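/- **Setting.** Fix a horizon $T$ and dimensions $n,m$. For each $t\in\{0,\dots,T\}$ let $\varXi_t$ be a set of parameters in a normed space (which may depend on $t$) with $\|\xi-\xi'\|\le 1$ for all $\xi,\xi'\in\varXi_t$. For parameters $\xi$ let $A_t(\xi)\in\mathbb R^{n\times n}$, $B_t(\xi)\in\mathbb R^{n\times m}$, $w_t(\xi),\bar x_t(\xi)\in\mathbb R^n$, $Q_t(\xi)\in\mathbb R^{n\times n}$, $R_t(\xi)\in\mathbb R^{m\times m}$, $P_T(\xi)\in\mathbb R^{n\times n}$ be given. For true parameters $\xi_t^*\in\varXi_t$ and an initial state $x(0)$ consider $$\min_{x_{0:T},u_{0:T-1}}\ \sum_{t=0}^{T-1}\Big((x_t-\bar x_t(\xi_t^*))^\top Q_t(\xi_t^*)(x_t-\bar x_t(\xi_t^*))+u_t^\top R_t(\xi_t^*)u_t\Big)+F_T(x_T;\xi_T^*)$$ subject to $x_{t+1}=A_t(\xi_t^*)x_t+B_t(\xi_t^*)u_t+w_t(\xi_t^*)$ for $0\le t<T$ and $x_0=x(0)$, where $F_T(x;\xi)=(x-\bar x_T(\xi))^\top P_T(\xi)(x-\bar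 x_T(\xi))$. Let $\mathsf{OPT}$, with states $x_t^*$, be an optimal trajectory. At time $t$ the controller receives predictions $\xi_{s|t}\in\varXi_s$ of $\xi_s^*$ for $t\le s\le\min\{t+k,T\}$. Put $\rho_{t,\tau}=\|\xi_{t+\tau|t}-\xi_{t+\tau}^*\|$ if $t+\tau\le T$ and $\rho_{t,\tau}=0$ otherwise, and $P(\tau)=\sum_{t=0}^{T-\tau}\rho_{t,\tau}^2$. At each time $t<T$, $\mathsf{MPC}_k$ applies to the true system the first input of an optimal solution, from its current state, of the problem over $[t,\min\{t+k,T\}]$ in which the true parameters are replaced by the predictions made at time $t$; if $t+k<T$, the terminal cost is the indicator of the point $\bar x_{t+k}(\xi_{t+k|t})$ ($0$ at this point, $+\infty$ elsewhere), and if $t+k\ge T$ it is $F_T(\cdot;\xi_{T|t})$. **Assumptions.** Norms of vectors are Euclidean and norms of matrices are spectral. For constants $\mu,\sigma>0$ and $\ell,a,b,D_w,D_{\bar x},D_{x^*},L_A,L_B,L_Q,L_R,L_P,L_{\bar x},L_w\ge0$, all parameters in the sets $\varXi_t$ and all times: 1. $\mu I\preceq Q_t(\xi_t)\preceq\ell I$,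 $\mu I\preceq R_t(\xi_t)\preceq\ell I$, $\mu I\preceq P_T(\xi_T)\preceq\ell I$; 2. $\|A_t(\xi_t)\|\le a$, $\|B_t(\xi_t)\|\le b$, $\|w_t(\xi_t)\|\le D_w$, $\|\bar x_t(\xi_t)\|\le D_{\bar x}$, and $A_t,B_t,Q_t,R_t,P_T,\bar x_t,w_t$ are Lipschitz on $\varXi_t$ with constants $L_A,L_B,L_Q,L_R,L_P,L_{\bar x},L_w$; 3. for $t_1\le t_2$ let $N_{t_1}^{t_2}$ be the matrix of the linear map $(x_{t_1},u_{t_1},x_{t_1+1},\dots,u_{t_2},x_{t_2+1})\mapsto(x_{t_1},\,x_{s+1}-A_s(\xi_s)x_s-B_s(\xi_s)u_s)_{t_1\le s\le t_2}$, and $\hat N_{t_1}^{t_2}$ the same matrix without the block column of $x_{t_2+1}$. Then $\sigma_{\min}(N_t^{T-1}(\xi_{t:T-1}))\ge\sigma$ for all $t<T$ and $\sigma_{\min}(\hat N_t^{t+k-1}(\xi_{t:t+k-1}))\ge\sigma$ for all $t<T-k$, where $\sigma_{\min}(N)=\lambda_{\min}(NN^\top)^{1/2}$; 4. $\|x_t^*\|\le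 D_{x^*}$ for all $t\le T$. **Theorem.** There is $\lambda_2\in(0,1)$ that depends only on $\mu,\ell,\sigma,a,b$, and there are $k_0\in\mathbb N$, $\delta>0$ and $C$ that depend only on the constants listed above (not on $T,k,n,m$, the parameter spaces, the system, $x(0)$, $\xi^*$ or the predictions), such that the following holds. If the assumptions hold, $k\ge k_0$, and $\sum_{\tau=0}^k\lambda_2^{2\tau}\rho_{t,\tau}\le\delta$ for all $t<T$, then $\mathsf{MPC}_k$ is well defined (all its optimization problems have solutions), and $$\mathrm{cost}(\mathsf{MPC}_k)-\mathrm{cost}(\mathsf{OPT})\le C\left(\sqrt{T\sum_{\tau=0}^{k-1}\lambda_2^\tau P(\tau)+\lambda_2^{2k}T^2}+\sum_{\tau=0}^{k-1}\lambda_2^\tau P(\tau)\right).$$ -/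

import Mathlib

open scoped NNReal Matrix

universe u

/-- Vectors of `ℝ^n`, with the Euclidean norm. -/
abbrev Vec (n : ℕ) := EuclideanSpace ℝ (Fin n)

/-- A parameterised LTV tracking problem of horizon `T`, with states in `ℝ^n` and inputs in `ℝ^m`:
for each time `t` a set `Ξ t` of admissible parameters (in a normed space `E t` that may vary with
`t`), and the cost and dynamics data as functions of the parameter. -/
structure LTVTracking (T n m : ℕ) (E : ℕ → Type u) where
  Ξ : ∀ t, Set (E t)
  A : ∀ t, E t → Matrix (Fin n) (Fin n) ℝ
  B : ∀ t, E t → Matrix (Fin n) (Fin m) ℝ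
  w : ∀ t, E t → Vec n
  xbar : ∀ t, E t → Vec n
  Q : ∀ t, E t → Matrix (Fin n) (Fin n) ℝ
  R : ∀ t, E t → Matrix (Fin m) (Fin m) ℝ
  PT : E T → Matrix (Fin n) (Fin n) ℝ

/-- The quadratic form `xᵀ M x`. -/
noncomputable def quadForm {n : ℕ} (M : Matrix (Fin n) (Fin n) ℝ) (x : Vec n) : ℝ :=
  x.ofLp ⬝ᵥ (M *ᵥ x.ofLp)

/-- The matrix `N` of the dynamics over the `K` steps `t, …, t + K - 1`:
block row `0` is `(I, 0, …)`, and block row `j + 1` has `-A_{t+j}` in the column of the state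
`y_{t+j}`, `-B_{t+j}` in the column of the input `v_{t+j}` and `I` in the column of `y_{t+j+1}`.
(The columns of the states come first, then those of the inputs; the order of the columns is
irrelevant for singular values.) -/
def dynMatrix {n m : ℕ} (A : ℕ → Matrix (Fin n) (Fin n) ℝ) (B : ℕ → Matrix (Fin n) (Fin m) ℝ)
    (t K : ℕ) :
    Matrix (Fin (K + 1) × Fin n) ((Fin (K + 1) × Fin n) ⊕ (Fin K × Fin m)) ℝ :=
  Matrix.of fun r c =>
    match c with
    | Sum.inl c =>
        (if (r.1 : ℕ) = c.1 then (1 : Matrix (Fin n) (Fin n) ℝ) r.2 c.2 else 0)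
          - (if (r.1 : ℕ) = c.1 + 1 then A (t + c.1) r.2 c.2 else 0)
    | Sum.inr c => -(if (r.1 : ℕ) = c.1 + 1 then B (t + c.1) r.2 c.2 else 0)

/-- The matrix `N̂`: `dynMatrix` without the block column of the last state `y_{t+K}`. -/
def dynMatrixHat {n m : ℕ} (A : ℕ → Matrix (Fin n) (Fin n) ℝ)
    (B : ℕ → Matrix (Fin n) (Fin m) ℝ) (t K : ℕ) :
    Matrix (Fin (K + 1) × Fin n) ((Fin K × Fin n) ⊕ (Fin K × Fin m)) ℝ :=
  (dynMatrix A B t K).submatrix id (Sum.map (Prod.map Fin.castSucc id) id)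

/-- `σ_min(M) ≥ σ`, where the singular values of `M` are counted by its rows (that is, they are the
square roots of the eigenvalues of `M Mᵀ`), so that for `σ > 0` this includes full row rank. -/
def SigmaMinGE {p q : Type} [Fintype p] [DecidableEq p] [Fintype q] [DecidableEq q]
    (M : Matrix p q ℝ) (σ : ℝ) : Prop :=
  ∀ i < Fintype.card p, σ ≤ (Matrix.toEuclideanLin Mᵀ).singularValues i

namespace LTVTracking

variable {T n m : ℕ} {E : ℕ → Type u}

/-- The dynamics `g_t(x, u; ξ) = A_t(ξ) x + B_t(ξ) u + w_t(ξ)`. -/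
noncomputable def step (S : LTVTracking T n m E) (t : ℕ) (ξ : E t) (x : Vec n) (v : Vec m) :
    Vec n :=
  Matrix.toEuclideanLin (S.A t ξ) x + Matrix.toEuclideanLin (S.B t ξ) v + S.w t ξ

/-- The stage cost `(x - x̄_t(ξ))ᵀ Q_t(ξ) (x - x̄_t(ξ)) + uᵀ R_t(ξ) u`. -/
noncomputable def stageCost (S : LTVTracking T n m E) (t : ℕ) (ξ : E t) (x : Vec n) (v : Vec m) :
    ℝ :=
  quadForm (S.Q t ξ) (x - S.xbar t ξ) + quadForm (S.R t ξ) v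

/-- The terminal cost `F_T(x; ξ) = (x - x̄_T(ξ))ᵀ P_T(ξ) (x - x̄_T(ξ))`. -/
noncomputable def terminalCost (S : LTVTracking T n m E) (ξ : E T) (x : Vec n) : ℝ :=
  quadForm (S.PT ξ) (x - S.xbar T ξ)

/-- `(y, v)` is a trajectory over `[t₁, t₂]` from `z`, for the parameters `ξ`.
Only the values `y_{t₁}, …, y_{t₂}` and `v_{t₁}, …, v_{t₂-1}` matter. -/
def IsTrajectory (S : LTVTracking T n m E) (ξ : ∀ t, E t) (t₁ t₂ : ℕ) (z : Vec n)
    (y : ℕ → Vec n) (v : ℕ → Vec m) : Prop :=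
  y t₁ = z ∧ ∀ s, t₁ ≤ s → s < t₂ → y (s + 1) = S.step s (ξ s) (y s) (v s)

/-- The objective of the finite-time optimal control problem over `[t₁, t₂]` with an extended-valued
terminal cost `F`. -/
noncomputable def ftocpCost (S : LTVTracking T n m E) (ξ : ∀ t, E t) (t₁ t₂ : ℕ)
    (F : Vec n → EReal) (y : ℕ → Vec n) (v : ℕ → Vec m) : EReal :=
  ((∑ s ∈ Finset.Ico t₁ t₂, S.stageCost s (ξ s) (y s) (v s) : ℝ) : EReal) + F (y t₂)

/-- `(y, v)` is an optimal solution of the finite-time optimal control problem over `[t₁, t₂]` with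
initial state `z`, parameters `ξ` and terminal cost `F`. -/
def IsFTOCPSolution (S : LTVTracking T n m E) (ξ : ∀ t, E t) (t₁ t₂ : ℕ) (z : Vec n)
    (F : Vec n → EReal) (y : ℕ → Vec n) (v : ℕ → Vec m) : Prop :=
  S.IsTrajectory ξ t₁ t₂ z y v ∧
    ∀ (y' : ℕ → Vec n) (v' : ℕ → Vec m), S.IsTrajectory ξ t₁ t₂ z y' v' →
      S.ftocpCost ξ t₁ t₂ F y v ≤ S.ftocpCost ξ t₁ t₂ F y' v'

/-- An offline optimal trajectory from `x₀`, for the true parameters `ξ`. -/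
def IsOfflineOptimal (S : LTVTracking T n m E) (ξ : ∀ t, E t) (x₀ : Vec n)
    (x : ℕ → Vec n) (v : ℕ → Vec m) : Prop :=
  S.IsFTOCPSolution ξ 0 T x₀ (fun y => (S.terminalCost (ξ T) y : EReal)) x v

/-- The total cost of a trajectory for the true parameters `ξ`. -/
noncomputable def totalCost (S : LTVTracking T n m E) (ξ : ∀ t, E t)
    (x : ℕ → Vec n) (v : ℕ → Vec m) : ℝ :=
  ∑ t ∈ Finset.range T, S.stageCost t (ξ t) (x t) (v t) + S.terminalCost (ξ T) (x T)

open Classical in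
/-- The terminal cost that `MPC_k` uses at time `t`, when it holds the predictions `ζ`: the
indicator of the predicted target `x̄_{t+k}(ζ_{t+k})` if `t + k < T`, and the predicted true
terminal cost otherwise. -/
noncomputable def mpcTerminal (S : LTVTracking T n m E) (k t : ℕ) (ζ : ∀ s, E s) (y : Vec n) :
    EReal :=
  if t + k < T then (if y = S.xbar (t + k) (ζ (t + k)) then 0 else ⊤)
  else (S.terminalCost (ζ T) y : EReal)

/-- `(x, v)` is the closed-loop trajectory of `MPC_k` from `x₀`: at each time `t < T` the first input
of an optimal solution of the predicted problem over `[t, min (t+k) T]` is applied to the true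
system. `ξ` are the true parameters, and `pred t s` is the prediction of `ξ s` made at time `t`. -/
def IsMPCTrajectory (S : LTVTracking T n m E) (k : ℕ) (ξ : ∀ t, E t) (pred : ℕ → ∀ s, E s)
    (x₀ : Vec n) (x : ℕ → Vec n) (v : ℕ → Vec m) : Prop :=
  x 0 = x₀ ∧ ∀ t < T,
    (∃ (y' : ℕ → Vec n) (v' : ℕ → Vec m),
      S.IsFTOCPSolution (pred t) t (min (t + k) T) (x t) (S.mpcTerminal k t (pred t)) y' v' ∧
        v t = v' t) ∧
    x (t + 1) = S.step t (ξ t) (x t) (v t)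

open scoped Matrix.Norms.L2Operator in
/-- The assumptions on the tracking problem, for prediction horizon `k`. Matrix norms are spectral
norms. -/
structure Assumptions [∀ t, NormedAddCommGroup (E t)] (S : LTVTracking T n m E) (k : ℕ)
    (μ ℓ σ a b Dw Dx LA LB LQ LR LP Lx Lw : ℝ) : Prop where
  /-- the parameter sets have diameter at most one -/
  diam : ∀ t ≤ T, ∀ ξ ∈ S.Ξ t, ∀ ξ' ∈ S.Ξ t, ‖ξ - ξ'‖ ≤ 1
  Q_lower : ∀ t < T, ∀ ξ ∈ S.Ξ t, (S.Q t ξ - μ • 1).PosSemidef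
  Q_upper : ∀ t < T, ∀ ξ ∈ S.Ξ t, (ℓ • 1 - S.Q t ξ).PosSemidef
  R_lower : ∀ t < T, ∀ ξ ∈ S.Ξ t, (S.R t ξ - μ • 1).PosSemidef
  R_upper : ∀ t < T, ∀ ξ ∈ S.Ξ t, (ℓ • 1 - S.R t ξ).PosSemidef
  PT_lower : ∀ ξ ∈ S.Ξ T, (S.PT ξ - μ • 1).PosSemidef
  PT_upper : ∀ ξ ∈ S.Ξ T, (ℓ • 1 - S.PT ξ).PosSemidef
  /-- uniform stabilizability up to the final time -/
  stab : ∀ t < T, ∀ ξ : ∀ s, E s, (∀ s, t ≤ s → s < T → ξ s ∈ S.Ξ s) →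
    SigmaMinGE (dynMatrix (fun s => S.A s (ξ s)) (fun s => S.B s (ξ s)) t (T - t)) σ
  /-- uniform controllability over each prediction window `[t, t + k]` -/
  ctrl : ∀ t, t + k < T → ∀ ξ : ∀ s, E s, (∀ s, t ≤ s → s < t + k → ξ s ∈ S.Ξ s) →
    SigmaMinGE (dynMatrixHat (fun s => S.A s (ξ s)) (fun s => S.B s (ξ s)) t k) σ
  A_bound : ∀ t < T, ∀ ξ ∈ S.Ξ t, ‖S.A t ξ‖ ≤ a
  B_bound : ∀ t < T, ∀ ξ ∈ S.Ξ t, ‖S.B t ξ‖ ≤ b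
  w_bound : ∀ t < T, ∀ ξ ∈ S.Ξ t, ‖S.w t ξ‖ ≤ Dw
  xbar_bound : ∀ t ≤ T, ∀ ξ ∈ S.Ξ t, ‖S.xbar t ξ‖ ≤ Dx
  A_lip : ∀ t < T, ∀ ξ ∈ S.Ξ t, ∀ ξ' ∈ S.Ξ t, ‖S.A t ξ - S.A t ξ'‖ ≤ LA * ‖ξ - ξ'‖
  B_lip : ∀ t < T, ∀ ξ ∈ S.Ξ t, ∀ ξ' ∈ S.Ξ t, ‖S.B t ξ - S.B t ξ'‖ ≤ LB * ‖ξ - ξ'‖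
  Q_lip : ∀ t < T, ∀ ξ ∈ S.Ξ t, ∀ ξ' ∈ S.Ξ t, ‖S.Q t ξ - S.Q t ξ'‖ ≤ LQ * ‖ξ - ξ'‖
  R_lip : ∀ t < T, ∀ ξ ∈ S.Ξ t, ∀ ξ' ∈ S.Ξ t, ‖S.R t ξ - S.R t ξ'‖ ≤ LR * ‖ξ - ξ'‖
  PT_lip : ∀ ξ ∈ S.Ξ T, ∀ ξ' ∈ S.Ξ T, ‖S.PT ξ - S.PT ξ'‖ ≤ LP * ‖ξ - ξ'‖
  xbar_lip : ∀ t ≤ T, ∀ ξ ∈ S.Ξ t, ∀ ξ' ∈ S.Ξ t, ‖S.xbar t ξ - S.xbar t ξ'‖ ≤ Lx * ‖ξ - ξ'‖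
  w_lip : ∀ t < T, ∀ ξ ∈ S.Ξ t, ∀ ξ' ∈ S.Ξ t, ‖S.w t ξ - S.w t ξ'‖ ≤ Lw * ‖ξ - ξ'‖

end LTVTracking

/-- The prediction error `ρ_{t,τ} = ‖ξ_{t+τ|t} - ξ*_{t+τ}‖`, with value `0` if `t + τ > T`. -/
noncomputable def predErr {E : ℕ → Type u} [∀ t, NormedAddCommGroup (E t)] (T : ℕ)
    (ξ : ∀ t, E t) (pred : ℕ → ∀ s, E s) (t τ : ℕ) : ℝ :=
  if t + τ ≤ T then ‖pred t (t + τ) - ξ (t + τ)‖ else 0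

/-- The power of the `τ`-step-away predictions `P(τ) = ∑_{t=0}^{T-τ} ρ_{t,τ}²`. -/
noncomputable def predPower {E : ℕ → Type u} [∀ t, NormedAddCommGroup (E t)] (T : ℕ)
    (ξ : ∀ t, E t) (pred : ℕ → ∀ s, E s) (τ : ℕ) : ℝ :=
  ∑ t ∈ Finset.range (T + 1 - τ), predErr T ξ pred t τ ^ 2

open scoped InnerProductSpace

set_option linter.unusedSectionVars false

/-! The problems are strongly convex, so their minimisers are the solutions of a linear optimality
system in states, inputs and multipliers. Testing this system with its own solution bounds states
and inputs by the residuals, up to a small multiple of the multipliers, and the singular value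
assumption bounds the multipliers. The resulting estimate of the solution by its residuals has a
constant independent of the horizon (`LQData.Regular.solSq_le`). Since the system couples
neighbouring times only, the estimate survives slowly varying weights. The weights `(1 + ε) ^ (-|i -
j|)` turn it into exponential decay: a residual at time `i` moves the solution at time `j` by order
`γ ^ |i - j|` (`LQData.Regular.decay`).

The truly optimal solution from the current state `x t`, inserted into the predicted optimality
system, leaves a residual of order `(1 + ‖x t‖) ρ_{t,τ}` at `τ` steps ahead and a bounded multiple
of `1 + ‖x t‖` at the end of the window. By decay, the input of the controller differs from the
optimal input at `x t` by `e_t ≤ C (1 + ‖x t‖) (∑ γ ^ τ ρ_{t,τ} + γ ^ k)` (`norm_mpc_input_sub_le`).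

Old input errors are forgotten geometrically along optimal trajectories. When the prediction errors
are small and `k` is large, a small-gain induction therefore keeps the closed loop bounded
(`one_add_norm_le_of_input_err_le`). One wrong input followed by optimal behaviour costs only `O(e_t
^ 2)` (`stageCost_add_costToGo_le`), and the optimal costs-to-go telescope, so the regret is `O(∑
e_t ^ 2)` (`totalCost_sub_le_sum`). Cauchy–Schwarz bounds this by a multiple of `∑ λ ^ τ P(τ) + T γ
^ (2k)` with `λ = √γ`. The square root in the final bound serves only to dominate `T γ ^ (2k)`. -/

theorem LinearMap.norm_adjoint_apply_le {X Y : Type*} [NormedAddCommGroup X]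
    [InnerProductSpace ℝ X] [FiniteDimensional ℝ X] [NormedAddCommGroup Y] [InnerProductSpace ℝ Y]
    [FiniteDimensional ℝ Y] (f : X →ₗ[ℝ] Y) {c : ℝ} (hc₀ : 0 ≤ c) (hc : ∀ x, ‖f x‖ ≤ c * ‖x‖)
    (y : Y) : ‖f.adjoint y‖ ≤ c * ‖y‖ := by
  rcases eq_or_ne (f.adjoint y) 0 with h | h
  · rw [h, norm_zero]; positivity
  · have h1 : ‖f.adjoint y‖ ^ 2 ≤ c * ‖f.adjoint y‖ * ‖y‖ := by
      rw [← real_inner_self_eq_norm_sq, LinearMap.adjoint_inner_left, real_inner_comm]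
      exact (real_inner_le_norm _ _).trans
        (mul_le_mul_of_nonneg_right (hc _) (norm_nonneg _))
    have h2 := norm_pos_iff.2 h
    nlinarith

theorem norm_add_sq_le_two_mul {X : Type*} [SeminormedAddCommGroup X] (x y : X) :
    ‖x + y‖ ^ 2 ≤ 2 * ‖x‖ ^ 2 + 2 * ‖y‖ ^ 2 := by
  have h := norm_add_le x y
  nlinarith [norm_nonneg (x + y), sq_nonneg (‖x‖ - ‖y‖), norm_nonneg x, norm_nonneg y]

theorem norm_sub_sq_le_two_mul {X : Type*} [SeminormedAddCommGroup X] (x y : X) :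
    ‖x - y‖ ^ 2 ≤ 2 * ‖x‖ ^ 2 + 2 * ‖y‖ ^ 2 := by
  simpa [sub_eq_add_neg] using norm_add_sq_le_two_mul x (-y)

/-! ### Abstract linear-quadratic optimality systems: an a priori estimate uniform in the horizon.
-/

/-- The linear data of a finite-horizon linear-quadratic problem with `K` steps: dynamics `A`, `B`,
cost operators `Q`, `R`, and a terminal condition `E y + F l = p` that couples the final state `y`
with its multiplier `l`. -/
structure LQData (X U : Type*) [NormedAddCommGroup X] [InnerProductSpace ℝ X]
    [NormedAddCommGroup U] [InnerProductSpace ℝ U] where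
  A : ℕ → X →ₗ[ℝ] X
  B : ℕ → U →ₗ[ℝ] X
  Q : ℕ → X →ₗ[ℝ] X
  R : ℕ → U →ₗ[ℝ] U
  E : X →ₗ[ℝ] X
  F : X →ₗ[ℝ] X
  K : ℕ

namespace LQData

variable {X U : Type*} [NormedAddCommGroup X] [InnerProductSpace ℝ X] [FiniteDimensional ℝ X]
  [NormedAddCommGroup U] [InnerProductSpace ℝ U] [FiniteDimensional ℝ U]

/-- The residual of stationarity in the states, with the terminal condition at time `K`. -/
noncomputable def resP (D : LQData X U) (y l : ℕ → X) (i : ℕ) : X :=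
  if i < D.K then D.Q i (y i) + l i - (D.A i).adjoint (l (i + 1)) else D.E (y i) + D.F (l i)

/-- The residual of stationarity in the inputs. -/
noncomputable def resG (D : LQData X U) (v : ℕ → U) (l : ℕ → X) (i : ℕ) : U :=
  if i < D.K then D.R i (v i) - (D.B i).adjoint (l (i + 1)) else 0

theorem resP_of_lt {D : LQData X U} {i : ℕ} (h : i < D.K) (y l : ℕ → X) :
    D.resP y l i = D.Q i (y i) + l i - (D.A i).adjoint (l (i + 1)) := if_pos h

theorem resP_last (D : LQData X U) (y l : ℕ → X) :
    D.resP y l D.K = D.E (y D.K) + D.F (l D.K) := if_neg (lt_irrefl _)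

theorem resG_of_lt {D : LQData X U} {i : ℕ} (h : i < D.K) (v : ℕ → U) (l : ℕ → X) :
    D.resG v l i = D.R i (v i) - (D.B i).adjoint (l (i + 1)) := if_pos h

theorem resG_of_not_lt {D : LQData X U} {i : ℕ} (h : ¬ i < D.K) (v : ℕ → U) (l : ℕ → X) :
    D.resG v l i = 0 := if_neg h

/-- The residual of the dynamics, with the initial state at time `0`. -/
def resQ (D : LQData X U) (y : ℕ → X) (v : ℕ → U) : ℕ → X
  | 0 => y 0
  | i + 1 => y (i + 1) - D.A i (y i) - D.B i (v i)

/-- The squared norm of a triple of states, inputs and multipliers. -/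
def solSq (D : LQData X U) (y : ℕ → X) (v : ℕ → U) (l : ℕ → X) : ℝ :=
  ∑ i ∈ Finset.range (D.K + 1), ‖y i‖ ^ 2 + ∑ i ∈ Finset.range D.K, ‖v i‖ ^ 2
    + ∑ i ∈ Finset.range (D.K + 1), ‖l i‖ ^ 2

/-- The squared norm of the residual at time `i`. -/
noncomputable def resSq (D : LQData X U) (y : ℕ → X) (v : ℕ → U) (l : ℕ → X) (i : ℕ) : ℝ :=
  ‖D.resP y l i‖ ^ 2 + ‖D.resG v l i‖ ^ 2 + ‖D.resQ y v i‖ ^ 2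

/-- The norm of the residual at time `i`. -/
noncomputable def resNorm (D : LQData X U) (y : ℕ → X) (v : ℕ → U) (l : ℕ → X) (i : ℕ) : ℝ :=
  ‖D.resP y l i‖ + ‖D.resG v l i‖ + ‖D.resQ y v i‖

/-- Uniform bounds on linear-quadratic data. -/
structure Regular (D : LQData X U) (μ ℓ σ a b : ℝ) : Prop where
  Q_lower : ∀ i < D.K, ∀ x, μ * ‖x‖ ^ 2 ≤ ⟪x, D.Q i x⟫_ℝ
  Q_upper : ∀ i < D.K, ∀ x, ‖D.Q i x‖ ≤ ℓ * ‖x‖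
  R_lower : ∀ i < D.K, ∀ x, μ * ‖x‖ ^ 2 ≤ ⟪x, D.R i x⟫_ℝ
  R_upper : ∀ i < D.K, ∀ x, ‖D.R i x‖ ≤ ℓ * ‖x‖
  A_bound : ∀ i < D.K, ∀ x, ‖D.A i x‖ ≤ a * ‖x‖
  B_bound : ∀ i < D.K, ∀ x, ‖D.B i x‖ ≤ b * ‖x‖
  -- Weak enough to cover both terminal conditions in use: `P y + l = p` for a quadratic terminal
  -- cost, and `y = p` with a free multiplier for a prescribed final state.
  term : ∀ y l, μ * ‖y‖ ^ 2 ≤ -⟪y, l⟫_ℝ + ‖D.E y + D.F l‖ * (‖y‖ + ‖l‖)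
    + μ * ‖D.E y + D.F l‖ ^ 2
  -- A lower bound for the transposed dynamics matrix applied to the multipliers. The last two terms
  -- pay for the final multiplier, which a quadratic terminal cost ties to the final state.
  stab : ∀ (l : ℕ → X) (y : X), σ ^ 2 * ∑ i ∈ Finset.range (D.K + 1), ‖l i‖ ^ 2 ≤
    ∑ i ∈ Finset.range D.K, (‖l i - (D.A i).adjoint (l (i + 1))‖ ^ 2
      + ‖(D.B i).adjoint (l (i + 1))‖ ^ 2)
      + 2 * ‖D.E y + D.F (l D.K)‖ ^ 2 + 2 * ℓ ^ 2 * ‖y‖ ^ 2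

/-- Summation by parts: the adjoint terms in the stationarity residuals combine with the dynamics,
so multipliers meet only dynamics residuals and the boundary. Any `N` is allowed for the sake of the
induction. -/
theorem sum_inner_res (D : LQData X U) (y : ℕ → X) (v : ℕ → U) (l : ℕ → X) (N : ℕ) :
    ∑ i ∈ Finset.range N, (⟪y i, D.Q i (y i) + l i - (D.A i).adjoint (l (i + 1))⟫_ℝ
        + ⟪v i, D.R i (v i) - (D.B i).adjoint (l (i + 1))⟫_ℝ)
      = ∑ i ∈ Finset.range N, (⟪y i, D.Q i (y i)⟫_ℝ + ⟪v i, D.R i (v i)⟫_ℝ)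
        + ∑ i ∈ Finset.range (N + 1), ⟪D.resQ y v i, l i⟫_ℝ - ⟪y N, l N⟫_ℝ := by
  induction N with
  | zero => simp [resQ]
  | succ N ih =>
    have hres : D.resQ y v (N + 1) = y (N + 1) - D.A N (y N) - D.B N (v N) := rfl
    rw [Finset.sum_range_succ, ih, Finset.sum_range_succ
      (fun i => ⟪y i, D.Q i (y i)⟫_ℝ + ⟪v i, D.R i (v i)⟫_ℝ) N,
      Finset.sum_range_succ (fun i => ⟪D.resQ y v i, l i⟫_ℝ) (N + 1), hres]
    simp only [inner_sub_right, inner_add_right, inner_sub_left,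
      LinearMap.adjoint_inner_right]
    ring

theorem mul_le_young {η : ℝ} (hη : 0 < η) (x y : ℝ) :
    x * y ≤ η * x ^ 2 + 1 / (4 * η) * y ^ 2 := by
  have h2 : 0 ≤ (2 * η * x - y) ^ 2 / (4 * η) := by positivity
  have h3 : (2 * η * x - y) ^ 2 / (4 * η)
      = η * x ^ 2 + 1 / (4 * η) * y ^ 2 - x * y := by
    field_simp; ring
  linarith

theorem inner_le_young {X : Type*} [NormedAddCommGroup X] [InnerProductSpace ℝ X] {η : ℝ}
    (hη : 0 < η) (x y : X) : ⟪x, y⟫_ℝ ≤ η * ‖x‖ ^ 2 + 1 / (4 * η) * ‖y‖ ^ 2 :=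
  (real_inner_le_norm x y).trans (mul_le_young hη ‖x‖ ‖y‖)

variable {D : LQData X U} {μ ℓ σ a b : ℝ}

/-- Stationarity expresses `l i - A* l (i + 1)` and `B* l (i + 1)` through residuals, `Q y` and `R
v`; these are exactly the quantities on the right of `stab`. -/
theorem Regular.sum_multiplier_sq_le (h : D.Regular μ ℓ σ a b) (y : ℕ → X) (v : ℕ → U)
    (l : ℕ → X) :
    σ ^ 2 * ∑ i ∈ Finset.range (D.K + 1), ‖l i‖ ^ 2 ≤
      2 * ∑ i ∈ Finset.range (D.K + 1), D.resSq y v l i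
      + 2 * ℓ ^ 2 * (∑ i ∈ Finset.range (D.K + 1), ‖y i‖ ^ 2
        + ∑ i ∈ Finset.range D.K, ‖v i‖ ^ 2) := by
  refine (h.stab l (y D.K)).trans ?_
  rw [Finset.sum_range_succ _ D.K, Finset.sum_range_succ _ D.K]
  have hK : ‖D.E (y D.K) + D.F (l D.K)‖ ^ 2 ≤ D.resSq y v l D.K := by
    simp only [resSq, resP, lt_irrefl, if_false]
    linarith [sq_nonneg ‖D.resG v l D.K‖, sq_nonneg ‖D.resQ y v D.K‖]
  have hs : ∑ i ∈ Finset.range D.K, (‖l i - (D.A i).adjoint (l (i + 1))‖ ^ 2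
      + ‖(D.B i).adjoint (l (i + 1))‖ ^ 2) ≤
      ∑ i ∈ Finset.range D.K, (2 * D.resSq y v l i + 2 * ℓ ^ 2 * (‖y i‖ ^ 2 + ‖v i‖ ^ 2)) := by
    refine Finset.sum_le_sum fun i hi => ?_
    have hi := Finset.mem_range.1 hi
    have h1 : l i - (D.A i).adjoint (l (i + 1)) = D.resP y l i - D.Q i (y i) := by
      simp only [resP, hi, if_true]; abel
    have h2 : (D.B i).adjoint (l (i + 1)) = D.R i (v i) - D.resG v l i := by
      simp only [resG, hi, if_true]; abel
    rw [h1, h2]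
    have h3 := norm_sub_sq_le_two_mul (D.resP y l i) (D.Q i (y i))
    have h4 := norm_sub_sq_le_two_mul (D.R i (v i)) (D.resG v l i)
    have h5 : ‖D.Q i (y i)‖ ^ 2 ≤ ℓ ^ 2 * ‖y i‖ ^ 2 := by
      rw [← mul_pow]; exact pow_le_pow_left₀ (norm_nonneg _) (h.Q_upper i hi _) 2
    have h6 : ‖D.R i (v i)‖ ^ 2 ≤ ℓ ^ 2 * ‖v i‖ ^ 2 := by
      rw [← mul_pow]; exact pow_le_pow_left₀ (norm_nonneg _) (h.R_upper i hi _) 2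
    have h7 := sq_nonneg ‖D.resQ y v i‖
    simp only [resSq]
    linarith
  rw [Finset.sum_add_distrib (f := fun i => 2 * D.resSq y v l i), ← Finset.mul_sum,
    ← Finset.mul_sum, Finset.sum_add_distrib (f := fun i => ‖y i‖ ^ 2)] at hs
  linarith

/-- Coercivity of the costs in the identity `sum_inner_res`, with Young's inequality on each
product. The free `η` keeps the multipliers' share small; it occurs twice, for the dynamics
residuals and for the terminal condition. -/
theorem Regular.energy_le (h : D.Regular μ ℓ σ a b) (hμ : 0 < μ) {η : ℝ} (hη : 0 < η)
    (y : ℕ → X) (v : ℕ → U) (l : ℕ → X) :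
    μ * (∑ i ∈ Finset.range (D.K + 1), ‖y i‖ ^ 2 + ∑ i ∈ Finset.range D.K, ‖v i‖ ^ 2) ≤
      μ / 4 * (∑ i ∈ Finset.range (D.K + 1), ‖y i‖ ^ 2 + ∑ i ∈ Finset.range D.K, ‖v i‖ ^ 2)
      + 2 * η * ∑ i ∈ Finset.range (D.K + 1), ‖l i‖ ^ 2
      + (1 / μ + 1 / (2 * η) + μ) * ∑ i ∈ Finset.range (D.K + 1), D.resSq y v l i := by
  have hid := D.sum_inner_res y v l D.K
  have hμ4 : 0 < μ / 4 := by positivity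
  have hinv : 1 / (4 * (μ / 4)) = 1 / μ := by field_simp
  have hinv2 : 1 / (2 * η) = 2 * (1 / (4 * η)) := by field_simp; norm_num
  have hη4 : 0 < 1 / (4 * η) := by positivity
  have hμi : 0 < 1 / μ := by positivity
  have hlow : ∑ i ∈ Finset.range D.K, (μ * (‖y i‖ ^ 2 + ‖v i‖ ^ 2)) ≤
      ∑ i ∈ Finset.range D.K, (⟪y i, D.Q i (y i)⟫_ℝ + ⟪v i, D.R i (v i)⟫_ℝ) :=
    Finset.sum_le_sum fun i hi => by
      have hi := Finset.mem_range.1 hi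
      linarith [h.Q_lower i hi (y i), h.R_lower i hi (v i)]
  have hup : ∑ i ∈ Finset.range D.K,
      (⟪y i, D.Q i (y i) + l i - (D.A i).adjoint (l (i + 1))⟫_ℝ
        + ⟪v i, D.R i (v i) - (D.B i).adjoint (l (i + 1))⟫_ℝ) ≤
      ∑ i ∈ Finset.range D.K, (μ / 4 * (‖y i‖ ^ 2 + ‖v i‖ ^ 2)
        + 1 / μ * (‖D.resP y l i‖ ^ 2 + ‖D.resG v l i‖ ^ 2)) :=
    Finset.sum_le_sum fun i hi => by
      have hi := Finset.mem_range.1 hi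
      have h1 := inner_le_young hμ4 (y i) (D.resP y l i)
      have h2 := inner_le_young hμ4 (v i) (D.resG v l i)
      rw [hinv] at h1 h2
      simp only [resP, resG, hi, if_true] at h1 h2 ⊢
      linarith
  have hq : ∑ i ∈ Finset.range (D.K + 1), (-(η * ‖l i‖ ^ 2 + 1 / (4 * η) * ‖D.resQ y v i‖ ^ 2)) ≤
      ∑ i ∈ Finset.range (D.K + 1), ⟪D.resQ y v i, l i⟫_ℝ :=
    Finset.sum_le_sum fun i _ => by
      have h1 := inner_le_young hη (-l i) (D.resQ y v i)
      rw [norm_neg, inner_neg_left, real_inner_comm] at h1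
      linarith
  have hK := h.term (y D.K) (l D.K)
  have hpK : D.E (y D.K) + D.F (l D.K) = D.resP y l D.K := by simp [resP]
  rw [hpK] at hK
  have hK1 := mul_le_young hμ4 ‖y D.K‖ ‖D.resP y l D.K‖
  have hK2 := mul_le_young hη ‖l D.K‖ ‖D.resP y l D.K‖
  rw [hinv] at hK1
  have hlK : ‖l D.K‖ ^ 2 ≤ ∑ i ∈ Finset.range (D.K + 1), ‖l i‖ ^ 2 :=
    Finset.single_le_sum (f := fun i => ‖l i‖ ^ 2) (fun i _ => by positivity)
      (Finset.self_mem_range_succ _)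
  have hlK' := mul_le_mul_of_nonneg_left hlK hη.le
  have hG' : ∑ i ∈ Finset.range (D.K + 1), ‖D.resG v l i‖ ^ 2 =
      ∑ i ∈ Finset.range D.K, ‖D.resG v l i‖ ^ 2 := by
    rw [Finset.sum_range_succ]; simp [resG]
  have hP : 0 ≤ ∑ i ∈ Finset.range D.K, ‖D.resP y l i‖ ^ 2 := by positivity
  have hG : 0 ≤ ∑ i ∈ Finset.range D.K, ‖D.resG v l i‖ ^ 2 := by positivity
  have hR : 0 ≤ ∑ i ∈ Finset.range (D.K + 1), ‖D.resQ y v i‖ ^ 2 := by positivity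
  have hpk := sq_nonneg ‖D.resP y l D.K‖
  rw [hid] at hup
  rw [hinv2]
  simp only [resSq, Finset.sum_neg_distrib, Finset.sum_add_distrib, ← Finset.mul_sum] at hlow hup hq ⊢
  rw [hG', Finset.sum_range_succ (fun i => ‖y i‖ ^ 2) D.K,
    Finset.sum_range_succ (fun i => ‖D.resP y l i‖ ^ 2) D.K]
  generalize 1 / (4 * η) = e at *
  generalize 1 / μ = f at *
  have e1 := mul_nonneg hη4.le hP
  have e2 := mul_nonneg hη4.le hG
  have e3 := mul_nonneg hη4.le hR
  have e4 := mul_nonneg hη4.le hpk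
  have m1 := mul_nonneg hμ.le hP
  have m2 := mul_nonneg hμ.le hG
  have m3 := mul_nonneg hμ.le hR
  have f3 := mul_nonneg hμi.le hR
  linarith

/-- The constant of the a priori estimate. -/
noncomputable def aprioriConst (μ ℓ σ : ℝ) : ℝ :=
  (1 + 2 * ℓ ^ 2 / σ ^ 2) * (2 / μ * (μ / (4 * ℓ ^ 2)
    + 1 / μ + 8 * ℓ ^ 2 / (μ * σ ^ 2) + μ)) + 2 / σ ^ 2

theorem aprioriConst_pos (hμ : 0 < μ) (hℓ : 0 < ℓ) (hσ : 0 < σ) : 0 < aprioriConst μ ℓ σ := by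
  unfold aprioriConst; positivity

/-- Residuals of the optimality system control its solution, uniformly in the horizon. -/
theorem Regular.solSq_le (h : D.Regular μ ℓ σ a b) (hμ : 0 < μ) (hℓ : 0 < ℓ) (hσ : 0 < σ)
    (y : ℕ → X) (v : ℕ → U) (l : ℕ → X) :
    D.solSq y v l ≤ aprioriConst μ ℓ σ * ∑ i ∈ Finset.range (D.K + 1), D.resSq y v l i := by
  -- With this `η`, the multiplier bound turns `2 η L` into at most `μ / 4 * Y` plus residuals, so
  -- half of `μ * Y` remains on the left.
  have hη : 0 < μ * σ ^ 2 / (16 * ℓ ^ 2) := by positivity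
  have h1 := h.energy_le hμ hη y v l
  have h2 := h.sum_multiplier_sq_le y v l
  unfold solSq aprioriConst
  set Y := ∑ i ∈ Finset.range (D.K + 1), ‖y i‖ ^ 2 + ∑ i ∈ Finset.range D.K, ‖v i‖ ^ 2
  set L := ∑ i ∈ Finset.range (D.K + 1), ‖l i‖ ^ 2
  set r := ∑ i ∈ Finset.range (D.K + 1), D.resSq y v l i
  have h3 : L ≤ 2 / σ ^ 2 * r + 2 * ℓ ^ 2 / σ ^ 2 * Y := by
    have : 2 / σ ^ 2 * r + 2 * ℓ ^ 2 / σ ^ 2 * Y = (2 * r + 2 * ℓ ^ 2 * Y) / σ ^ 2 := by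
      field_simp
    rw [this, le_div_iff₀ (by positivity)]
    linarith
  have h4 : 2 * (μ * σ ^ 2 / (16 * ℓ ^ 2)) * L ≤ μ / (4 * ℓ ^ 2) * r + μ / 4 * Y := by
    refine (mul_le_mul_of_nonneg_left h3 (by positivity)).trans (le_of_eq ?_)
    field_simp; ring
  have h5 : 1 / (2 * (μ * σ ^ 2 / (16 * ℓ ^ 2))) = 8 * ℓ ^ 2 / (μ * σ ^ 2) := by
    field_simp; norm_num
  rw [h5] at h1
  have h6 : Y ≤ 2 / μ * (μ / (4 * ℓ ^ 2) + 1 / μ + 8 * ℓ ^ 2 / (μ * σ ^ 2) + μ) * r := by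
    have : μ / 2 * Y ≤ (μ / (4 * ℓ ^ 2) + 1 / μ + 8 * ℓ ^ 2 / (μ * σ ^ 2) + μ) * r := by linarith
    calc Y = 2 / μ * (μ / 2 * Y) := by field_simp
      _ ≤ _ := mul_le_mul_of_nonneg_left this (by positivity)
      _ = _ := by ring
  have h7 := mul_le_mul_of_nonneg_left h6 (a := 1 + 2 * ℓ ^ 2 / σ ^ 2) (by positivity)
  calc Y + L ≤ (1 + 2 * ℓ ^ 2 / σ ^ 2) * Y + 2 / σ ^ 2 * r := by linarith
    _ ≤ _ := by linarith

end LQData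

/-! ### Weighted estimates, exponential decay of the sensitivity, and solvability. -/

namespace LQData

variable {X U : Type*} [NormedAddCommGroup X] [InnerProductSpace ℝ X] [FiniteDimensional ℝ X]
  [NormedAddCommGroup U] [InnerProductSpace ℝ U] [FiniteDimensional ℝ U]
  {D : LQData X U} {μ ℓ σ a b : ℝ}

theorem resNorm_nonneg (y : ℕ → X) (v : ℕ → U) (l : ℕ → X) (i : ℕ) : 0 ≤ D.resNorm y v l i := by
  unfold resNorm; positivity

theorem resSq_le_resNorm_sq (y : ℕ → X) (v : ℕ → U) (l : ℕ → X) (i : ℕ) :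
    D.resSq y v l i ≤ D.resNorm y v l i ^ 2 := by
  unfold resSq resNorm
  nlinarith [norm_nonneg (D.resP y l i), norm_nonneg (D.resG v l i), norm_nonneg (D.resQ y v i),
    mul_nonneg (norm_nonneg (D.resP y l i)) (norm_nonneg (D.resG v l i)),
    mul_nonneg (norm_nonneg (D.resP y l i)) (norm_nonneg (D.resQ y v i)),
    mul_nonneg (norm_nonneg (D.resG v l i)) (norm_nonneg (D.resQ y v i))]

theorem norm_smul_sq_le_of_abs_le {Y Z : Type*} [NormedAddCommGroup Y] [NormedSpace ℝ Y]
    [NormedAddCommGroup Z] [NormedSpace ℝ Z]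
    {d e ε β : ℝ} {w : Y} {z : Z} (hd : |d| ≤ ε * |e|) (hw : ‖w‖ ≤ β * ‖z‖) :
    ‖d • w‖ ^ 2 ≤ ε ^ 2 * β ^ 2 * ‖e • z‖ ^ 2 := by
  have h1 : ‖d • w‖ ≤ ε * β * ‖e • z‖ := by
    rw [norm_smul, norm_smul, Real.norm_eq_abs, Real.norm_eq_abs]
    calc |d| * ‖w‖ ≤ (ε * |e|) * (β * ‖z‖) :=
          mul_le_mul hd hw (norm_nonneg _) ((abs_nonneg _).trans hd)
      _ = _ := by ring
  have h2 := pow_le_pow_left₀ (norm_nonneg _) h1 2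
  rwa [mul_pow, mul_pow] at h2

theorem norm_smul_add_smul_sq_le {Y Z : Type*} [NormedAddCommGroup Y] [NormedSpace ℝ Y]
    [NormedAddCommGroup Z] [NormedSpace ℝ Z]
    {c d e ε β : ℝ} {x w : Y} {z : Z} (hd : |d| ≤ ε * |e|) (hw : ‖w‖ ≤ β * ‖z‖) :
    ‖c • x + d • w‖ ^ 2 ≤ 2 * (c ^ 2 * ‖x‖ ^ 2) + 2 * (ε ^ 2 * β ^ 2 * ‖e • z‖ ^ 2) := by
  refine (norm_add_sq_le_two_mul _ _).trans (add_le_add (le_of_eq ?_) ?_)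
  · rw [norm_smul, mul_pow, Real.norm_eq_abs, sq_abs]
  · exact mul_le_mul_of_nonneg_left (norm_smul_sq_le_of_abs_le hd hw) zero_le_two

/-- The estimate of the solution of the optimality system by its residual persists under slowly
varying weights. -/
theorem Regular.solSq_weighted_le (h : D.Regular μ ℓ σ a b) (hμ : 0 < μ) (hℓ : 0 < ℓ)
    (hσ : 0 < σ) (ha : 0 ≤ a) (hb : 0 ≤ b) {ε : ℝ}
    (hε : aprioriConst μ ℓ σ * (8 * ε ^ 2 * (a ^ 2 + b ^ 2)) ≤ 1) {ω : ℕ → ℝ}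
    (hω₁ : ∀ i, |ω (i + 1) - ω i| ≤ ε * |ω i|) (hω₂ : ∀ i, |ω i - ω (i + 1)| ≤ ε * |ω (i + 1)|)
    (y : ℕ → X) (v : ℕ → U) (l : ℕ → X) :
    D.solSq (fun i => ω i • y i) (fun i => ω i • v i) (fun i => ω i • l i) ≤
      4 * aprioriConst μ ℓ σ * ∑ i ∈ Finset.range (D.K + 1), ω i ^ 2 * D.resSq y v l i := by
  have hM := aprioriConst_pos hμ hℓ hσ
  have h0 := h.solSq_le hμ hℓ hσ (fun i => ω i • y i) (fun i => ω i • v i) (fun i => ω i • l i)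
  set M := aprioriConst μ ℓ σ
  set Y := fun i => ω i • y i with hY
  set V := fun i => ω i • v i with hV
  set L := fun i => ω i • l i with hL
  -- The residual of the weighted triple is the weighted residual plus a commutator. The commutator
  -- contains only differences of neighbouring weights, hence is of order `ε` times the weighted
  -- solution.
  have hPG : ∑ i ∈ Finset.range (D.K + 1), (‖D.resP Y L i‖ ^ 2 + ‖D.resG V L i‖ ^ 2) ≤
      ∑ i ∈ Finset.range (D.K + 1), 2 * (ω i ^ 2 * (‖D.resP y l i‖ ^ 2 + ‖D.resG v l i‖ ^ 2))
      + 2 * ε ^ 2 * (a ^ 2 + b ^ 2) * ∑ i ∈ Finset.range D.K, ‖L (i + 1)‖ ^ 2 := by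
    rw [Finset.sum_range_succ, Finset.sum_range_succ _ D.K, Finset.mul_sum, add_right_comm,
      ← Finset.sum_add_distrib]
    refine add_le_add (Finset.sum_le_sum fun i hi => ?_) ?_
    · have hi := Finset.mem_range.1 hi
      have e1 : D.resP Y L i = ω i • D.resP y l i
          + (ω i - ω (i + 1)) • (D.A i).adjoint (l (i + 1)) := by
        simp only [resP, hi, if_true, hY, hL, map_smul]; module
      have e2 : D.resG V L i = ω i • D.resG v l i
          + (ω i - ω (i + 1)) • (D.B i).adjoint (l (i + 1)) := by
        simp only [resG, hi, if_true, hV, hL, map_smul]; module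
      have i1 := norm_smul_add_smul_sq_le (c := ω i) (x := D.resP y l i) (hω₂ i)
        ((D.A i).norm_adjoint_apply_le ha (h.A_bound i hi) (l (i + 1)))
      have i2 := norm_smul_add_smul_sq_le (c := ω i) (x := D.resG v l i) (hω₂ i)
        ((D.B i).norm_adjoint_apply_le hb (h.B_bound i hi) (l (i + 1)))
      rw [e1, e2]
      linarith
    · have e1 : D.resP Y L D.K = ω D.K • D.resP y l D.K := by
        simp [resP, hY, hL]
      have e2 : D.resG V L D.K = 0 := by simp [resG]
      rw [e1, e2, norm_smul, mul_pow, Real.norm_eq_abs, sq_abs, norm_zero]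
      have := mul_nonneg (sq_nonneg (ω D.K)) (sq_nonneg ‖D.resP y l D.K‖)
      have := mul_nonneg (sq_nonneg (ω D.K)) (sq_nonneg ‖D.resG v l D.K‖)
      linarith
  have hQ : ∑ i ∈ Finset.range (D.K + 1), ‖D.resQ Y V i‖ ^ 2 ≤
      ∑ i ∈ Finset.range (D.K + 1), 2 * (ω i ^ 2 * ‖D.resQ y v i‖ ^ 2)
      + 4 * ε ^ 2 * (a ^ 2 + b ^ 2) * ∑ i ∈ Finset.range D.K, (‖Y i‖ ^ 2 + ‖V i‖ ^ 2) := by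
    rw [Finset.sum_range_succ', Finset.sum_range_succ' _ D.K, Finset.mul_sum, add_right_comm,
      ← Finset.sum_add_distrib]
    refine add_le_add (Finset.sum_le_sum fun i hi => ?_) ?_
    · have hi := Finset.mem_range.1 hi
      have e1 : D.resQ Y V (i + 1) = ω (i + 1) • D.resQ y v (i + 1)
          + (ω (i + 1) - ω i) • (D.A i (y i) + D.B i (v i)) := by
        simp only [resQ, hY, hV, map_smul]; module
      have n1 := norm_smul_sq_le_of_abs_le (hω₁ i) (h.A_bound i hi (y i))
      have n2 := norm_smul_sq_le_of_abs_le (hω₁ i) (h.B_bound i hi (v i))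
      have n3 := norm_add_sq_le_two_mul (ω (i + 1) • D.resQ y v (i + 1))
        ((ω (i + 1) - ω i) • (D.A i (y i) + D.B i (v i)))
      have n4 := norm_add_sq_le_two_mul ((ω (i + 1) - ω i) • D.A i (y i))
        ((ω (i + 1) - ω i) • D.B i (v i))
      rw [← smul_add] at n4
      rw [norm_smul (ω (i + 1)) (D.resQ y v (i + 1)), mul_pow, Real.norm_eq_abs, sq_abs] at n3
      rw [e1]
      have n5 : 0 ≤ ε ^ 2 * (a ^ 2 * ‖V i‖ ^ 2 + b ^ 2 * ‖Y i‖ ^ 2) := by positivity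
      simp only [hY, hV] at n5 ⊢
      linarith
    · have e1 : D.resQ Y V 0 = ω 0 • D.resQ y v 0 := rfl
      rw [e1, norm_smul, mul_pow, Real.norm_eq_abs, sq_abs]
      have := mul_nonneg (sq_nonneg (ω 0)) (sq_nonneg ‖D.resQ y v 0‖)
      linarith
  have hsum : ∑ i ∈ Finset.range (D.K + 1), D.resSq Y V L i ≤
      2 * ∑ i ∈ Finset.range (D.K + 1), ω i ^ 2 * D.resSq y v l i
        + 4 * ε ^ 2 * (a ^ 2 + b ^ 2) * D.solSq Y V L := by
    have e1 : 2 * ∑ i ∈ Finset.range (D.K + 1), ω i ^ 2 * D.resSq y v l i =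
        ∑ i ∈ Finset.range (D.K + 1), 2 * (ω i ^ 2 * (‖D.resP y l i‖ ^ 2 + ‖D.resG v l i‖ ^ 2))
        + ∑ i ∈ Finset.range (D.K + 1), 2 * (ω i ^ 2 * ‖D.resQ y v i‖ ^ 2) := by
      rw [Finset.mul_sum, ← Finset.sum_add_distrib]
      exact Finset.sum_congr rfl fun i _ => by unfold resSq; ring
    have e2 : ∑ i ∈ Finset.range (D.K + 1), D.resSq Y V L i =
        ∑ i ∈ Finset.range (D.K + 1), (‖D.resP Y L i‖ ^ 2 + ‖D.resG V L i‖ ^ 2)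
        + ∑ i ∈ Finset.range (D.K + 1), ‖D.resQ Y V i‖ ^ 2 := by
      rw [← Finset.sum_add_distrib]; rfl
    have e3 : ∑ i ∈ Finset.range D.K, ‖L (i + 1)‖ ^ 2 ≤
        ∑ i ∈ Finset.range (D.K + 1), ‖L i‖ ^ 2 := by
      rw [Finset.sum_range_succ']; linarith [sq_nonneg ‖L 0‖]
    have e4 : ∑ i ∈ Finset.range D.K, (‖Y i‖ ^ 2 + ‖V i‖ ^ 2) ≤
        ∑ i ∈ Finset.range (D.K + 1), ‖Y i‖ ^ 2 + ∑ i ∈ Finset.range D.K, ‖V i‖ ^ 2 := by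
      rw [Finset.sum_add_distrib, Finset.sum_range_succ]; linarith [sq_nonneg ‖Y D.K‖]
    have hc : 0 ≤ ε ^ 2 * (a ^ 2 + b ^ 2) := by positivity
    have e5 := mul_le_mul_of_nonneg_left e3 hc
    have e6 := mul_le_mul_of_nonneg_left e4 hc
    have e7 : 0 ≤ ε ^ 2 * (a ^ 2 + b ^ 2) * ∑ i ∈ Finset.range (D.K + 1), ‖L i‖ ^ 2 := by
      positivity
    rw [e1, e2, solSq]
    linarith
  have hnn : 0 ≤ D.solSq Y V L := by unfold solSq; positivity
  -- By the choice of `ε` the commutators amount to at most half of the left side and are absorbed.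
  have h1 := mul_le_mul_of_nonneg_left hsum hM.le
  have h2 := mul_le_mul_of_nonneg_right hε hnn
  linarith

/-- The weights `(1 + ε) ^ (-|i - j|)` vary slowly in `i`. -/
theorem abs_pow_dist_sub_le {ε : ℝ} (hε : 0 < ε) (j i : ℕ) :
    |(1 / (1 + ε)) ^ Nat.dist (i + 1) j - (1 / (1 + ε)) ^ Nat.dist i j|
      ≤ ε * |(1 / (1 + ε)) ^ Nat.dist i j| ∧
    |(1 / (1 + ε)) ^ Nat.dist i j - (1 / (1 + ε)) ^ Nat.dist (i + 1) j|
      ≤ ε * |(1 / (1 + ε)) ^ Nat.dist (i + 1) j| := by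
  set γ := 1 / (1 + ε) with hγ
  have hγ0 : 0 < γ := by positivity
  have hγ1 : γ ≤ 1 := by rw [hγ, div_le_one (by positivity)]; linarith
  have key : γ * (1 + ε) = 1 := by rw [hγ]; field_simp
  have hp : ∀ d : ℕ, |γ ^ d| = γ ^ d := fun d => abs_of_pos (pow_pos hγ0 d)
  have h1 : ∀ d : ℕ, γ ^ d - γ ^ (d + 1) = ε * γ ^ (d + 1) := fun d => by
    rw [pow_succ]; linear_combination (-γ ^ d) * key
  have h2 : ∀ d : ℕ, γ ^ (d + 1) ≤ γ ^ d := fun d => pow_le_pow_of_le_one hγ0.le hγ1 (Nat.le_succ d)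
  rw [abs_sub_comm (γ ^ Nat.dist (i + 1) j), hp, hp]
  rcases Nat.lt_or_ge i j with hij | hij
  · have hd : Nat.dist i j = Nat.dist (i + 1) j + 1 := by simp only [Nat.dist]; omega
    rw [hd, abs_sub_comm, h1, abs_of_nonneg (by positivity)]
    exact ⟨le_rfl, mul_le_mul_of_nonneg_left (h2 _) hε.le⟩
  · have hd : Nat.dist (i + 1) j = Nat.dist i j + 1 := by simp only [Nat.dist]; omega
    rw [hd, h1, abs_of_nonneg (by positivity)]
    exact ⟨mul_le_mul_of_nonneg_left (h2 _) hε.le, le_rfl⟩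

/-- The variation of the weights that is compatible with the a priori estimate. -/
noncomputable def decayEps (μ ℓ σ a b : ℝ) : ℝ :=
  1 / √(aprioriConst μ ℓ σ * (8 * (a ^ 2 + b ^ 2) + 1))

/-- The rate of exponential decay of the sensitivity of the optimality system. -/
noncomputable def decayRate (μ ℓ σ a b : ℝ) : ℝ := 1 / (1 + decayEps μ ℓ σ a b)

/-- The constant of the exponential decay estimate. -/
noncomputable def decayConst (μ ℓ σ : ℝ) : ℝ := √(4 * aprioriConst μ ℓ σ)

theorem decayEps_pos (hμ : 0 < μ) (hℓ : 0 < ℓ) (hσ : 0 < σ) : 0 < decayEps μ ℓ σ a b := by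
  have := aprioriConst_pos hμ hℓ hσ
  unfold decayEps; positivity

theorem decayEps_spec (hμ : 0 < μ) (hℓ : 0 < ℓ) (hσ : 0 < σ) :
    aprioriConst μ ℓ σ * (8 * decayEps μ ℓ σ a b ^ 2 * (a ^ 2 + b ^ 2)) ≤ 1 := by
  have hM := aprioriConst_pos hμ hℓ hσ
  have h2 : 0 < 8 * (a ^ 2 + b ^ 2) + 1 := by positivity
  unfold decayEps
  rw [div_pow, one_pow, Real.sq_sqrt (by positivity)]
  have : aprioriConst μ ℓ σ * (8 * (1 / (aprioriConst μ ℓ σ * (8 * (a ^ 2 + b ^ 2) + 1)))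
      * (a ^ 2 + b ^ 2)) = 8 * (a ^ 2 + b ^ 2) / (8 * (a ^ 2 + b ^ 2) + 1) := by
    field_simp
  rw [this, div_le_one h2]
  linarith

theorem decayRate_pos (hμ : 0 < μ) (hℓ : 0 < ℓ) (hσ : 0 < σ) : 0 < decayRate μ ℓ σ a b := by
  have := decayEps_pos (a := a) (b := b) hμ hℓ hσ
  unfold decayRate; positivity

theorem decayRate_lt_one (hμ : 0 < μ) (hℓ : 0 < ℓ) (hσ : 0 < σ) : decayRate μ ℓ σ a b < 1 := by
  have := decayEps_pos (a := a) (b := b) hμ hℓ hσ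
  unfold decayRate
  rw [div_lt_one (by positivity)]
  linarith

theorem decayConst_pos (hμ : 0 < μ) (hℓ : 0 < ℓ) (hσ : 0 < σ) : 0 < decayConst μ ℓ σ := by
  have := aprioriConst_pos hμ hℓ hσ
  unfold decayConst; positivity

/-- Exponential decay of the sensitivity of the optimality system: the influence of a residual at
time `i` on the solution at time `j` is of order `γ ^ |i - j|`. -/
theorem Regular.decay (h : D.Regular μ ℓ σ a b) (hμ : 0 < μ) (hℓ : 0 < ℓ)
    (hσ : 0 < σ) (ha : 0 ≤ a) (hb : 0 ≤ b) (y : ℕ → X) (v : ℕ → U) (l : ℕ → X) {j : ℕ}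
    (hj : j ≤ D.K) :
    (‖y j‖ ≤ decayConst μ ℓ σ * ∑ i ∈ Finset.range (D.K + 1),
      decayRate μ ℓ σ a b ^ Nat.dist i j * D.resNorm y v l i) ∧
    (‖l j‖ ≤ decayConst μ ℓ σ * ∑ i ∈ Finset.range (D.K + 1),
      decayRate μ ℓ σ a b ^ Nat.dist i j * D.resNorm y v l i) ∧
    (j < D.K → ‖v j‖ ≤ decayConst μ ℓ σ * ∑ i ∈ Finset.range (D.K + 1),
      decayRate μ ℓ σ a b ^ Nat.dist i j * D.resNorm y v l i) := by
  have hM := aprioriConst_pos hμ hℓ hσ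
  have hγ := decayRate_pos (a := a) (b := b) hμ hℓ hσ
  have hw := fun i => abs_pow_dist_sub_le (decayEps_pos (a := a) (b := b) hμ hℓ hσ) j i
  have h0 := h.solSq_weighted_le hμ hℓ hσ ha hb (decayEps_spec hμ hℓ hσ)
    (ω := fun i => decayRate μ ℓ σ a b ^ Nat.dist i j) (fun i => (hw i).1) (fun i => (hw i).2) y v l
  have hnn : ∀ i ∈ Finset.range (D.K + 1),
      0 ≤ decayRate μ ℓ σ a b ^ Nat.dist i j * D.resNorm y v l i := fun i _ =>
    mul_nonneg (by positivity) (resNorm_nonneg y v l i)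
  -- The `ℓ²` norm of the residuals is at most their `ℓ¹` norm, which makes the final estimate
  -- linear in the residuals.
  have h1 : ∑ i ∈ Finset.range (D.K + 1),
      (decayRate μ ℓ σ a b ^ Nat.dist i j) ^ 2 * D.resSq y v l i ≤
      (∑ i ∈ Finset.range (D.K + 1), decayRate μ ℓ σ a b ^ Nat.dist i j * D.resNorm y v l i) ^ 2 :=
    (Finset.sum_le_sum fun i _ => by
      rw [mul_pow]
      exact mul_le_mul_of_nonneg_left (resSq_le_resNorm_sq y v l i) (by positivity)).trans
      (Finset.sum_sq_le_sq_sum_of_nonneg hnn)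
  have h2 := h0.trans (mul_le_mul_of_nonneg_left h1 (by positivity))
  have hfin : ∀ x : ℝ, x ^ 2 ≤ D.solSq (fun i => decayRate μ ℓ σ a b ^ Nat.dist i j • y i)
      (fun i => decayRate μ ℓ σ a b ^ Nat.dist i j • v i)
      (fun i => decayRate μ ℓ σ a b ^ Nat.dist i j • l i) →
      x ≤ decayConst μ ℓ σ * ∑ i ∈ Finset.range (D.K + 1),
        decayRate μ ℓ σ a b ^ Nat.dist i j * D.resNorm y v l i := fun x hx => by
    refine (le_abs_self x).trans (abs_le_of_sq_le_sq ?_ (mul_nonneg (decayConst_pos hμ hℓ hσ).le (Finset.sum_nonneg hnn)))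
    rw [mul_pow, decayConst, Real.sq_sqrt (by positivity)]
    exact hx.trans h2
  have hjm : j ∈ Finset.range (D.K + 1) := Finset.mem_range.2 (by omega)
  -- The weight at time `j` itself is `1`, so each of the three norms is a single term of the
  -- weighted sum.
  refine ⟨hfin _ ?_, hfin _ ?_, fun hjK => hfin _ ?_⟩
  · have := Finset.single_le_sum
      (f := fun i => ‖decayRate μ ℓ σ a b ^ Nat.dist i j • y i‖ ^ 2) (fun i _ => by positivity) hjm
    simp only [Nat.dist_self, pow_zero, one_smul] at this
    unfold solSq
    refine this.trans ?_
    rw [add_assoc]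
    exact le_add_of_nonneg_right (by positivity)
  · have := Finset.single_le_sum
      (f := fun i => ‖decayRate μ ℓ σ a b ^ Nat.dist i j • l i‖ ^ 2) (fun i _ => by positivity) hjm
    simp only [Nat.dist_self, pow_zero, one_smul] at this
    unfold solSq
    refine this.trans ?_
    exact le_add_of_nonneg_left (by positivity)
  · have := Finset.single_le_sum
      (f := fun i => ‖decayRate μ ℓ σ a b ^ Nat.dist i j • v i‖ ^ 2) (fun i _ => by positivity)
      (Finset.mem_range.2 hjK)
    simp only [Nat.dist_self, pow_zero, one_smul] at this
    unfold solSq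
    refine this.trans ?_
    rw [add_right_comm]
    exact le_add_of_nonneg_left (by positivity)

/-- Extension by zero of a finite sequence. -/
def extendZero {Z : Type*} [Zero Z] {N : ℕ} (f : Fin N → Z) (i : ℕ) : Z :=
  if h : i < N then f ⟨i, h⟩ else 0

theorem extendZero_add {Z : Type*} [AddZeroClass Z] {N : ℕ} (f g : Fin N → Z) :
    extendZero (f + g) = extendZero f + extendZero g := by
  funext i; simp only [extendZero, Pi.add_apply]; split_ifs <;> simp

theorem extendZero_smul {Z : Type*} [AddCommGroup Z] [Module ℝ Z] {N : ℕ} (c : ℝ)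
    (f : Fin N → Z) : extendZero (c • f) = c • extendZero f := by
  funext i; simp only [extendZero, Pi.smul_apply]; split_ifs <;> simp

theorem resP_add (D : LQData X U) (y l y' l' : ℕ → X) (i : ℕ) :
    D.resP (y + y') (l + l') i = D.resP y l i + D.resP y' l' i := by
  simp only [resP, Pi.add_apply, map_add]; split_ifs <;> abel

theorem resG_add (D : LQData X U) (v v' : ℕ → U) (l l' : ℕ → X) (i : ℕ) :
    D.resG (v + v') (l + l') i = D.resG v l i + D.resG v' l' i := by
  simp only [resG, Pi.add_apply, map_add]; split_ifs <;> abel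

theorem resQ_add (D : LQData X U) (y y' : ℕ → X) (v v' : ℕ → U) (i : ℕ) :
    D.resQ (y + y') (v + v') i = D.resQ y v i + D.resQ y' v' i := by
  cases i <;> simp only [resQ, Pi.add_apply, map_add]
  abel

theorem resP_smul (D : LQData X U) (c : ℝ) (y l : ℕ → X) (i : ℕ) :
    D.resP (c • y) (c • l) i = c • D.resP y l i := by
  simp only [resP, Pi.smul_apply, map_smul]; split_ifs <;> module

theorem resG_smul (D : LQData X U) (c : ℝ) (v : ℕ → U) (l : ℕ → X) (i : ℕ) :
    D.resG (c • v) (c • l) i = c • D.resG v l i := by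
  simp only [resG, Pi.smul_apply, map_smul]; split_ifs <;> module

theorem resQ_smul (D : LQData X U) (c : ℝ) (y : ℕ → X) (v : ℕ → U) (i : ℕ) :
    D.resQ (c • y) (c • v) i = c • D.resQ y v i := by
  cases i <;> simp only [resQ, Pi.smul_apply, map_smul]
  module

/-- The optimality system has a solution for every right-hand side. -/
theorem Regular.exists_solution (h : D.Regular μ ℓ σ a b) (hμ : 0 < μ) (hℓ : 0 < ℓ)
    (hσ : 0 < σ) (p : ℕ → X) (g : ℕ → U) (q : ℕ → X) :
    ∃ (y : ℕ → X) (v : ℕ → U) (l : ℕ → X), (∀ i ≤ D.K, D.resP y l i = p i) ∧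
      (∀ i < D.K, D.resG v l i = g i) ∧ (∀ i ≤ D.K, D.resQ y v i = q i) := by
  -- There are as many equations as unknowns: the system is an endomorphism of a finite-dimensional
  -- space. The a priori estimate with zero residual gives injectivity, hence surjectivity.
  let T : ((Fin (D.K + 1) → X) × (Fin D.K → U) × (Fin (D.K + 1) → X)) →ₗ[ℝ]
      ((Fin (D.K + 1) → X) × (Fin D.K → U) × (Fin (D.K + 1) → X)) :=
    { toFun := fun z => (fun i => D.resP (extendZero z.1) (extendZero z.2.2) i,
        fun i => D.resG (extendZero z.2.1) (extendZero z.2.2) i,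
        fun i => D.resQ (extendZero z.1) (extendZero z.2.1) i)
      map_add' := fun z z' => by
        simp only [Prod.fst_add, Prod.snd_add, extendZero_add, resP_add, resG_add, resQ_add]
        rfl
      map_smul' := fun c z => by
        simp only [Prod.smul_fst, Prod.smul_snd, extendZero_smul, resP_smul, resG_smul, resQ_smul]
        rfl }
  have hinj : Function.Injective T := by
    rw [← LinearMap.ker_eq_bot, LinearMap.ker_eq_bot']
    intro z hz
    have hP : ∀ i < D.K + 1, D.resP (extendZero z.1) (extendZero z.2.2) i = 0 := fun i hi =>
      congrFun (congrArg Prod.fst hz) ⟨i, hi⟩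
    have hG : ∀ i < D.K + 1, D.resG (extendZero z.2.1) (extendZero z.2.2) i = 0 := fun i hi => by
      by_cases hiK : i < D.K
      · exact congrFun (congrArg (fun z => z.2.1) hz) ⟨i, hiK⟩
      · simp [resG, hiK]
    have hQ : ∀ i < D.K + 1, D.resQ (extendZero z.1) (extendZero z.2.1) i = 0 := fun i hi =>
      congrFun (congrArg (fun z => z.2.2) hz) ⟨i, hi⟩
    have h0 := h.solSq_le hμ hℓ hσ (extendZero z.1) (extendZero z.2.1) (extendZero z.2.2)
    have h1 : ∑ i ∈ Finset.range (D.K + 1),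
        D.resSq (extendZero z.1) (extendZero z.2.1) (extendZero z.2.2) i = 0 :=
      Finset.sum_eq_zero fun i hi => by
        have hi := Finset.mem_range.1 hi
        simp [resSq, hP i hi, hG i hi, hQ i hi]
    rw [h1, mul_zero, solSq] at h0
    have s1 : 0 ≤ ∑ i ∈ Finset.range (D.K + 1), ‖extendZero z.1 i‖ ^ 2 := by positivity
    have s2 : 0 ≤ ∑ i ∈ Finset.range D.K, ‖extendZero z.2.1 i‖ ^ 2 := by positivity
    have s3 : 0 ≤ ∑ i ∈ Finset.range (D.K + 1), ‖extendZero z.2.2 i‖ ^ 2 := by positivity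
    have t1 := (Finset.sum_eq_zero_iff_of_nonneg fun i _ => by positivity).1
      (le_antisymm (by linarith) s1)
    have t2 := (Finset.sum_eq_zero_iff_of_nonneg fun i _ => by positivity).1
      (le_antisymm (by linarith) s2)
    have t3 := (Finset.sum_eq_zero_iff_of_nonneg fun i _ => by positivity).1
      (le_antisymm (by linarith) s3)
    refine Prod.ext (funext fun i => ?_) (Prod.ext (funext fun i => ?_) (funext fun i => ?_))
    · simpa [extendZero, Nat.le_of_lt_succ i.2] using t1 i (Finset.mem_range.2 i.2)
    · simpa [extendZero] using t2 i (Finset.mem_range.2 i.2)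
    · simpa [extendZero, Nat.le_of_lt_succ i.2] using t3 i (Finset.mem_range.2 i.2)
  obtain ⟨z, hz⟩ := (LinearMap.injective_iff_surjective.1 hinj)
    (fun i => p i, fun i => g i, fun i => q i)
  refine ⟨extendZero z.1, extendZero z.2.1, extendZero z.2.2, fun i hi => ?_, fun i hi => ?_,
    fun i hi => ?_⟩
  · exact congrFun (congrArg Prod.fst hz) ⟨i, by omega⟩
  · exact congrFun (congrArg (fun z => z.2.1) hz) ⟨i, by omega⟩
  · exact congrFun (congrArg (fun z => z.2.2) hz) ⟨i, by omega⟩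

end LQData

/-! ### The matrix hypotheses as inequalities for operators. -/

open scoped Matrix.Norms.L2Operator in
theorem norm_toEuclideanLin_le {p q : ℕ} {M : Matrix (Fin p) (Fin q) ℝ} {c : ℝ} (h : ‖M‖ ≤ c)
    (x : Vec q) : ‖Matrix.toEuclideanLin M x‖ ≤ c * ‖x‖ :=
  (Matrix.l2_opNorm_mulVec M x).trans (mul_le_mul_of_nonneg_right h (norm_nonneg x))

theorem quadForm_eq_inner {n : ℕ} (M : Matrix (Fin n) (Fin n) ℝ) (x : Vec n) :
    quadForm M x = ⟪x, Matrix.toEuclideanLin M x⟫_ℝ := by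
  rw [quadForm]
  exact (Matrix.inner_toEuclideanCLM M x x).symm

theorem toEuclideanLin_smul_one {n : ℕ} (c : ℝ) (x : Vec n) :
    Matrix.toEuclideanLin (c • (1 : Matrix (Fin n) (Fin n) ℝ)) x = c • x := by
  rw [map_smul, LinearMap.smul_apply, Matrix.toLpLin_apply, Matrix.one_mulVec]

theorem Matrix.PosSemidef.inner_nonneg {n : ℕ} {M : Matrix (Fin n) (Fin n) ℝ}
    (h : M.PosSemidef) (x : Vec n) : 0 ≤ ⟪x, Matrix.toEuclideanLin M x⟫_ℝ := by
  have := (Matrix.isPositive_toEuclideanLin_iff.2 h).2 x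
  rw [real_inner_comm]; simpa using this

theorem le_inner_of_posSemidef {n : ℕ} {M : Matrix (Fin n) (Fin n) ℝ} {μ : ℝ}
    (h : (M - μ • 1).PosSemidef) (x : Vec n) :
    μ * ‖x‖ ^ 2 ≤ ⟪x, Matrix.toEuclideanLin M x⟫_ℝ := by
  have := h.inner_nonneg x
  rw [map_sub, LinearMap.sub_apply, toEuclideanLin_smul_one, inner_sub_right, inner_smul_right,
    real_inner_self_eq_norm_sq] at this
  linarith

theorem inner_le_of_posSemidef {n : ℕ} {M : Matrix (Fin n) (Fin n) ℝ} {ℓ : ℝ}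
    (h : (ℓ • 1 - M).PosSemidef) (x : Vec n) :
    ⟪x, Matrix.toEuclideanLin M x⟫_ℝ ≤ ℓ * ‖x‖ ^ 2 := by
  have := h.inner_nonneg x
  rw [map_sub, LinearMap.sub_apply, toEuclideanLin_smul_one, inner_sub_right, inner_smul_right,
    real_inner_self_eq_norm_sq] at this
  linarith

theorem inner_toEuclideanLin_comm_of_posSemidef {n : ℕ} {M : Matrix (Fin n) (Fin n) ℝ} {μ : ℝ}
    (h : (M - μ • 1).PosSemidef) (x y : Vec n) :
    ⟪Matrix.toEuclideanLin M x, y⟫_ℝ = ⟪x, Matrix.toEuclideanLin M y⟫_ℝ := by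
  have := (Matrix.isPositive_toEuclideanLin_iff.2 h).1 x y
  simp only [map_sub, LinearMap.sub_apply, toEuclideanLin_smul_one, inner_sub_right,
    inner_smul_right, inner_sub_left, inner_smul_left] at this
  simpa using this

/-- Evaluating the nonnegative form of `M` at `(ℓ + 1) x - M x` and bounding it from above at `x`
and `M x` gives the operator norm without diagonalisation. The constant `ℓ + 1` replaces `ℓ` so that
division by it is allowed when `ℓ = 0`; it takes the role of `ℓ` in the abstract theory from here
on. -/
theorem norm_toEuclideanLin_le_of_posSemidef {n : ℕ} {M : Matrix (Fin n) (Fin n) ℝ} {μ ℓ : ℝ}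
    (hμ : 0 ≤ μ) (hℓ : 0 ≤ ℓ) (h₁ : (M - μ • 1).PosSemidef) (h₂ : (ℓ • 1 - M).PosSemidef)
    (x : Vec n) : ‖Matrix.toEuclideanLin M x‖ ≤ (ℓ + 1) * ‖x‖ := by
  set f := Matrix.toEuclideanLin M with hf
  have up : ∀ z, ⟪z, f z⟫_ℝ ≤ (ℓ + 1) * ‖z‖ ^ 2 := fun z => by
    have := inner_le_of_posSemidef h₂ z
    nlinarith [sq_nonneg ‖z‖]
  have lo : ∀ z, 0 ≤ ⟪z, f z⟫_ℝ := fun z =>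
    le_trans (by positivity) (le_inner_of_posSemidef h₁ z)
  have hs : ⟪x, f (f x)⟫_ℝ = ‖f x‖ ^ 2 := by
    rw [← real_inner_self_eq_norm_sq]
    exact (inner_toEuclideanLin_comm_of_posSemidef h₁ x (f x)).symm
  have h1 := up (f x)
  have h2 := lo ((ℓ + 1) • x - f x)
  have h3 := up x
  have h4 : ⟪(ℓ + 1) • x - f x, f ((ℓ + 1) • x - f x)⟫_ℝ
      = (ℓ + 1) ^ 2 * ⟪x, f x⟫_ℝ - 2 * (ℓ + 1) * ‖f x‖ ^ 2 + ⟪f x, f (f x)⟫_ℝ := by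
    simp only [map_sub, map_smul, inner_sub_left, inner_sub_right, real_inner_smul_left,
      real_inner_smul_right, hs, real_inner_self_eq_norm_sq]
    ring
  rw [h4] at h2
  have hl : 0 < ℓ + 1 := by linarith
  have h5 : (ℓ + 1) * ‖f x‖ ^ 2 ≤ (ℓ + 1) * ((ℓ + 1) * ‖x‖) ^ 2 := by
    nlinarith [mul_le_mul_of_nonneg_left h3 (sq_nonneg (ℓ + 1))]
  exact (le_abs_self _).trans
    (abs_le_of_sq_le_sq (le_of_mul_le_mul_left h5 hl) (by positivity))

theorem adjoint_toEuclideanLin {p q : ℕ} (M : Matrix (Fin p) (Fin q) ℝ) :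
    (Matrix.toEuclideanLin M).adjoint = Matrix.toEuclideanLin Mᵀ := by
  rw [← Matrix.toEuclideanLin_conjTranspose_eq_adjoint, Matrix.conjTranspose_eq_transpose_of_trivial]

/-- Parseval in an orthonormal eigenbasis of `M Mᵀ`, whose eigenvalues are the squared singular
values. -/
theorem SigmaMinGE.sq_mul_norm_sq_le {p q : Type} [Fintype p] [DecidableEq p] [Fintype q]
    [DecidableEq q] {M : Matrix p q ℝ} {σ : ℝ} (hσ : 0 ≤ σ) (h : SigmaMinGE M σ)
    (x : EuclideanSpace ℝ p) : σ ^ 2 * ‖x‖ ^ 2 ≤ ‖Matrix.toEuclideanLin Mᵀ x‖ ^ 2 := by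
  set f := Matrix.toEuclideanLin Mᵀ with hf
  have hn : Module.finrank ℝ (EuclideanSpace ℝ p) = Fintype.card p := finrank_euclideanSpace
  set e := f.isSymmetric_adjoint_comp_self.eigenvectorBasis hn with he
  have h1 : ‖f x‖ ^ 2 = ⟪x, (f.adjoint ∘ₗ f) x⟫_ℝ := by
    rw [LinearMap.comp_apply, LinearMap.adjoint_inner_right, real_inner_self_eq_norm_sq]
  have h2 : ⟪x, (f.adjoint ∘ₗ f) x⟫_ℝ =
      ∑ i, ⟪x, e i⟫_ℝ * ⟪e i, (f.adjoint ∘ₗ f) x⟫_ℝ := (e.sum_inner_mul_inner _ _).symm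
  have h3 : ‖x‖ ^ 2 = ∑ i, ⟪x, e i⟫_ℝ * ⟪e i, x⟫_ℝ := by
    rw [e.sum_inner_mul_inner, real_inner_self_eq_norm_sq]
  rw [h1, h2, h3, Finset.mul_sum]
  refine Finset.sum_le_sum fun i _ => ?_
  have h4 : ⟪e i, (f.adjoint ∘ₗ f) x⟫_ℝ = f.singularValues i ^ 2 * ⟪e i, x⟫_ℝ := by
    rw [← f.isSymmetric_adjoint_comp_self (e i) x, he,
      f.isSymmetric_adjoint_comp_self.apply_eigenvectorBasis, f.sq_singularValues_fin hn,
      real_inner_smul_left]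
    rfl
  rw [h4, real_inner_comm (e i) x]
  have h5 := pow_le_pow_left₀ hσ (h i i.2) 2
  nlinarith [mul_self_nonneg ⟪e i, x⟫_ℝ, mul_le_mul_of_nonneg_right h5 (mul_self_nonneg ⟪e i, x⟫_ℝ)]

/-- A state block of `Nᵀ l` is the adjoint recursion of the multipliers. The column of the last
state carries no `A`, which is the case `c = K`. -/
theorem sum_dynMatrix_inl {n m : ℕ} (A : ℕ → Matrix (Fin n) (Fin n) ℝ)
    (B : ℕ → Matrix (Fin n) (Fin m) ℝ) (t K : ℕ) (l : ℕ → Vec n) (c : Fin (K + 1)) (j : Fin n) :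
    ∑ r : Fin (K + 1) × Fin n, dynMatrix A B t K r (Sum.inl (c, j)) * l r.1 r.2 =
      l c j - if (c : ℕ) < K then Matrix.toEuclideanLin (A (t + c))ᵀ (l (c + 1)) j else 0 := by
  rw [Fintype.sum_prod_type]
  simp only [dynMatrix, Matrix.of_apply, sub_mul, Finset.sum_sub_distrib, ite_mul, zero_mul]
  congr 1
  · rw [Finset.sum_eq_single c]
    · simp [Matrix.one_apply]
    · intro i _ hi
      have : (i : ℕ) ≠ c := fun h => hi (Fin.ext h)
      simp [this]
    · simp
  · split_ifs with hc
    · rw [Finset.sum_eq_single (⟨c + 1, by omega⟩ : Fin (K + 1))]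
      · simp [Matrix.toLpLin_apply, Matrix.mulVec, dotProduct]
      · intro i _ hi
        have : (i : ℕ) ≠ c + 1 := fun h => hi (Fin.ext h)
        simp [this]
      · simp
    · refine Finset.sum_eq_zero fun i _ => Finset.sum_eq_zero fun k _ => ?_
      rw [if_neg (by omega)]

theorem sum_dynMatrix_inr {n m : ℕ} (A : ℕ → Matrix (Fin n) (Fin n) ℝ)
    (B : ℕ → Matrix (Fin n) (Fin m) ℝ) (t K : ℕ) (l : ℕ → Vec n) (c : Fin K) (j : Fin m) :
    ∑ r : Fin (K + 1) × Fin n, dynMatrix A B t K r (Sum.inr (c, j)) * l r.1 r.2 =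
      - Matrix.toEuclideanLin (B (t + c))ᵀ (l (c + 1)) j := by
  rw [Fintype.sum_prod_type]
  simp only [dynMatrix, Matrix.of_apply, neg_mul, ite_mul, zero_mul, Finset.sum_neg_distrib]
  congr 1
  rw [Finset.sum_eq_single (⟨c + 1, by omega⟩ : Fin (K + 1))]
  · simp [Matrix.toLpLin_apply, Matrix.mulVec, dotProduct]
  · intro i _ hi
    have : (i : ℕ) ≠ c + 1 := fun h => hi (Fin.ext h)
    simp [this]
  · simp

theorem norm_sq_stacked {n K : ℕ} (l : ℕ → Vec n) :
    ‖(WithLp.toLp 2 fun r : Fin (K + 1) × Fin n => l r.1 r.2 : EuclideanSpace ℝ _)‖ ^ 2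
      = ∑ i ∈ Finset.range (K + 1), ‖l i‖ ^ 2 := by
  rw [EuclideanSpace.norm_sq_eq, Fintype.sum_prod_type, Finset.sum_range]
  exact Finset.sum_congr rfl fun i _ => by rw [EuclideanSpace.norm_sq_eq]

/-- The right side is `‖Nᵀ l‖ ^ 2` by blocks; the column of the last state contributes `‖l K‖ ^ 2`.
-/
theorem sum_le_of_sigmaMinGE_dynMatrix {n m : ℕ} {A : ℕ → Matrix (Fin n) (Fin n) ℝ}
    {B : ℕ → Matrix (Fin n) (Fin m) ℝ} {t K : ℕ} {σ : ℝ} (hσ : 0 ≤ σ)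
    (h : SigmaMinGE (dynMatrix A B t K) σ) (l : ℕ → Vec n) :
    σ ^ 2 * ∑ i ∈ Finset.range (K + 1), ‖l i‖ ^ 2 ≤
      ∑ i ∈ Finset.range K, (‖l i - (Matrix.toEuclideanLin (A (t + i))).adjoint (l (i + 1))‖ ^ 2
        + ‖(Matrix.toEuclideanLin (B (t + i))).adjoint (l (i + 1))‖ ^ 2) + ‖l K‖ ^ 2 := by
  have h0 := h.sq_mul_norm_sq_le hσ (WithLp.toLp 2 fun r : Fin (K + 1) × Fin n => l r.1 r.2)
  rw [norm_sq_stacked] at h0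
  refine h0.trans (le_of_eq ?_)
  have h1 : ∀ (c : Fin (K + 1)) (j : Fin n), Matrix.toEuclideanLin (dynMatrix A B t K)ᵀ
      (WithLp.toLp 2 fun r : Fin (K + 1) × Fin n => l r.1 r.2) (Sum.inl (c, j)) = _ := fun c j =>
    sum_dynMatrix_inl A B t K l c j
  have h2 : ∀ (c : Fin K) (j : Fin m), Matrix.toEuclideanLin (dynMatrix A B t K)ᵀ
      (WithLp.toLp 2 fun r : Fin (K + 1) × Fin n => l r.1 r.2) (Sum.inr (c, j)) = _ := fun c j =>
    sum_dynMatrix_inr A B t K l c j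
  rw [EuclideanSpace.norm_sq_eq, Fintype.sum_sum_type, Fintype.sum_prod_type,
    Fintype.sum_prod_type, Fin.sum_univ_castSucc, Finset.sum_add_distrib, Finset.sum_range,
    Finset.sum_range, add_right_comm]
  congr 1
  · congr 1
    · refine Finset.sum_congr rfl fun c _ => ?_
      rw [adjoint_toEuclideanLin, EuclideanSpace.norm_sq_eq]
      refine Finset.sum_congr rfl fun j _ => ?_
      rw [h1, Fin.val_castSucc, if_pos c.2, PiLp.sub_apply]
    · refine Finset.sum_congr rfl fun c _ => ?_
      rw [adjoint_toEuclideanLin, EuclideanSpace.norm_sq_eq]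
      refine Finset.sum_congr rfl fun j _ => ?_
      rw [h2, norm_neg]
  · rw [EuclideanSpace.norm_sq_eq]
    refine Finset.sum_congr rfl fun j _ => ?_
    rw [h1, Fin.val_last, if_neg (lt_irrefl K), sub_zero]

/-- Without the last state column nothing is left of `‖l K‖ ^ 2`: controllability bounds the
multipliers even if the final one is unconstrained. -/
theorem sum_le_of_sigmaMinGE_dynMatrixHat {n m : ℕ} {A : ℕ → Matrix (Fin n) (Fin n) ℝ}
    {B : ℕ → Matrix (Fin n) (Fin m) ℝ} {t K : ℕ} {σ : ℝ} (hσ : 0 ≤ σ)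
    (h : SigmaMinGE (dynMatrixHat A B t K) σ) (l : ℕ → Vec n) :
    σ ^ 2 * ∑ i ∈ Finset.range (K + 1), ‖l i‖ ^ 2 ≤
      ∑ i ∈ Finset.range K, (‖l i - (Matrix.toEuclideanLin (A (t + i))).adjoint (l (i + 1))‖ ^ 2
        + ‖(Matrix.toEuclideanLin (B (t + i))).adjoint (l (i + 1))‖ ^ 2) := by
  have h0 := h.sq_mul_norm_sq_le hσ (WithLp.toLp 2 fun r : Fin (K + 1) × Fin n => l r.1 r.2)
  rw [norm_sq_stacked] at h0
  refine h0.trans (le_of_eq ?_)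
  have h1 : ∀ (c : Fin K) (j : Fin n), Matrix.toEuclideanLin (dynMatrixHat A B t K)ᵀ
      (WithLp.toLp 2 fun r : Fin (K + 1) × Fin n => l r.1 r.2) (Sum.inl (c, j)) = _ := fun c j =>
    sum_dynMatrix_inl A B t K l c.castSucc j
  have h2 : ∀ (c : Fin K) (j : Fin m), Matrix.toEuclideanLin (dynMatrixHat A B t K)ᵀ
      (WithLp.toLp 2 fun r : Fin (K + 1) × Fin n => l r.1 r.2) (Sum.inr (c, j)) = _ := fun c j =>
    sum_dynMatrix_inr A B t K l c j
  rw [EuclideanSpace.norm_sq_eq, Fintype.sum_sum_type, Fintype.sum_prod_type,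
    Fintype.sum_prod_type, Finset.sum_add_distrib, Finset.sum_range, Finset.sum_range]
  congr 1
  · refine Finset.sum_congr rfl fun c _ => ?_
    rw [adjoint_toEuclideanLin, EuclideanSpace.norm_sq_eq]
    refine Finset.sum_congr rfl fun j _ => ?_
    rw [h1, Fin.val_castSucc, if_pos c.2, PiLp.sub_apply]
  · refine Finset.sum_congr rfl fun c _ => ?_
    rw [adjoint_toEuclideanLin, EuclideanSpace.norm_sq_eq]
    refine Finset.sum_congr rfl fun j _ => ?_
    rw [h2, norm_neg]

/-! ### Optimality conditions of the tracking problem as an instance of the abstract system. -/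

namespace LTVTracking

open Matrix (toEuclideanLin)

variable {T n m : ℕ} {E : ℕ → Type u}

/-- The linear-quadratic data of the tracking problem over `[t, t + K]` with parameters `ξ` and
terminal condition `G y + F l = p`. -/
noncomputable def lqData (S : LTVTracking T n m E) (ξ : ∀ t, E t) (t K : ℕ)
    (G F : Vec n →ₗ[ℝ] Vec n) : LQData (Vec n) (Vec m) where
  A i := toEuclideanLin (S.A (t + i) (ξ (t + i)))
  B i := toEuclideanLin (S.B (t + i) (ξ (t + i)))
  Q i := toEuclideanLin (S.Q (t + i) (ξ (t + i)))
  R i := toEuclideanLin (S.R (t + i) (ξ (t + i)))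
  E := G
  F := F
  K := K

/-- `(y, v, l)` solves the optimality conditions of the tracking problem over `[t₁, t₂]` from `z`,
with terminal condition `G y + F l = p`. -/
structure IsKKT (S : LTVTracking T n m E) (ξ : ∀ t, E t) (t₁ t₂ : ℕ) (z : Vec n)
    (G F : Vec n →ₗ[ℝ] Vec n) (p : Vec n) (y : ℕ → Vec n) (v : ℕ → Vec m) (l : ℕ → Vec n) :
    Prop where
  traj : S.IsTrajectory ξ t₁ t₂ z y v
  stat_x : ∀ s, t₁ ≤ s → s < t₂ → toEuclideanLin (S.Q s (ξ s)) (y s - S.xbar s (ξ s)) + l s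
    = (toEuclideanLin (S.A s (ξ s))).adjoint (l (s + 1))
  stat_u : ∀ s, t₁ ≤ s → s < t₂ → toEuclideanLin (S.R s (ξ s)) (v s)
    = (toEuclideanLin (S.B s (ξ s))).adjoint (l (s + 1))
  term : G (y t₂) + F (l t₂) = p

section Regular

variable [∀ t, NormedAddCommGroup (E t)] {S : LTVTracking T n m E} {k : ℕ}
  {μ ℓ σ a b Dw Dx LA LB LQ LR LP Lx Lw : ℝ}

theorem min_one_sq_mul_le {σ x y : ℝ} (hσ : 0 < σ) (hx : 0 ≤ x) (h : σ ^ 2 * x ≤ y) :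
    min σ 1 ^ 2 * x ≤ y :=
  (mul_le_mul_of_nonneg_right
    (pow_le_pow_left₀ (le_min hσ.le zero_le_one) (min_le_left σ 1) 2) hx).trans h

theorem Assumptions.regular (h : S.Assumptions k μ ℓ σ a b Dw Dx LA LB LQ LR LP Lx Lw)
    (hμ : 0 < μ) (hℓ : 0 ≤ ℓ) {ξ : ∀ t, E t} {t K : ℕ} (htK : t + K ≤ T)
    (hξ : ∀ s, t ≤ s → s < t + K → ξ s ∈ S.Ξ s) {G F : Vec n →ₗ[ℝ] Vec n} {σ' : ℝ}
    (term : ∀ y l, μ * ‖y‖ ^ 2 ≤ -⟪y, l⟫_ℝ + ‖G y + F l‖ * (‖y‖ + ‖l‖) + μ * ‖G y + F l‖ ^ 2)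
    (stab : ∀ (l : ℕ → Vec n) (y : Vec n), σ' ^ 2 * ∑ i ∈ Finset.range (K + 1), ‖l i‖ ^ 2 ≤
      ∑ i ∈ Finset.range K,
        (‖l i - (toEuclideanLin (S.A (t + i) (ξ (t + i)))).adjoint (l (i + 1))‖ ^ 2
        + ‖(toEuclideanLin (S.B (t + i) (ξ (t + i)))).adjoint (l (i + 1))‖ ^ 2)
        + 2 * ‖G y + F (l K)‖ ^ 2 + 2 * (ℓ + 1) ^ 2 * ‖y‖ ^ 2) :
    (S.lqData ξ t K G F).Regular μ (ℓ + 1) σ' a b := by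
  have hT : ∀ i < K, t + i < T := fun i hi => by omega
  have hm : ∀ i < K, ξ (t + i) ∈ S.Ξ (t + i) := fun i hi => hξ _ (by omega) (by omega)
  exact
    { Q_lower := fun i hi => le_inner_of_posSemidef (h.Q_lower _ (hT i hi) _ (hm i hi))
      Q_upper := fun i hi => norm_toEuclideanLin_le_of_posSemidef hμ.le hℓ
        (h.Q_lower _ (hT i hi) _ (hm i hi)) (h.Q_upper _ (hT i hi) _ (hm i hi))
      R_lower := fun i hi => le_inner_of_posSemidef (h.R_lower _ (hT i hi) _ (hm i hi))
      R_upper := fun i hi => norm_toEuclideanLin_le_of_posSemidef hμ.le hℓ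
        (h.R_lower _ (hT i hi) _ (hm i hi)) (h.R_upper _ (hT i hi) _ (hm i hi))
      A_bound := fun i hi => norm_toEuclideanLin_le (h.A_bound _ (hT i hi) _ (hm i hi))
      B_bound := fun i hi => norm_toEuclideanLin_le (h.B_bound _ (hT i hi) _ (hm i hi))
      term := term
      stab := stab }

/-- The final multiplier is `p - P y`, which pays for the term `‖l K‖ ^ 2` in the stabilizability
bound. -/
theorem Assumptions.regular_final (h : S.Assumptions k μ ℓ σ a b Dw Dx LA LB LQ LR LP Lx Lw)
    (hμ : 0 < μ) (hℓ : 0 ≤ ℓ) (hσ : 0 < σ) {ξ : ∀ t, E t} {t K : ℕ} (htK : t + K = T)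
    (hξ : ∀ s, t ≤ s → s ≤ T → ξ s ∈ S.Ξ s) :
    (S.lqData ξ t K (toEuclideanLin (S.PT (ξ T))) LinearMap.id).Regular
      μ (ℓ + 1) (min σ 1) a b := by
  refine h.regular hμ hℓ htK.le (fun s hs hs' => hξ s hs (by omega)) (fun y l => ?_) (fun l y => ?_)
  · have h1 := le_inner_of_posSemidef (h.PT_lower _ (hξ T (by omega) le_rfl)) y
    simp only [LinearMap.id_apply]
    set p := toEuclideanLin (S.PT (ξ T)) y + l with hp
    have h2 : ⟪y, toEuclideanLin (S.PT (ξ T)) y⟫_ℝ = ⟪y, p⟫_ℝ - ⟪y, l⟫_ℝ := by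
      rw [hp, inner_add_right]; ring
    have h3 := real_inner_le_norm y p
    have h4 := mul_nonneg (norm_nonneg p) (norm_nonneg l)
    have h5 := mul_nonneg hμ.le (sq_nonneg ‖p‖)
    linarith
  · simp only [LinearMap.id_apply]
    have h1 : ‖l K‖ ^ 2 ≤ 2 * ‖toEuclideanLin (S.PT (ξ T)) y + l K‖ ^ 2
        + 2 * (ℓ + 1) ^ 2 * ‖y‖ ^ 2 := by
      have e1 := norm_sub_sq_le_two_mul (toEuclideanLin (S.PT (ξ T)) y + l K)
        (toEuclideanLin (S.PT (ξ T)) y)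
      rw [add_sub_cancel_left] at e1
      have e2 := pow_le_pow_left₀ (norm_nonneg _) (norm_toEuclideanLin_le_of_posSemidef hμ.le hℓ
        (h.PT_lower _ (hξ T (by omega) le_rfl)) (h.PT_upper _ (hξ T (by omega) le_rfl)) y) 2
      rw [mul_pow] at e2
      linarith
    -- At `t = T` there are no dynamics and no stabilizability is assumed; the terminal condition
    -- alone suffices, with a constant at most `1`. This is why `min σ 1` replaces `σ`.
    rcases Nat.eq_zero_or_pos K with rfl | hK
    · rw [Finset.sum_range_one, Finset.sum_range_zero, zero_add]
      refine le_trans ?_ h1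
      have : min σ 1 ^ 2 ≤ 1 := pow_le_one₀ (le_min hσ.le zero_le_one) (min_le_right σ 1)
      nlinarith [sq_nonneg ‖l 0‖]
    · have h2 := h.stab t (by omega) ξ fun s hs hsT => hξ s hs hsT.le
      have hTt : T - t = K := by omega
      rw [hTt] at h2
      have h3 := min_one_sq_mul_le hσ (by positivity) (sum_le_of_sigmaMinGE_dynMatrix hσ.le h2 l)
      linarith

/-- A prescribed final state says nothing about the final multiplier, so the stronger bound for `N̂`
is needed here. -/
theorem Assumptions.regular_window (h : S.Assumptions k μ ℓ σ a b Dw Dx LA LB LQ LR LP Lx Lw)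
    (hμ : 0 < μ) (hℓ : 0 ≤ ℓ) (hσ : 0 < σ) {ξ : ∀ t, E t} {t : ℕ} (htk : t + k < T)
    (hξ : ∀ s, t ≤ s → s < t + k → ξ s ∈ S.Ξ s) :
    (S.lqData ξ t k LinearMap.id 0).Regular μ (ℓ + 1) (min σ 1) a b := by
  refine h.regular hμ hℓ htk.le hξ (fun y l => ?_) (fun l y => ?_)
  · simp only [LinearMap.id_apply, LinearMap.zero_apply, add_zero]
    have h3 := real_inner_le_norm y l
    have h4 := mul_nonneg (norm_nonneg y) (norm_nonneg y)
    linarith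
  · simp only [LinearMap.id_apply, LinearMap.zero_apply, add_zero]
    have h3 := min_one_sq_mul_le hσ (by positivity)
      (sum_le_of_sigmaMinGE_dynMatrixHat hσ.le (h.ctrl t htk ξ hξ) l)
    have h4 : 0 ≤ 2 * ‖y‖ ^ 2 + 2 * (ℓ + 1) ^ 2 * ‖y‖ ^ 2 := by positivity
    linarith

end Regular

section Solutions

variable {S : LTVTracking T n m E} {ξ : ∀ t, E t} {t K : ℕ} {G F : Vec n →ₗ[ℝ] Vec n} {p : Vec n}
  {μ ℓ σ a b : ℝ}

theorem exists_isKKT (h : (S.lqData ξ t K G F).Regular μ ℓ σ a b) (hμ : 0 < μ) (hℓ : 0 < ℓ)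
    (hσ : 0 < σ) (z p : Vec n) : ∃ y v l, S.IsKKT ξ t (t + K) z G F p y v l := by
  -- Targets enter as `Q x̄`. In the dynamics, index `0` holds the initial state and index `i + 1`
  -- the offset `w` of time `t + i`.
  obtain ⟨y, v, l, hP, hG, hQ⟩ := h.exists_solution hμ hℓ hσ
    (fun i => if i < K then toEuclideanLin (S.Q (t + i) (ξ (t + i))) (S.xbar (t + i) (ξ (t + i)))
      else p) (fun _ => 0) (fun i => Nat.casesOn i z fun i => S.w (t + i) (ξ (t + i)))
  have hK : (S.lqData ξ t K G F).K = K := rfl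
  rw [hK] at hP hG hQ
  have hsub : ∀ i, t + i + 1 - t = i + 1 := fun i => by omega
  refine ⟨fun s => y (s - t), fun s => v (s - t), fun s => l (s - t), ⟨?_, ?_⟩, ?_, ?_, ?_⟩
  · simpa [LQData.resQ] using hQ 0 (Nat.zero_le _)
  · intro s hs hs'
    obtain ⟨i, rfl⟩ := Nat.exists_eq_add_of_le hs
    have := hQ (i + 1) (by omega)
    simp only [LQData.resQ, lqData] at this
    simp only [hsub, Nat.add_sub_cancel_left, step, ← this]
    abel
  · intro s hs hs'
    obtain ⟨i, rfl⟩ := Nat.exists_eq_add_of_le hs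
    have hi : i < K := by omega
    have := hP i hi.le
    rw [if_pos hi, LQData.resP_of_lt (D := S.lqData ξ t K G F) hi] at this
    simp only [lqData] at this
    simp only [hsub, Nat.add_sub_cancel_left, map_sub, ← this]
    abel
  · intro s hs hs'
    obtain ⟨i, rfl⟩ := Nat.exists_eq_add_of_le hs
    have hi : i < K := by omega
    have := hG i hi
    rw [LQData.resG_of_lt (D := S.lqData ξ t K G F) hi] at this
    simp only [hsub, Nat.add_sub_cancel_left]
    exact sub_eq_zero.1 this
  · have := hP K le_rfl
    simpa only [LQData.resP, lqData, lt_irrefl, if_false, Nat.add_sub_cancel_left] using this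

/-- The tail of a solution of the optimality conditions is one as well. -/
theorem IsKKT.tail {t₁ t₂ s : ℕ} {z : Vec n} {y : ℕ → Vec n} {v : ℕ → Vec m} {l : ℕ → Vec n}
    (h : S.IsKKT ξ t₁ t₂ z G F p y v l) (hs : t₁ ≤ s) : S.IsKKT ξ s t₂ (y s) G F p y v l :=
  ⟨⟨rfl, fun r hr hr' => h.traj.2 r (hs.trans hr) hr'⟩,
    fun r hr hr' => h.stat_x r (hs.trans hr) hr', fun r hr hr' => h.stat_u r (hs.trans hr) hr',
    h.term⟩

theorem IsKKT.res_eq {z : Vec n} {y : ℕ → Vec n} {v : ℕ → Vec m} {l : ℕ → Vec n}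
    (h : S.IsKKT ξ t (t + K) z G F p y v l) :
    (∀ i < K, (S.lqData ξ t K G F).resP (fun i => y (t + i)) (fun i => l (t + i)) i
      = toEuclideanLin (S.Q (t + i) (ξ (t + i))) (S.xbar (t + i) (ξ (t + i)))) ∧
    (S.lqData ξ t K G F).resP (fun i => y (t + i)) (fun i => l (t + i)) K = p ∧
    (∀ i, (S.lqData ξ t K G F).resG (fun i => v (t + i)) (fun i => l (t + i)) i = 0) ∧
    (S.lqData ξ t K G F).resQ (fun i => y (t + i)) (fun i => v (t + i)) 0 = z ∧
    ∀ i < K, (S.lqData ξ t K G F).resQ (fun i => y (t + i)) (fun i => v (t + i)) (i + 1)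
      = S.w (t + i) (ξ (t + i)) := by
  refine ⟨fun i hi => ?_, ?_, fun i => ?_, h.traj.1, fun i hi => ?_⟩
  · have := h.stat_x (t + i) (by omega) (by omega)
    rw [LQData.resP_of_lt (D := S.lqData ξ t K G F) hi]
    simp only [lqData]
    rw [← add_assoc t i 1, ← this, map_sub]
    abel
  · simpa only [LQData.resP, lqData, lt_irrefl, if_false] using h.term
  · by_cases hi : i < K
    · rw [LQData.resG_of_lt (D := S.lqData ξ t K G F) hi]
      simp only [lqData]
      rw [h.stat_u (t + i) (by omega) (by omega), ← add_assoc t i 1, sub_self]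
    · exact LQData.resG_of_not_lt (D := S.lqData ξ t K G F) hi _ _
  · have := h.traj.2 (t + i) (by omega) (by omega)
    simp only [LQData.resQ, lqData]
    rw [← add_assoc t i 1, this, step]
    abel

theorem _root_.LQData.resP_sub {X U : Type*} [NormedAddCommGroup X] [InnerProductSpace ℝ X]
    [FiniteDimensional ℝ X] [NormedAddCommGroup U] [InnerProductSpace ℝ U]
    (D : LQData X U) (y l y' l' : ℕ → X) (i : ℕ) :
    D.resP (fun i => y i - y' i) (fun i => l i - l' i) i = D.resP y l i - D.resP y' l' i := by
  simp only [LQData.resP, map_sub]; split_ifs <;> abel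

theorem _root_.LQData.resG_sub {X U : Type*} [NormedAddCommGroup X] [InnerProductSpace ℝ X]
    [FiniteDimensional ℝ X] [NormedAddCommGroup U] [InnerProductSpace ℝ U]
    [FiniteDimensional ℝ U] (D : LQData X U) (v v' : ℕ → U) (l l' : ℕ → X) (i : ℕ) :
    D.resG (fun i => v i - v' i) (fun i => l i - l' i) i = D.resG v l i - D.resG v' l' i := by
  simp only [LQData.resG, map_sub]; split_ifs <;> abel

theorem _root_.LQData.resQ_sub {X U : Type*} [NormedAddCommGroup X] [InnerProductSpace ℝ X]
    [NormedAddCommGroup U] [InnerProductSpace ℝ U]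
    (D : LQData X U) (y y' : ℕ → X) (v v' : ℕ → U) (i : ℕ) :
    D.resQ (fun i => y i - y' i) (fun i => v i - v' i) i = D.resQ y v i - D.resQ y' v' i := by
  cases i <;> simp only [LQData.resQ, map_sub]
  abel

variable {z z' : Vec n} {y y' : ℕ → Vec n} {v v' : ℕ → Vec m} {l l' : ℕ → Vec n}

/-- Two solutions of the optimality conditions that differ in the initial state only have a
residual at the initial time only. -/
theorem IsKKT.sub_res_eq (h : S.IsKKT ξ t (t + K) z G F p y v l)
    (h' : S.IsKKT ξ t (t + K) z' G F p y' v' l') (i : ℕ) (hi : i ≤ K) :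
    (S.lqData ξ t K G F).resP (fun i => y (t + i) - y' (t + i))
      (fun i => l (t + i) - l' (t + i)) i = 0 ∧
    (S.lqData ξ t K G F).resG (fun i => v (t + i) - v' (t + i))
      (fun i => l (t + i) - l' (t + i)) i = 0 ∧
    (S.lqData ξ t K G F).resQ (fun i => y (t + i) - y' (t + i))
      (fun i => v (t + i) - v' (t + i)) i = if i = 0 then z - z' else 0 := by
  obtain ⟨p1, p2, p3, p4, p5⟩ := h.res_eq
  obtain ⟨q1, q2, q3, q4, q5⟩ := h'.res_eq
  have eP := LQData.resP_sub (S.lqData ξ t K G F) (fun i => y (t + i)) (fun i => l (t + i))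
    (fun i => y' (t + i)) (fun i => l' (t + i)) i
  have eG := LQData.resG_sub (S.lqData ξ t K G F) (fun i => v (t + i)) (fun i => v' (t + i))
    (fun i => l (t + i)) (fun i => l' (t + i)) i
  have eQ := LQData.resQ_sub (S.lqData ξ t K G F) (fun i => y (t + i)) (fun i => y' (t + i))
    (fun i => v (t + i)) (fun i => v' (t + i)) i
  refine ⟨eP.trans ?_, eG.trans (by rw [p3, q3, sub_zero]), eQ.trans ?_⟩
  · rcases hi.eq_or_lt with rfl | hi
    · rw [p2, q2, sub_self]
    · rw [p1 i hi, q1 i hi, sub_self]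
  · cases i with
    | zero => rw [p4, q4, if_pos rfl]
    | succ i => rw [p5 i hi, q5 i hi, sub_self, if_neg (Nat.succ_ne_zero i)]

/-- Only the residual `z - z'` at time `0` remains in the difference, at distance `j` from time `j`.
-/
theorem IsKKT.norm_sub_le (h : S.IsKKT ξ t (t + K) z G F p y v l)
    (h' : S.IsKKT ξ t (t + K) z' G F p y' v' l') (hr : (S.lqData ξ t K G F).Regular μ ℓ σ a b)
    (hμ : 0 < μ) (hℓ : 0 < ℓ) (hσ : 0 < σ) (ha : 0 ≤ a) (hb : 0 ≤ b) {j : ℕ} (hj : j ≤ K) :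
    ‖y (t + j) - y' (t + j)‖ ≤
      LQData.decayConst μ ℓ σ * (LQData.decayRate μ ℓ σ a b ^ j * ‖z - z'‖) := by
  have h1 := (hr.decay hμ hℓ hσ ha hb (fun i => y (t + i) - y' (t + i))
    (fun i => v (t + i) - v' (t + i)) (fun i => l (t + i) - l' (t + i)) hj).1
  refine h1.trans (le_of_eq ?_)
  congr 1
  have hK : (S.lqData ξ t K G F).K = K := rfl
  rw [hK, Finset.sum_eq_single 0]
  · obtain ⟨e1, e2, e3⟩ := h.sub_res_eq h' 0 (Nat.zero_le K)
    rw [LQData.resNorm, e1, e2, e3, if_pos rfl, norm_zero, norm_zero, zero_add, zero_add]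
    simp [Nat.dist]
  · intro i hi hi0
    obtain ⟨e1, e2, e3⟩ := h.sub_res_eq h' i (Nat.lt_succ_iff.1 (Finset.mem_range.1 hi))
    rw [LQData.resNorm, e1, e2, e3, if_neg hi0]
    simp
  · simp

/-- The energy counterpart of `IsKKT.norm_sub_le`: the whole deviation is summable uniformly in the
horizon, which makes the loss of one wrong input independent of `T`. -/
theorem IsKKT.solSq_sub_le (h : S.IsKKT ξ t (t + K) z G F p y v l)
    (h' : S.IsKKT ξ t (t + K) z' G F p y' v' l') (hr : (S.lqData ξ t K G F).Regular μ ℓ σ a b)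
    (hμ : 0 < μ) (hℓ : 0 < ℓ) (hσ : 0 < σ) :
    (S.lqData ξ t K G F).solSq (fun i => y (t + i) - y' (t + i))
      (fun i => v (t + i) - v' (t + i)) (fun i => l (t + i) - l' (t + i)) ≤
      LQData.aprioriConst μ ℓ σ * ‖z - z'‖ ^ 2 := by
  refine (hr.solSq_le hμ hℓ hσ _ _ _).trans (le_of_eq ?_)
  congr 1
  have hK : (S.lqData ξ t K G F).K = K := rfl
  rw [hK, Finset.sum_eq_single 0]
  · obtain ⟨e1, e2, e3⟩ := h.sub_res_eq h' 0 (Nat.zero_le K)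
    rw [LQData.resSq, e1, e2, e3, if_pos rfl]
    simp
  · intro i hi hi0
    obtain ⟨e1, e2, e3⟩ := h.sub_res_eq h' i (Nat.lt_succ_iff.1 (Finset.mem_range.1 hi))
    rw [LQData.resSq, e1, e2, e3, if_neg hi0]
    simp
  · simp

end Solutions

end LTVTracking

/-! ### Uniform bounds on solutions and sensitivity to the parameters. -/

theorem geom_sum_le_inv {γ : ℝ} (h₀ : 0 ≤ γ) (h₁ : γ < 1) (N : ℕ) :
    ∑ i ∈ Finset.range N, γ ^ i ≤ 1 / (1 - γ) := by
  rw [one_div, ← tsum_geometric_of_lt_one h₀ h₁]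
  exact (summable_geometric_of_lt_one h₀ h₁).sum_le_tsum _ fun i _ => by positivity

theorem sum_pow_dist_le {γ : ℝ} (h₀ : 0 ≤ γ) (h₁ : γ < 1) {N j : ℕ} (hj : j ≤ N) :
    ∑ i ∈ Finset.range N, γ ^ Nat.dist i j ≤ 2 / (1 - γ) := by
  obtain ⟨M, rfl⟩ := Nat.exists_eq_add_of_le hj
  rw [Finset.sum_range_add, ← Finset.sum_range_reflect]
  have e1 : ∑ i ∈ Finset.range j, γ ^ Nat.dist (j - 1 - i) j ≤ ∑ i ∈ Finset.range j, γ ^ i :=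
    Finset.sum_le_sum fun i hi => by
      have hi := Finset.mem_range.1 hi
      have : Nat.dist (j - 1 - i) j = i + 1 := by simp only [Nat.dist]; omega
      rw [this]
      exact pow_le_pow_of_le_one h₀ h₁.le (Nat.le_succ i)
  have e2 : ∑ i ∈ Finset.range M, γ ^ Nat.dist (j + i) j = ∑ i ∈ Finset.range M, γ ^ i :=
    Finset.sum_congr rfl fun i _ => by
      have : Nat.dist (j + i) j = i := by simp only [Nat.dist]; omega
      rw [this]
  have e3 := geom_sum_le_inv h₀ h₁ j
  have e4 := geom_sum_le_inv h₀ h₁ M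
  have e5 : 2 / (1 - γ) = 1 / (1 - γ) + 1 / (1 - γ) := by ring
  rw [e2, e5]
  linarith

open scoped Matrix.Norms.L2Operator in
theorem norm_adjoint_toEuclideanLin_sub_le {p q : ℕ} {M M' : Matrix (Fin p) (Fin q) ℝ} {c : ℝ}
    (h : ‖M - M'‖ ≤ c) (x : Vec p) :
    ‖(Matrix.toEuclideanLin M).adjoint x - (Matrix.toEuclideanLin M').adjoint x‖ ≤ c * ‖x‖ := by
  rw [← LinearMap.sub_apply, ← map_sub, ← map_sub]
  exact LinearMap.norm_adjoint_apply_le _ ((norm_nonneg _).trans h) (norm_toEuclideanLin_le h) x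

open scoped Matrix.Norms.L2Operator in
theorem norm_toEuclideanLin_sub_le {p q : ℕ} {M M' : Matrix (Fin p) (Fin q) ℝ} {c : ℝ}
    (h : ‖M - M'‖ ≤ c) (x : Vec q) :
    ‖Matrix.toEuclideanLin M x - Matrix.toEuclideanLin M' x‖ ≤ c * ‖x‖ := by
  rw [← LinearMap.sub_apply, ← map_sub]
  exact norm_toEuclideanLin_le h x

namespace LTVTracking

open Matrix (toEuclideanLin)

variable {T n m : ℕ} {E : ℕ → Type u} {S : LTVTracking T n m E} {ξ ζ : ∀ t, E t} {t K : ℕ}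
  {G F : Vec n →ₗ[ℝ] Vec n} {p z : Vec n} {μ ℓ σ a b : ℝ}
  {y : ℕ → Vec n} {v : ℕ → Vec m} {l : ℕ → Vec n}

/-- Solutions of the optimality conditions are bounded uniformly in the horizon. -/
theorem IsKKT.norm_le (h : S.IsKKT ξ t (t + K) z G F p y v l)
    (hr : (S.lqData ξ t K G F).Regular μ ℓ σ a b)
    (hμ : 0 < μ) (hℓ : 0 < ℓ) (hσ : 0 < σ) (ha : 0 ≤ a) (hb : 0 ≤ b) {d d' : ℝ} (hd' : 0 ≤ d')
    (hx : ∀ i < K, ‖toEuclideanLin (S.Q (t + i) (ξ (t + i))) (S.xbar (t + i) (ξ (t + i)))‖ ≤ d)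
    (hp : ‖p‖ ≤ d) (hw : ∀ i < K, ‖S.w (t + i) (ξ (t + i))‖ ≤ d') {j : ℕ} (hj : j ≤ K) :
    (‖y (t + j)‖ ≤ LQData.decayConst μ ℓ σ *
      (2 / (1 - LQData.decayRate μ ℓ σ a b) * (d + d') + ‖z‖)) ∧
    (‖l (t + j)‖ ≤ LQData.decayConst μ ℓ σ *
      (2 / (1 - LQData.decayRate μ ℓ σ a b) * (d + d') + ‖z‖)) ∧
    (j < K → ‖v (t + j)‖ ≤ LQData.decayConst μ ℓ σ *
      (2 / (1 - LQData.decayRate μ ℓ σ a b) * (d + d') + ‖z‖)) := by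
  have hγ0 := LQData.decayRate_pos (a := a) (b := b) hμ hℓ hσ
  have hγ1 := LQData.decayRate_lt_one (a := a) (b := b) hμ hℓ hσ
  set γ := LQData.decayRate μ ℓ σ a b with hγ
  have h1 := hr.decay hμ hℓ hσ ha hb (fun i => y (t + i)) (fun i => v (t + i))
    (fun i => l (t + i)) (j := j) hj
  obtain ⟨p1, p2, p3, p4, p5⟩ := h.res_eq
  have hres : ∀ i ≤ K, (S.lqData ξ t K G F).resNorm (fun i => y (t + i)) (fun i => v (t + i))
      (fun i => l (t + i)) i ≤ (d + d') + if i = 0 then ‖z‖ else 0 := fun i hi => by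
    have e1 : ‖(S.lqData ξ t K G F).resP (fun i => y (t + i)) (fun i => l (t + i)) i‖ ≤ d := by
      rcases hi.eq_or_lt with rfl | hi
      · rwa [p2]
      · rw [p1 i hi]; exact hx i hi
    have e2 : ‖(S.lqData ξ t K G F).resQ (fun i => y (t + i)) (fun i => v (t + i)) i‖ ≤
        d' + if i = 0 then ‖z‖ else 0 := by
      cases i with
      | zero => rw [p4, if_pos rfl]; linarith
      | succ i => rw [p5 i hi, if_neg (Nat.succ_ne_zero i), add_zero]; exact hw i hi
    rw [LQData.resNorm, p3, norm_zero, add_zero]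
    linarith
  have hdd : 0 ≤ d + d' := add_nonneg ((norm_nonneg _).trans hp) hd'
  have hsum : ∑ i ∈ Finset.range (K + 1), γ ^ Nat.dist i j *
      (S.lqData ξ t K G F).resNorm (fun i => y (t + i)) (fun i => v (t + i))
      (fun i => l (t + i)) i ≤ 2 / (1 - γ) * (d + d') + ‖z‖ := by
    calc _ ≤ ∑ i ∈ Finset.range (K + 1), (γ ^ Nat.dist i j * (d + d')
          + if i = 0 then ‖z‖ else 0) := Finset.sum_le_sum fun i hi => by
            have hi := Nat.lt_succ_iff.1 (Finset.mem_range.1 hi)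
            have g1 : 0 ≤ γ ^ Nat.dist i j := by positivity
            have g2 : γ ^ Nat.dist i j ≤ 1 := pow_le_one₀ hγ0.le hγ1.le
            have g3 : 0 ≤ if i = 0 then ‖z‖ else 0 := by split_ifs <;> positivity
            refine (mul_le_mul_of_nonneg_left (hres i hi) g1).trans ?_
            rw [mul_add]
            have := mul_le_mul_of_nonneg_right g2 g3
            linarith
      _ = (∑ i ∈ Finset.range (K + 1), γ ^ Nat.dist i j) * (d + d') + ‖z‖ := by
            rw [Finset.sum_add_distrib, ← Finset.sum_mul]; simp
      _ ≤ _ := by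
            have := mul_le_mul_of_nonneg_right
              (sum_pow_dist_le hγ0.le hγ1 (hj.trans (Nat.le_succ K))) hdd
            linarith
  have hG := (LQData.decayConst_pos hμ hℓ hσ).le
  have hfin := mul_le_mul_of_nonneg_left hsum hG
  exact ⟨h1.1.trans hfin, h1.2.1.trans hfin, fun hjK => (h1.2.2 hjK).trans hfin⟩

variable [∀ t, NormedAddCommGroup (E t)] {k : ℕ} {Dw Dx LA LB LQ LR LP Lx Lw : ℝ}

/-- Sensitivity of the first input to errors in the parameters and in the terminal condition. -/
theorem IsKKT.norm_first_input_sub_le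
    (hS : S.Assumptions k μ ℓ σ a b Dw Dx LA LB LQ LR LP Lx Lw)
    (hμ : 0 < μ) (hℓ : 0 ≤ ℓ) (ha : 0 ≤ a) (hb : 0 ≤ b) (hLA : 0 ≤ LA)
    (hLB : 0 ≤ LB) (hLQ : 0 ≤ LQ) (hLR : 0 ≤ LR) (hK : 0 < K) (htK : t + K ≤ T)
    (hξ : ∀ s, t ≤ s → s < t + K → ξ s ∈ S.Ξ s) (hζ : ∀ s, t ≤ s → s < t + K → ζ s ∈ S.Ξ s)
    (h : S.IsKKT ζ t (t + K) z G F p y v l) {σ' : ℝ} (hσ' : 0 < σ')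
    (hr : (S.lqData ζ t K G F).Regular μ (ℓ + 1) σ' a b)
    {G' F' : Vec n →ₗ[ℝ] Vec n} {p' : Vec n} {y' : ℕ → Vec n} {v' : ℕ → Vec m} {l' : ℕ → Vec n}
    (h' : S.IsKKT ξ t T z G' F' p' y' v' l') {N : ℝ} (hy : ∀ i ≤ K, ‖y' (t + i)‖ ≤ N)
    (hl : ∀ i ≤ K, ‖l' (t + i)‖ ≤ N) (hv : ∀ i < K, ‖v' (t + i)‖ ≤ N) :
    ‖v' t - v t‖ ≤ LQData.decayConst μ (ℓ + 1) σ' *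
      ((LQ * (N + Dx) + (ℓ + 1) * Lx + LR * N + 2 * (LA * N) + 2 * (LB * N) + Lw) *
        ∑ i ∈ Finset.range K, LQData.decayRate μ (ℓ + 1) σ' a b ^ i * ‖ζ (t + i) - ξ (t + i)‖
      + LQData.decayRate μ (ℓ + 1) σ' a b ^ K * ‖G (y' (t + K)) + F (l' (t + K)) - p‖) := by
  have hℓ' : 0 < ℓ + 1 := by linarith
  have hγ0 := LQData.decayRate_pos (a := a) (b := b) hμ hℓ' hσ'
  have hγ1 := LQData.decayRate_lt_one (a := a) (b := b) hμ hℓ' hσ'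
  set γ := LQData.decayRate μ (ℓ + 1) σ' a b with hγ
  set D := S.lqData ζ t K G F with hD
  -- The solution for `ξ`, restricted to the window, is inserted into the system for `ζ`. The
  -- initial states agree; the Lipschitz bounds make each residual before the end proportional to a
  -- parameter error, and the terminal residual sits at distance `K` from the first input.
  have h1 := (hr.decay hμ hℓ' hσ' ha hb (fun i => y' (t + i) - y (t + i))
    (fun i => v' (t + i) - v (t + i)) (fun i => l' (t + i) - l (t + i)) (Nat.zero_le _)).2.2 hK
  refine h1.trans (mul_le_mul_of_nonneg_left ?_ (LQData.decayConst_pos hμ hℓ' hσ').le)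
  obtain ⟨p1, p2, p3, p4, p5⟩ := h.res_eq
  set ρ := fun i => ‖ζ (t + i) - ξ (t + i)‖ with hρ
  have hT : ∀ i < K, t + i < T := fun i hi => by omega
  have hmξ : ∀ i < K, ξ (t + i) ∈ S.Ξ (t + i) := fun i hi => hξ _ (by omega) (by omega)
  have hmζ : ∀ i < K, ζ (t + i) ∈ S.Ξ (t + i) := fun i hi => hζ _ (by omega) (by omega)
  have hρ0 : ∀ i, 0 ≤ ρ i := fun i => norm_nonneg _
  have hP : ∀ i < K, ‖D.resP (fun i => y' (t + i) - y (t + i)) (fun i => l' (t + i) - l (t + i)) i‖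
      ≤ (LQ * (N + Dx) + (ℓ + 1) * Lx + LA * N) * ρ i := fun i hi => by
    rw [LQData.resP_sub D (fun i => y' (t + i)) (fun i => l' (t + i)) (fun i => y (t + i))
      (fun i => l (t + i)), p1 i hi, LQData.resP_of_lt (D := D) hi]
    have e0 := h'.stat_x (t + i) (by omega) (hT i hi)
    have e1 : D.Q i (y' (t + i)) + l' (t + i) - (D.A i).adjoint (l' (t + (i + 1)))
        - toEuclideanLin (S.Q (t + i) (ζ (t + i))) (S.xbar (t + i) (ζ (t + i))) =
        (toEuclideanLin (S.Q (t + i) (ζ (t + i))) (y' (t + i) - S.xbar (t + i) (ξ (t + i)))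
          - toEuclideanLin (S.Q (t + i) (ξ (t + i))) (y' (t + i) - S.xbar (t + i) (ξ (t + i))))
        - toEuclideanLin (S.Q (t + i) (ζ (t + i)))
          (S.xbar (t + i) (ζ (t + i)) - S.xbar (t + i) (ξ (t + i)))
        - ((toEuclideanLin (S.A (t + i) (ζ (t + i)))).adjoint (l' (t + (i + 1)))
          - (toEuclideanLin (S.A (t + i) (ξ (t + i)))).adjoint (l' (t + (i + 1)))) := by
      simp only [hD, lqData]
      rw [← add_assoc t i 1, ← e0]
      simp only [map_sub]
      abel
    rw [e1]
    have n1 := norm_toEuclideanLin_sub_le (hS.Q_lip _ (hT i hi) _ (hmζ i hi) _ (hmξ i hi))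
      (y' (t + i) - S.xbar (t + i) (ξ (t + i)))
    have n2 := norm_toEuclideanLin_le_of_posSemidef hμ.le hℓ
      (hS.Q_lower _ (hT i hi) _ (hmζ i hi)) (hS.Q_upper _ (hT i hi) _ (hmζ i hi))
      (S.xbar (t + i) (ζ (t + i)) - S.xbar (t + i) (ξ (t + i)))
    have n3 := norm_adjoint_toEuclideanLin_sub_le
      (hS.A_lip _ (hT i hi) _ (hmζ i hi) _ (hmξ i hi)) (l' (t + (i + 1)))
    have n4 : ‖y' (t + i) - S.xbar (t + i) (ξ (t + i))‖ ≤ N + Dx :=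
      (_root_.norm_sub_le _ _).trans (add_le_add (hy i hi.le) (hS.xbar_bound _ (hT i hi).le _ (hmξ i hi)))
    have n5 := hS.xbar_lip _ (hT i hi).le _ (hmζ i hi) _ (hmξ i hi)
    have m1 := mul_le_mul_of_nonneg_left n4 (mul_nonneg hLQ (hρ0 i))
    have m2 := mul_le_mul_of_nonneg_left n5 hℓ'.le
    have m3 := mul_le_mul_of_nonneg_left (hl (i + 1) hi) (mul_nonneg hLA (hρ0 i))
    refine (_root_.norm_sub_le _ _).trans ((add_le_add (_root_.norm_sub_le _ _) le_rfl).trans ?_)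
    simp only [hρ] at m1 m2 m3 ⊢
    linarith
  have hG : ∀ i < K, ‖D.resG (fun i => v' (t + i) - v (t + i)) (fun i => l' (t + i) - l (t + i)) i‖
      ≤ (LR * N + LB * N) * ρ i := fun i hi => by
    rw [LQData.resG_sub D (fun i => v' (t + i)) (fun i => v (t + i)) (fun i => l' (t + i))
      (fun i => l (t + i)), p3 i, LQData.resG_of_lt (D := D) hi, sub_zero]
    have e0 := h'.stat_u (t + i) (by omega) (hT i hi)
    have e1 : D.R i (v' (t + i)) - (D.B i).adjoint (l' (t + (i + 1))) =
        (toEuclideanLin (S.R (t + i) (ζ (t + i))) (v' (t + i))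
          - toEuclideanLin (S.R (t + i) (ξ (t + i))) (v' (t + i)))
        - ((toEuclideanLin (S.B (t + i) (ζ (t + i)))).adjoint (l' (t + (i + 1)))
          - (toEuclideanLin (S.B (t + i) (ξ (t + i)))).adjoint (l' (t + (i + 1)))) := by
      simp only [hD, lqData]
      rw [← add_assoc t i 1, ← e0]
      abel
    rw [e1]
    have n1 := norm_toEuclideanLin_sub_le (hS.R_lip _ (hT i hi) _ (hmζ i hi) _ (hmξ i hi))
      (v' (t + i))
    have n3 := norm_adjoint_toEuclideanLin_sub_le
      (hS.B_lip _ (hT i hi) _ (hmζ i hi) _ (hmξ i hi)) (l' (t + (i + 1)))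
    have m1 := mul_le_mul_of_nonneg_left (hv i hi) (mul_nonneg hLR (hρ0 i))
    have m3 := mul_le_mul_of_nonneg_left (hl (i + 1) hi) (mul_nonneg hLB (hρ0 i))
    refine (_root_.norm_sub_le _ _).trans ?_
    simp only [hρ] at m1 m3 ⊢
    linarith
  have hQ : ∀ i < K,
      ‖D.resQ (fun i => y' (t + i) - y (t + i)) (fun i => v' (t + i) - v (t + i)) (i + 1)‖
      ≤ (LA * N + LB * N + Lw) * ρ i := fun i hi => by
    rw [LQData.resQ_sub D (fun i => y' (t + i)) (fun i => y (t + i)) (fun i => v' (t + i))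
      (fun i => v (t + i)), p5 i hi]
    have e0 := h'.traj.2 (t + i) (by omega) (hT i hi)
    have e1 : D.resQ (fun i => y' (t + i)) (fun i => v' (t + i)) (i + 1)
        - S.w (t + i) (ζ (t + i)) =
        -((toEuclideanLin (S.A (t + i) (ζ (t + i))) (y' (t + i))
          - toEuclideanLin (S.A (t + i) (ξ (t + i))) (y' (t + i)))
        + (toEuclideanLin (S.B (t + i) (ζ (t + i))) (v' (t + i))
          - toEuclideanLin (S.B (t + i) (ξ (t + i))) (v' (t + i)))
        + (S.w (t + i) (ζ (t + i)) - S.w (t + i) (ξ (t + i)))) := by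
      simp only [hD, lqData, LQData.resQ]
      rw [← add_assoc t i 1, e0, step]
      abel
    rw [e1, norm_neg]
    have n1 := norm_toEuclideanLin_sub_le (hS.A_lip _ (hT i hi) _ (hmζ i hi) _ (hmξ i hi))
      (y' (t + i))
    have n2 := norm_toEuclideanLin_sub_le (hS.B_lip _ (hT i hi) _ (hmζ i hi) _ (hmξ i hi))
      (v' (t + i))
    have n3 := hS.w_lip _ (hT i hi) _ (hmζ i hi) _ (hmξ i hi)
    have m1 := mul_le_mul_of_nonneg_left (hy i hi.le) (mul_nonneg hLA (hρ0 i))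
    have m2 := mul_le_mul_of_nonneg_left (hv i hi) (mul_nonneg hLB (hρ0 i))
    refine (norm_add_le _ _).trans ((add_le_add (norm_add_le _ _) le_rfl).trans ?_)
    simp only [hρ] at m1 m2 ⊢
    linarith
  have hQ0 : D.resQ (fun i => y' (t + i) - y (t + i)) (fun i => v' (t + i) - v (t + i)) 0 = 0 := by
    rw [LQData.resQ_sub D (fun i => y' (t + i)) (fun i => y (t + i)) (fun i => v' (t + i))
      (fun i => v (t + i)), p4]
    exact sub_eq_zero.2 h'.traj.1
  have hPK : D.resP (fun i => y' (t + i) - y (t + i)) (fun i => l' (t + i) - l (t + i)) K =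
      G (y' (t + K)) + F (l' (t + K)) - p := by
    rw [LQData.resP_sub D (fun i => y' (t + i)) (fun i => l' (t + i)) (fun i => y (t + i))
      (fun i => l (t + i)), p2]
    exact congrArg (· - p) (LQData.resP_last D _ _)
  have hGK : D.resG (fun i => v' (t + i) - v (t + i)) (fun i => l' (t + i) - l (t + i)) K = 0 :=
    LQData.resG_of_not_lt (D := D) (lt_irrefl K) _ _
  have hDK : D.K = K := rfl
  simp only [hDK, LQData.resNorm, mul_add, Finset.sum_add_distrib, Nat.dist_zero_right]
  -- The dynamics residual of index `i + 1` stems from the parameters at time `t + i`, hence the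
  -- shifted sum; the surplus factor `γ` is dropped later.
  rw [Finset.sum_range_succ _ K, Finset.sum_range_succ _ K, Finset.sum_range_succ' _ K, hQ0, hPK,
    hGK, norm_zero, norm_zero, mul_zero, mul_zero, add_zero, add_zero]
  have s1 : ∑ i ∈ Finset.range K, γ ^ i *
      ‖D.resP (fun i => y' (t + i) - y (t + i)) (fun i => l' (t + i) - l (t + i)) i‖ ≤
      (LQ * (N + Dx) + (ℓ + 1) * Lx + LA * N) * ∑ i ∈ Finset.range K, γ ^ i * ρ i := by
    rw [Finset.mul_sum]
    refine Finset.sum_le_sum fun i hi => ?_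
    have := mul_le_mul_of_nonneg_left (hP i (Finset.mem_range.1 hi)) (pow_nonneg hγ0.le i)
    linarith
  have s2 : ∑ i ∈ Finset.range K, γ ^ i *
      ‖D.resG (fun i => v' (t + i) - v (t + i)) (fun i => l' (t + i) - l (t + i)) i‖ ≤
      (LR * N + LB * N) * ∑ i ∈ Finset.range K, γ ^ i * ρ i := by
    rw [Finset.mul_sum]
    refine Finset.sum_le_sum fun i hi => ?_
    have := mul_le_mul_of_nonneg_left (hG i (Finset.mem_range.1 hi)) (pow_nonneg hγ0.le i)
    linarith
  have s3 : ∑ i ∈ Finset.range K, γ ^ (i + 1) *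
      ‖D.resQ (fun i => y' (t + i) - y (t + i)) (fun i => v' (t + i) - v (t + i)) (i + 1)‖ ≤
      (LA * N + LB * N + Lw) * ∑ i ∈ Finset.range K, γ ^ i * ρ i := by
    rw [Finset.mul_sum]
    refine Finset.sum_le_sum fun i hi => ?_
    have g1 := mul_le_mul_of_nonneg_left (hQ i (Finset.mem_range.1 hi)) (pow_nonneg hγ0.le i)
    have g2 : γ ^ (i + 1) ≤ γ ^ i := pow_le_pow_of_le_one hγ0.le hγ1.le (Nat.le_succ i)
    have g3 := mul_le_mul_of_nonneg_right g2 (norm_nonneg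
      (D.resQ (fun i => y' (t + i) - y (t + i)) (fun i => v' (t + i) - v (t + i)) (i + 1)))
    linarith
  linarith

end LTVTracking

/-! ### The optimality conditions characterise the minimisers. -/

theorem quadForm_add_of_posSemidef {n : ℕ} {M : Matrix (Fin n) (Fin n) ℝ} {μ : ℝ}
    (h : (M - μ • 1).PosSemidef) (x d : Vec n) :
    quadForm M (x + d) = quadForm M x + quadForm M d + 2 * ⟪Matrix.toEuclideanLin M x, d⟫_ℝ := by
  simp only [quadForm_eq_inner, map_add, inner_add_left, inner_add_right]
  rw [inner_toEuclideanLin_comm_of_posSemidef h x d,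
    ← inner_toEuclideanLin_comm_of_posSemidef h d x, real_inner_comm x,
    ← inner_toEuclideanLin_comm_of_posSemidef h x d]
  ring

theorem le_quadForm_of_posSemidef {n : ℕ} {M : Matrix (Fin n) (Fin n) ℝ} {μ : ℝ}
    (h : (M - μ • 1).PosSemidef) (x : Vec n) : μ * ‖x‖ ^ 2 ≤ quadForm M x := by
  rw [quadForm_eq_inner]; exact le_inner_of_posSemidef h x

theorem quadForm_le_of_posSemidef {n : ℕ} {M : Matrix (Fin n) (Fin n) ℝ} {ℓ : ℝ}
    (h : (ℓ • 1 - M).PosSemidef) (x : Vec n) : quadForm M x ≤ ℓ * ‖x‖ ^ 2 := by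
  rw [quadForm_eq_inner]; exact inner_le_of_posSemidef h x

namespace LTVTracking

open Matrix (toEuclideanLin)

variable {T n m : ℕ} {E : ℕ → Type u} {S : LTVTracking T n m E} {ξ : ∀ t, E t} {t : ℕ}
  {G F : Vec n →ₗ[ℝ] Vec n} {p z : Vec n} {μ ℓ σ a b : ℝ}
  {y y' : ℕ → Vec n} {v v' : ℕ → Vec m} {l : ℕ → Vec n}
  [∀ t, NormedAddCommGroup (E t)] {k : ℕ} {Dw Dx LA LB LQ LR LP Lx Lw : ℝ}

/-- The cost of a trajectory from time `t` on. -/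
noncomputable def costToGo (S : LTVTracking T n m E) (ξ : ∀ t, E t) (t : ℕ)
    (y : ℕ → Vec n) (v : ℕ → Vec m) : ℝ :=
  ∑ s ∈ Finset.Ico t T, S.stageCost s (ξ s) (y s) (v s) + S.terminalCost (ξ T) (y T)

/-- The quadratic part of the stage cost. -/
noncomputable def quadCost (S : LTVTracking T n m E) (s : ℕ) (ζ : E s) (x : Vec n) (u : Vec m) :
    ℝ :=
  quadForm (S.Q s ζ) x + quadForm (S.R s ζ) u

/-- The cost of a trajectory differs from that of a solution of the optimality conditions by a
quadratic form in the difference and a boundary term. -/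
theorem IsKKT.sum_stageCost_eq {t₁ t₂ : ℕ}
    (hS : S.Assumptions k μ ℓ σ a b Dw Dx LA LB LQ LR LP Lx Lw) (ht : t₁ ≤ t₂) (htT : t₂ ≤ T)
    (hξ : ∀ s, t₁ ≤ s → s < t₂ → ξ s ∈ S.Ξ s) (h : S.IsKKT ξ t₁ t₂ z G F p y v l)
    (h' : S.IsTrajectory ξ t₁ t₂ z y' v') :
    ∑ s ∈ Finset.Ico t₁ t₂, S.stageCost s (ξ s) (y' s) (v' s) =
      ∑ s ∈ Finset.Ico t₁ t₂, S.stageCost s (ξ s) (y s) (v s)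
      + ∑ s ∈ Finset.Ico t₁ t₂, S.quadCost s (ξ s) (y' s - y s) (v' s - v s)
      + 2 * ⟪l t₂, y' t₂ - y t₂⟫_ℝ := by
  -- By stationarity the cross terms of the quadratic expansion are an increment of `2 ⟪l s, y' s -
  -- y s⟫`, so they telescope.
  have key : ∀ s ∈ Finset.Ico t₁ t₂, S.stageCost s (ξ s) (y' s) (v' s) =
      S.stageCost s (ξ s) (y s) (v s) + S.quadCost s (ξ s) (y' s - y s) (v' s - v s)
      + (2 * ⟪l (s + 1), y' (s + 1) - y (s + 1)⟫_ℝ - 2 * ⟪l s, y' s - y s⟫_ℝ) := by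
    intro s hs
    obtain ⟨hs1, hs2⟩ := Finset.mem_Ico.1 hs
    have hm := hξ s hs1 hs2
    have e1 : y' s - S.xbar s (ξ s) = (y s - S.xbar s (ξ s)) + (y' s - y s) := by abel
    have e2 : v' s = v s + (v' s - v s) := by abel
    have e3 : toEuclideanLin (S.Q s (ξ s)) (y s - S.xbar s (ξ s)) =
        (toEuclideanLin (S.A s (ξ s))).adjoint (l (s + 1)) - l s :=
      eq_sub_of_add_eq (h.stat_x s hs1 hs2)
    have e4 : y' (s + 1) - y (s + 1) = toEuclideanLin (S.A s (ξ s)) (y' s - y s)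
        + toEuclideanLin (S.B s (ξ s)) (v' s - v s) := by
      rw [h'.2 s hs1 hs2, h.traj.2 s hs1 hs2, step, step, map_sub, map_sub]; abel
    have q1 := quadForm_add_of_posSemidef (hS.Q_lower s (by omega) _ hm)
      (y s - S.xbar s (ξ s)) (y' s - y s)
    have q2 := quadForm_add_of_posSemidef (hS.R_lower s (by omega) _ hm) (v s) (v' s - v s)
    rw [← e1, e3, inner_sub_left, LinearMap.adjoint_inner_left] at q1
    rw [← e2, h.stat_u s hs1 hs2, LinearMap.adjoint_inner_left] at q2
    rw [stageCost, stageCost, quadCost, q1, q2, e4, inner_add_right]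
    ring
  have h0 : y' t₁ - y t₁ = 0 := by rw [h'.1, h.traj.1, sub_self]
  have htel : ∑ s ∈ Finset.Ico t₁ t₂,
      (2 * ⟪l (s + 1), y' (s + 1) - y (s + 1)⟫_ℝ - 2 * ⟪l s, y' s - y s⟫_ℝ) =
      2 * ⟪l t₂, y' t₂ - y t₂⟫_ℝ := by
    rw [Finset.sum_Ico_sub (fun s => 2 * ⟪l s, y' s - y s⟫_ℝ) ht, h0, inner_zero_right, mul_zero,
      sub_zero]
  rw [Finset.sum_congr rfl key, Finset.sum_add_distrib, Finset.sum_add_distrib, htel]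

theorem le_quadCost_of_mem (hS : S.Assumptions k μ ℓ σ a b Dw Dx LA LB LQ LR LP Lx Lw)
    {s : ℕ} (hs : s < T) (hξ : ξ s ∈ S.Ξ s) (x : Vec n) (u : Vec m) :
    μ * ‖x‖ ^ 2 + μ * ‖u‖ ^ 2 ≤ S.quadCost s (ξ s) x u :=
  add_le_add (le_quadForm_of_posSemidef (hS.Q_lower s hs _ hξ) x)
    (le_quadForm_of_posSemidef (hS.R_lower s hs _ hξ) u)

/-- The terminal condition cancels the boundary term, leaving a positive definite excess. It yields
optimality and uniqueness, and later an upper bound on the loss. -/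
theorem IsKKT.costToGo_eq
    (hS : S.Assumptions k μ ℓ σ a b Dw Dx LA LB LQ LR LP Lx Lw) (ht : t ≤ T)
    (hξ : ∀ s, t ≤ s → s ≤ T → ξ s ∈ S.Ξ s)
    (h : S.IsKKT ξ t T z (toEuclideanLin (S.PT (ξ T))) LinearMap.id
      (toEuclideanLin (S.PT (ξ T)) (S.xbar T (ξ T))) y v l)
    (h' : S.IsTrajectory ξ t T z y' v') :
    S.costToGo ξ t y' v' = S.costToGo ξ t y v
      + (∑ s ∈ Finset.Ico t T, S.quadCost s (ξ s) (y' s - y s) (v' s - v s)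
        + quadForm (S.PT (ξ T)) (y' T - y T)) := by
  have h1 := h.sum_stageCost_eq hS ht le_rfl (fun s hs hs' => hξ s hs hs'.le) h'
  have e1 : y' T - S.xbar T (ξ T) = (y T - S.xbar T (ξ T)) + (y' T - y T) := by abel
  have e2 : toEuclideanLin (S.PT (ξ T)) (y T - S.xbar T (ξ T)) = - l T := by
    have := h.term
    rw [LinearMap.id_apply] at this
    rw [map_sub, ← this]; abel
  have q1 := quadForm_add_of_posSemidef (hS.PT_lower _ (hξ T ht le_rfl))
      (y T - S.xbar T (ξ T)) (y' T - y T)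
  rw [← e1, e2, inner_neg_left] at q1
  rw [costToGo, costToGo, h1, terminalCost, terminalCost, q1]
  ring

theorem ftocpCost_final_eq (S : LTVTracking T n m E) (ξ : ∀ t, E t) (t : ℕ) (y : ℕ → Vec n)
    (v : ℕ → Vec m) :
    S.ftocpCost ξ t T (fun x => (S.terminalCost (ξ T) x : EReal)) y v
      = (S.costToGo ξ t y v : EReal) := by
  rw [ftocpCost, costToGo, EReal.coe_add]

theorem eq_zero_of_mul_norm_sq_le {X : Type*} [NormedAddCommGroup X] {x : X} {c : ℝ} (hc : 0 < c)
    (h : c * ‖x‖ ^ 2 ≤ 0) : x = 0 := by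
  rw [← norm_eq_zero]
  have : ‖x‖ ^ 2 ≤ 0 := by
    by_contra! h'
    exact absurd h (not_le.2 (mul_pos hc h'))
  exact pow_eq_zero_iff two_ne_zero |>.1 (le_antisymm this (sq_nonneg _))

theorem eq_of_sum_quadCost_le {t₁ t₂ : ℕ}
    (hS : S.Assumptions k μ ℓ σ a b Dw Dx LA LB LQ LR LP Lx Lw) (hμ : 0 < μ) (htT : t₂ ≤ T)
    (hξ : ∀ s, t₁ ≤ s → s < t₂ → ξ s ∈ S.Ξ s)
    (h : ∑ s ∈ Finset.Ico t₁ t₂, S.quadCost s (ξ s) (y' s - y s) (v' s - v s) ≤ 0) {s : ℕ}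
    (hs : t₁ ≤ s) (hs' : s < t₂) : y' s = y s ∧ v' s = v s := by
  have hq : ∀ s ∈ Finset.Ico t₁ t₂, μ * ‖y' s - y s‖ ^ 2 + μ * ‖v' s - v s‖ ^ 2 ≤
      S.quadCost s (ξ s) (y' s - y s) (v' s - v s) := fun s hs => by
    obtain ⟨hs1, hs2⟩ := Finset.mem_Ico.1 hs
    exact le_quadCost_of_mem hS (by omega) (hξ s hs1 hs2) _ _
  have h1 := Finset.single_le_sum (f := fun s => S.quadCost s (ξ s) (y' s - y s) (v' s - v s))
    (fun s hs => le_trans (by positivity) (hq s hs)) (Finset.mem_Ico.2 ⟨hs, hs'⟩)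
  have h2 := (hq s (Finset.mem_Ico.2 ⟨hs, hs'⟩)).trans (h1.trans h)
  have h3 : 0 ≤ μ * ‖y' s - y s‖ ^ 2 := by positivity
  have h4 : 0 ≤ μ * ‖v' s - v s‖ ^ 2 := by positivity
  exact ⟨sub_eq_zero.1 (eq_zero_of_mul_norm_sq_le hμ (by linarith)),
    sub_eq_zero.1 (eq_zero_of_mul_norm_sq_le hμ (by linarith))⟩

theorem IsKKT.isFTOCPSolution_final
    (hS : S.Assumptions k μ ℓ σ a b Dw Dx LA LB LQ LR LP Lx Lw) (hμ : 0 < μ) (ht : t ≤ T)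
    (hξ : ∀ s, t ≤ s → s ≤ T → ξ s ∈ S.Ξ s)
    (h : S.IsKKT ξ t T z (toEuclideanLin (S.PT (ξ T))) LinearMap.id
      (toEuclideanLin (S.PT (ξ T)) (S.xbar T (ξ T))) y v l) :
    S.IsFTOCPSolution ξ t T z (fun x => (S.terminalCost (ξ T) x : EReal)) y v := by
  refine ⟨h.traj, fun y' v' h' => ?_⟩
  rw [ftocpCost_final_eq, ftocpCost_final_eq, EReal.coe_le_coe_iff, h.costToGo_eq hS ht hξ h']
  refine le_add_of_nonneg_right (add_nonneg (Finset.sum_nonneg fun s hs => ?_) ?_)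
  · obtain ⟨hs1, hs2⟩ := Finset.mem_Ico.1 hs
    exact le_trans (by positivity) (le_quadCost_of_mem hS hs2 (hξ s hs1 hs2.le) _ _)
  · exact le_trans (by positivity)
      (le_quadForm_of_posSemidef (hS.PT_lower _ (hξ T ht le_rfl)) (y' T - y T))

theorem IsKKT.eq_of_isFTOCPSolution_final
    (hS : S.Assumptions k μ ℓ σ a b Dw Dx LA LB LQ LR LP Lx Lw) (hμ : 0 < μ) (ht : t ≤ T)
    (hξ : ∀ s, t ≤ s → s ≤ T → ξ s ∈ S.Ξ s)
    (h : S.IsKKT ξ t T z (toEuclideanLin (S.PT (ξ T))) LinearMap.id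
      (toEuclideanLin (S.PT (ξ T)) (S.xbar T (ξ T))) y v l)
    (h' : S.IsFTOCPSolution ξ t T z (fun x => (S.terminalCost (ξ T) x : EReal)) y' v') :
    (∀ s, t ≤ s → s ≤ T → y' s = y s) ∧ ∀ s, t ≤ s → s < T → v' s = v s := by
  have h1 := h'.2 y v h.traj
  rw [ftocpCost_final_eq, ftocpCost_final_eq, EReal.coe_le_coe_iff, h.costToGo_eq hS ht hξ h'.1]
    at h1
  have h2 : 0 ≤ ∑ s ∈ Finset.Ico t T, S.quadCost s (ξ s) (y' s - y s) (v' s - v s) :=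
    Finset.sum_nonneg fun s hs => by
      obtain ⟨hs1, hs2⟩ := Finset.mem_Ico.1 hs
      exact le_trans (by positivity) (le_quadCost_of_mem hS hs2 (hξ s hs1 hs2.le) _ _)
  have h3 := le_quadForm_of_posSemidef (hS.PT_lower _ (hξ T ht le_rfl)) (y' T - y T)
  have h4 : 0 ≤ μ * ‖y' T - y T‖ ^ 2 := by positivity
  have h5 := fun s hs hs' => eq_of_sum_quadCost_le hS hμ le_rfl
    (fun s hs hs' => hξ s hs hs'.le) (y := y) (y' := y') (v := v) (v' := v') (by linarith)
    (s := s) hs hs'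
  refine ⟨fun s hs hs' => ?_, fun s hs hs' => (h5 s hs hs').2⟩
  rcases hs'.eq_or_lt with rfl | hs'
  · exact sub_eq_zero.1 (eq_zero_of_mul_norm_sq_le hμ (by linarith))
  · exact (h5 s hs hs').1

/-- A competitor of finite cost has the same final state, so the boundary term vanishes whatever the
multiplier; all others cost `⊤`. -/
theorem IsKKT.isFTOCPSolution_window
    (hS : S.Assumptions k μ ℓ σ a b Dw Dx LA LB LQ LR LP Lx Lw) (hμ : 0 < μ) (ht : t + k < T)
    (hξ : ∀ s, t ≤ s → s < t + k → ξ s ∈ S.Ξ s)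
    (h : S.IsKKT ξ t (t + k) z LinearMap.id 0 (S.xbar (t + k) (ξ (t + k))) y v l) :
    S.IsFTOCPSolution ξ t (t + k) z (S.mpcTerminal k t ξ) y v := by
  have hy : y (t + k) = S.xbar (t + k) (ξ (t + k)) := by simpa using h.term
  refine ⟨h.traj, fun y' v' h' => ?_⟩
  rw [ftocpCost, ftocpCost, mpcTerminal, mpcTerminal, if_pos ht, if_pos ht, if_pos hy]
  split_ifs with hy'
  · have h1 := h.sum_stageCost_eq hS (Nat.le_add_right t k) ht.le hξ h'
    rw [hy, hy', sub_self, inner_zero_right, mul_zero, add_zero] at h1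
    rw [add_zero, add_zero, EReal.coe_le_coe_iff, h1]
    refine le_add_of_nonneg_right (Finset.sum_nonneg fun s hs => ?_)
    obtain ⟨hs1, hs2⟩ := Finset.mem_Ico.1 hs
    exact le_trans (by positivity)
      (le_quadCost_of_mem hS (hs2.trans ht) (hξ s hs1 hs2) _ _)
  · rw [EReal.coe_add_top]; exact le_top

theorem IsKKT.eq_of_isFTOCPSolution_window
    (hS : S.Assumptions k μ ℓ σ a b Dw Dx LA LB LQ LR LP Lx Lw) (hμ : 0 < μ) (ht : t + k < T)
    (hξ : ∀ s, t ≤ s → s < t + k → ξ s ∈ S.Ξ s)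
    (h : S.IsKKT ξ t (t + k) z LinearMap.id 0 (S.xbar (t + k) (ξ (t + k))) y v l)
    (h' : S.IsFTOCPSolution ξ t (t + k) z (S.mpcTerminal k t ξ) y' v') {s : ℕ} (hs : t ≤ s)
    (hs' : s < t + k) : v' s = v s := by
  have hy : y (t + k) = S.xbar (t + k) (ξ (t + k)) := by simpa using h.term
  have h1 := h'.2 y v h.traj
  rw [ftocpCost, ftocpCost, mpcTerminal, mpcTerminal, if_pos ht, if_pos ht, if_pos hy, add_zero]
    at h1
  split_ifs at h1 with hy'
  · have h2 := h.sum_stageCost_eq hS (Nat.le_add_right t k) ht.le hξ h'.1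
    rw [hy, hy', sub_self, inner_zero_right, mul_zero, add_zero] at h2
    rw [add_zero, EReal.coe_le_coe_iff, h2] at h1
    exact (eq_of_sum_quadCost_le hS hμ ht.le hξ (y := y) (y' := y') (v := v) (v' := v')
      (by linarith) hs hs').2
  · rw [EReal.coe_add_top, top_le_iff] at h1
    exact absurd h1 (EReal.coe_ne_top _)

end LTVTracking

/-! ### Distance of the predictive controller's input from the optimal input. -/

namespace LTVTracking

open Matrix (toEuclideanLin)

/-- The decay rate of the sensitivity of tracking problems. -/
noncomputable def trackRate (μ ℓ σ a b : ℝ) : ℝ := LQData.decayRate μ (ℓ + 1) (min σ 1) a b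

/-- The constant of the exponential decay of the sensitivity of tracking problems. -/
noncomputable def trackConst (μ ℓ σ : ℝ) : ℝ := LQData.decayConst μ (ℓ + 1) (min σ 1)

/-- The constant of the linear growth of optimal trajectories in the initial state. -/
noncomputable def growthConst (μ ℓ σ a b Dw Dx : ℝ) : ℝ :=
  trackConst μ ℓ σ * (2 / (1 - trackRate μ ℓ σ a b) * ((ℓ + 1) * Dx + Dw) + 1)

/-- The constant in the bound of the distance between the input of the predictive controller and
the optimal input. -/
noncomputable def inputErrConst (μ ℓ σ a b Dw Dx LA LB LQ LR LP Lx Lw : ℝ) : ℝ :=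
  trackConst μ ℓ σ * ((LQ * (growthConst μ ℓ σ a b Dw Dx + Dx) + (ℓ + 1) * Lx
    + LR * growthConst μ ℓ σ a b Dw Dx + 2 * (LA * growthConst μ ℓ σ a b Dw Dx)
    + 2 * (LB * growthConst μ ℓ σ a b Dw Dx) + Lw)
    + (LP * (growthConst μ ℓ σ a b Dw Dx + Dx) + (ℓ + 1) * Lx)
    + (growthConst μ ℓ σ a b Dw Dx + Dx))

variable {T n m : ℕ} {E : ℕ → Type u} {S : LTVTracking T n m E} {ξ : ∀ t, E t} {t : ℕ}
  {z : Vec n} {μ ℓ σ a b : ℝ} {y : ℕ → Vec n} {v : ℕ → Vec m} {l : ℕ → Vec n}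
  [∀ t, NormedAddCommGroup (E t)] {k : ℕ} {Dw Dx LA LB LQ LR LP Lx Lw : ℝ}

theorem trackRate_pos (hμ : 0 < μ) (hℓ : 0 ≤ ℓ) (hσ : 0 < σ) : 0 < trackRate μ ℓ σ a b :=
  LQData.decayRate_pos hμ (by linarith) (lt_min hσ one_pos)

theorem trackRate_lt_one (hμ : 0 < μ) (hℓ : 0 ≤ ℓ) (hσ : 0 < σ) : trackRate μ ℓ σ a b < 1 :=
  LQData.decayRate_lt_one hμ (by linarith) (lt_min hσ one_pos)

theorem trackConst_pos (hμ : 0 < μ) (hℓ : 0 ≤ ℓ) (hσ : 0 < σ) : 0 < trackConst μ ℓ σ :=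
  LQData.decayConst_pos hμ (by linarith) (lt_min hσ one_pos)

theorem growthConst_nonneg (hμ : 0 < μ) (hℓ : 0 ≤ ℓ) (hσ : 0 < σ) (hDw : 0 ≤ Dw) (hDx : 0 ≤ Dx) :
    0 ≤ growthConst μ ℓ σ a b Dw Dx := by
  have h1 := trackConst_pos hμ hℓ hσ
  have h2 : 0 < 1 - trackRate μ ℓ σ a b := by linarith [trackRate_lt_one (a := a) (b := b) hμ hℓ hσ]
  unfold growthConst
  positivity

/-- `(y, v, l)` solves the optimality conditions of the problem over `[t, T]` from `z`. -/
abbrev IsFinalKKT (S : LTVTracking T n m E) (ξ : ∀ t, E t) (t : ℕ) (z : Vec n) (y : ℕ → Vec n)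
    (v : ℕ → Vec m) (l : ℕ → Vec n) : Prop :=
  S.IsKKT ξ t T z (toEuclideanLin (S.PT (ξ T))) LinearMap.id
    (toEuclideanLin (S.PT (ξ T)) (S.xbar T (ξ T))) y v l

theorem exists_isFinalKKT (hS : S.Assumptions k μ ℓ σ a b Dw Dx LA LB LQ LR LP Lx Lw) (hμ : 0 < μ)
    (hℓ : 0 ≤ ℓ) (hσ : 0 < σ) (ht : t ≤ T) (hξ : ∀ s, t ≤ s → s ≤ T → ξ s ∈ S.Ξ s) (z : Vec n) :
    ∃ y v l, S.IsFinalKKT ξ t z y v l := by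
  obtain ⟨K, hK⟩ := Nat.exists_eq_add_of_le ht
  have := exists_isKKT (hS.regular_final hμ hℓ hσ hK.symm hξ) hμ (by linarith)
    (lt_min hσ one_pos) z (toEuclideanLin (S.PT (ξ T)) (S.xbar T (ξ T)))
  rwa [← hK] at this

theorem IsKKT.norm_le_growthConst (hS : S.Assumptions k μ ℓ σ a b Dw Dx LA LB LQ LR LP Lx Lw)
    (hμ : 0 < μ) (hℓ : 0 ≤ ℓ) (hσ : 0 < σ) (ha : 0 ≤ a) (hb : 0 ≤ b) (hDw : 0 ≤ Dw) (hDx : 0 ≤ Dx)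
    {K : ℕ} (hK : t + K = T)
    (hξ : ∀ s, t ≤ s → s ≤ T → ξ s ∈ S.Ξ s) (h : S.IsFinalKKT ξ t z y v l) {j : ℕ} (hj : j ≤ K) :
    ‖y (t + j)‖ ≤ growthConst μ ℓ σ a b Dw Dx * (1 + ‖z‖) ∧
    ‖l (t + j)‖ ≤ growthConst μ ℓ σ a b Dw Dx * (1 + ‖z‖) ∧
    (j < K → ‖v (t + j)‖ ≤ growthConst μ ℓ σ a b Dw Dx * (1 + ‖z‖)) := by
  have hm : ∀ i ≤ K, ξ (t + i) ∈ S.Ξ (t + i) := fun i hi => hξ _ (by omega) (by omega)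
  have hmT := hξ T (by omega) le_rfl
  have h1 := IsKKT.norm_le (K := K) (by rw [hK]; exact h) (hS.regular_final hμ hℓ hσ hK hξ) hμ
    (by linarith) (lt_min hσ one_pos) ha hb (d := (ℓ + 1) * Dx) hDw
    (fun i hi => (norm_toEuclideanLin_le_of_posSemidef hμ.le hℓ
      (hS.Q_lower _ (by omega) _ (hm i hi.le)) (hS.Q_upper _ (by omega) _ (hm i hi.le)) _).trans
      (mul_le_mul_of_nonneg_left (hS.xbar_bound _ (by omega) _ (hm i hi.le)) (by linarith)))
    ((norm_toEuclideanLin_le_of_posSemidef hμ.le hℓ (hS.PT_lower _ hmT) (hS.PT_upper _ hmT) _).trans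
      (mul_le_mul_of_nonneg_left (hS.xbar_bound _ le_rfl _ hmT) (by linarith)))
    (fun i hi => hS.w_bound _ (by omega) _ (hm i hi.le)) hj
  have h2 : trackConst μ ℓ σ * (2 / (1 - trackRate μ ℓ σ a b) * ((ℓ + 1) * Dx + Dw) + ‖z‖) ≤
      growthConst μ ℓ σ a b Dw Dx * (1 + ‖z‖) := by
    have g1 := trackConst_pos hμ hℓ hσ
    have g2 : 0 < 1 - trackRate μ ℓ σ a b := by
      linarith [trackRate_lt_one (a := a) (b := b) hμ hℓ hσ]
    unfold growthConst
    rw [mul_assoc]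
    refine mul_le_mul_of_nonneg_left ?_ g1.le
    have g3 : 0 ≤ 2 / (1 - trackRate μ ℓ σ a b) * ((ℓ + 1) * Dx + Dw) := by positivity
    nlinarith [norm_nonneg z, mul_nonneg g3 (norm_nonneg z)]
  exact ⟨h1.1.trans h2, h1.2.1.trans h2, fun hjK => (h1.2.2 hjK).trans h2⟩

theorem exists_mpc_solution (hS : S.Assumptions k μ ℓ σ a b Dw Dx LA LB LQ LR LP Lx Lw) (hμ : 0 < μ)
    (hℓ : 0 ≤ ℓ) (hσ : 0 < σ) (ht : t < T) {ζ : ∀ s, E s}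
    (hζ : ∀ s, t ≤ s → s ≤ t + k → s ≤ T → ζ s ∈ S.Ξ s) (z : Vec n) :
    ∃ y v, S.IsFTOCPSolution ζ t (min (t + k) T) z (S.mpcTerminal k t ζ) y v := by
  by_cases htk : t + k < T
  · rw [min_eq_left htk.le]
    have hm : ∀ s, t ≤ s → s < t + k → ζ s ∈ S.Ξ s := fun s hs hs' => hζ s hs hs'.le (by omega)
    obtain ⟨y, v, l, h⟩ := exists_isKKT (hS.regular_window hμ hℓ hσ htk hm) hμ (by linarith)
      (lt_min hσ one_pos) z (S.xbar (t + k) (ζ (t + k)))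
    exact ⟨y, v, h.isFTOCPSolution_window hS hμ htk hm⟩
  · have hm : ∀ s, t ≤ s → s ≤ T → ζ s ∈ S.Ξ s := fun s hs hs' => hζ s hs (by omega) hs'
    obtain ⟨y, v, l, h⟩ := exists_isFinalKKT hS hμ hℓ hσ ht.le hm z
    have hF : S.mpcTerminal k t ζ = fun x => (S.terminalCost (ζ T) x : EReal) := by
      funext x; rw [mpcTerminal, if_neg htk]
    rw [min_eq_right (not_lt.1 htk), hF]
    exact ⟨y, v, h.isFTOCPSolution_final hS hμ ht.le hm⟩

theorem predErr_nonneg (T : ℕ) (ξ : ∀ t, E t) (pred : ℕ → ∀ s, E s) (t τ : ℕ) :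
    0 ≤ predErr T ξ pred t τ := by
  unfold predErr; split_ifs <;> positivity

theorem predErr_of_le {T t τ : ℕ} (h : t + τ ≤ T) (ξ : ∀ t, E t) (pred : ℕ → ∀ s, E s) :
    predErr T ξ pred t τ = ‖pred t (t + τ) - ξ (t + τ)‖ := if_pos h

/-- The input of the predictive controller is close to the optimal one. -/
theorem norm_mpc_input_sub_le (hS : S.Assumptions k μ ℓ σ a b Dw Dx LA LB LQ LR LP Lx Lw)
    (hμ : 0 < μ) (hℓ : 0 ≤ ℓ) (hσ : 0 < σ) (ha : 0 ≤ a) (hb : 0 ≤ b) (hDw : 0 ≤ Dw) (hDx : 0 ≤ Dx)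
    (hLA : 0 ≤ LA) (hLB : 0 ≤ LB) (hLQ : 0 ≤ LQ) (hLR : 0 ≤ LR) (hLP : 0 ≤ LP) (hLx : 0 ≤ Lx)
    (hLw : 0 ≤ Lw) (hk : 0 < k) (ht : t < T) {pred : ℕ → ∀ s, E s}
    (hξ : ∀ s, s ≤ T → ξ s ∈ S.Ξ s)
    (hζ : ∀ s, t ≤ s → s ≤ t + k → s ≤ T → pred t s ∈ S.Ξ s)
    (h : S.IsFinalKKT ξ t z y v l) {y' : ℕ → Vec n} {v' : ℕ → Vec m}
    (h' : S.IsFTOCPSolution (pred t) t (min (t + k) T) z (S.mpcTerminal k t (pred t)) y' v') :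
    ‖v' t - v t‖ ≤ inputErrConst μ ℓ σ a b Dw Dx LA LB LQ LR LP Lx Lw * (1 + ‖z‖) *
      (∑ τ ∈ Finset.range k, trackRate μ ℓ σ a b ^ τ * predErr T ξ pred t τ
        + trackRate μ ℓ σ a b ^ k) := by
  have hγ0 := trackRate_pos (a := a) (b := b) hμ hℓ hσ
  have hγ1 := trackRate_lt_one (a := a) (b := b) hμ hℓ hσ
  have hH := growthConst_nonneg (a := a) (b := b) hμ hℓ hσ hDw hDx
  have hG := trackConst_pos hμ hℓ hσ
  have hσ' : 0 < min σ 1 := lt_min hσ one_pos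
  obtain ⟨K, hK⟩ := Nat.exists_eq_add_of_le ht.le
  have hbd := fun j hj => h.norm_le_growthConst hS hμ hℓ hσ ha hb hDw hDx hK.symm
    (fun s _ hs => hξ s hs) (j := j) hj
  -- The truly optimal solution is bounded by a multiple of `1 + ‖z‖ ≥ 1`, which also absorbs all
  -- constant terms.
  have hz1 : 1 ≤ 1 + ‖z‖ := by linarith [norm_nonneg z]
  have hDxz : Dx ≤ Dx * (1 + ‖z‖) := le_mul_of_one_le_right hDx hz1
  have hLxz : (ℓ + 1) * Lx ≤ (ℓ + 1) * Lx * (1 + ‖z‖) :=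
    le_mul_of_one_le_right (by positivity) hz1
  have hLwz : Lw ≤ Lw * (1 + ‖z‖) := le_mul_of_one_le_right hLw hz1
  unfold inputErrConst
  set H := growthConst μ ℓ σ a b Dw Dx with hHdef
  set γ := trackRate μ ℓ σ a b with hγ
  set Z := 1 + ‖z‖ with hZ
  have hc1 : LQ * (H * Z + Dx) + (ℓ + 1) * Lx + LR * (H * Z) + 2 * (LA * (H * Z))
      + 2 * (LB * (H * Z)) + Lw ≤ (LQ * (H + Dx) + (ℓ + 1) * Lx
    + LR * H + 2 * (LA * H) + 2 * (LB * H) + Lw) * Z := by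
    have := mul_le_mul_of_nonneg_left hDxz hLQ
    linarith
  set c1 := LQ * (H + Dx) + (ℓ + 1) * Lx + LR * H + 2 * (LA * H) + 2 * (LB * H) + Lw with hc1def
  have hc1nn : 0 ≤ c1 := by positivity
  have hZ0 : 0 ≤ Z := by linarith
  have hterm : ∀ τ, 0 ≤ γ ^ τ * predErr T ξ pred t τ := fun τ =>
    mul_nonneg (by positivity) (predErr_nonneg T ξ pred t τ)
  have hsum0 : ∀ N, 0 ≤ ∑ τ ∈ Finset.range N, γ ^ τ * predErr T ξ pred t τ := fun N =>
    Finset.sum_nonneg fun τ _ => hterm τ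
  by_cases htk : t + k < T
  -- The true trajectory need not be near the prescribed endpoint: the terminal mismatch is merely
  -- bounded, and it is the factor `γ ^ k` that makes it small.
  · rw [min_eq_left htk.le] at h'
    have hm : ∀ s, t ≤ s → s < t + k → pred t s ∈ S.Ξ s := fun s hs hs' => hζ s hs hs'.le (by omega)
    have hreg := hS.regular_window hμ hℓ hσ htk hm
    obtain ⟨y₁, v₁, l₁, h₁⟩ := exists_isKKT hreg hμ (by linarith) hσ' z
      (S.xbar (t + k) (pred t (t + k)))
    rw [h₁.eq_of_isFTOCPSolution_window hS hμ htk hm h' le_rfl (by omega), norm_sub_rev]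
    have h2 := IsKKT.norm_first_input_sub_le hS hμ hℓ ha hb hLA hLB hLQ hLR hk htk.le
      (fun s _ hs' => hξ s (by omega)) hm h₁ hσ' hreg h (N := H * Z)
      (fun i hi => (hbd i (by omega)).1) (fun i hi => (hbd i (by omega)).2.1)
      (fun i hi => (hbd i (by omega)).2.2 (by omega))
    refine h2.trans ?_
    rw [mul_assoc, mul_assoc]
    refine mul_le_mul_of_nonneg_left ?_ hG.le
    have e1 : ∑ i ∈ Finset.range k, γ ^ i * ‖pred t (t + i) - ξ (t + i)‖ =
        ∑ i ∈ Finset.range k, γ ^ i * predErr T ξ pred t i :=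
      Finset.sum_congr rfl fun i hi => by
        rw [predErr_of_le (by have := Finset.mem_range.1 hi; omega)]
    have e2 : ‖LinearMap.id (R := ℝ) (y (t + k)) + (0 : Vec n →ₗ[ℝ] Vec n) (l (t + k))
        - S.xbar (t + k) (pred t (t + k))‖ ≤ (H + Dx) * Z := by
      rw [LinearMap.id_apply, LinearMap.zero_apply, add_zero]
      have := (hbd k (by omega)).1
      have := hS.xbar_bound (t + k) htk.le _ (hζ (t + k) (by omega) le_rfl htk.le)
      exact (norm_sub_le _ _).trans (by linarith)
    change _ * ∑ i ∈ Finset.range k, γ ^ i * ‖pred t (t + i) - ξ (t + i)‖ + γ ^ k * _ ≤ _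
    rw [e1]
    have e3 := mul_le_mul_of_nonneg_right hc1 (hsum0 k)
    have e4 := mul_le_mul_of_nonneg_left e2 (pow_nonneg hγ0.le k)
    have c2nn : 0 ≤ LP * (H + Dx) + (ℓ + 1) * Lx := by positivity
    have e5 : 0 ≤ (LP * (H + Dx) + (ℓ + 1) * Lx) * Z *
      (∑ τ ∈ Finset.range k, γ ^ τ * predErr T ξ pred t τ + γ ^ k) :=
      mul_nonneg (by positivity) (add_nonneg (hsum0 k) (by positivity))
    have e6 : 0 ≤ (H + Dx) * Z * ∑ τ ∈ Finset.range k, γ ^ τ * predErr T ξ pred t τ :=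
      mul_nonneg (by positivity) (hsum0 k)
    have e7 : 0 ≤ c1 * Z * γ ^ k := by positivity
    linarith
  -- The window reaches `T`, so the terminal mismatch is itself a prediction error, of lead `K = T -
  -- t`.
  · have hm : ∀ s, t ≤ s → s ≤ T → pred t s ∈ S.Ξ s := fun s hs hs' => hζ s hs (by omega) hs'
    have hF : S.mpcTerminal k t (pred t) = fun x => (S.terminalCost (pred t T) x : EReal) := by
      funext x; rw [mpcTerminal, if_neg htk]
    rw [min_eq_right (not_lt.1 htk), hF] at h'
    have hreg := hS.regular_final hμ hℓ hσ hK.symm hm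
    obtain ⟨y₁, v₁, l₁, h₁⟩ := exists_isFinalKKT hS hμ hℓ hσ ht.le hm z
    rw [(h₁.eq_of_isFTOCPSolution_final hS hμ ht.le hm h').2 t le_rfl ht, norm_sub_rev]
    have h2 := IsKKT.norm_first_input_sub_le (K := K) hS hμ hℓ ha hb hLA hLB hLQ hLR (by omega)
      hK.symm.le (fun s _ hs' => hξ s (by omega)) (fun s hs hs' => hm s hs (by omega))
      (by rw [← hK]; exact h₁) hσ' hreg h (N := H * Z)
      (fun i hi => (hbd i hi).1) (fun i hi => (hbd i hi).2.1)
      (fun i hi => (hbd i hi.le).2.2 hi)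
    refine h2.trans ?_
    rw [mul_assoc, mul_assoc]
    refine mul_le_mul_of_nonneg_left ?_ hG.le
    have e1 : ∑ i ∈ Finset.range K, γ ^ i * ‖pred t (t + i) - ξ (t + i)‖ =
        ∑ i ∈ Finset.range K, γ ^ i * predErr T ξ pred t i :=
      Finset.sum_congr rfl fun i hi => by
        rw [predErr_of_le (by have := Finset.mem_range.1 hi; omega)]
    have hmT := hm T ht.le le_rfl
    have hxT := hξ T le_rfl
    have hρ : predErr T ξ pred t K = ‖pred t T - ξ T‖ := by
      rw [predErr_of_le hK.symm.le, ← hK]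
    have e2 : ‖toEuclideanLin (S.PT (pred t T)) (y (t + K)) + LinearMap.id (R := ℝ) (l (t + K))
        - toEuclideanLin (S.PT (pred t T)) (S.xbar T (pred t T))‖
        ≤ (LP * (H + Dx) + (ℓ + 1) * Lx) * Z * predErr T ξ pred t K := by
      have hyT := (hbd K le_rfl).1
      rw [hρ]
      rw [← hK] at hyT ⊢
      have g0 := h.term
      rw [LinearMap.id_apply] at g0 ⊢
      have g1 : toEuclideanLin (S.PT (pred t T)) (y T) + l T
          - toEuclideanLin (S.PT (pred t T)) (S.xbar T (pred t T)) =
          (toEuclideanLin (S.PT (pred t T)) (y T - S.xbar T (ξ T))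
            - toEuclideanLin (S.PT (ξ T)) (y T - S.xbar T (ξ T)))
          - toEuclideanLin (S.PT (pred t T)) (S.xbar T (pred t T) - S.xbar T (ξ T)) := by
        rw [eq_sub_of_add_eq' g0]; simp only [map_sub]; abel
      rw [g1]
      have n1 := norm_toEuclideanLin_sub_le (hS.PT_lip _ hmT _ hxT) (y T - S.xbar T (ξ T))
      have n2 := norm_toEuclideanLin_le_of_posSemidef hμ.le hℓ (hS.PT_lower _ hmT)
        (hS.PT_upper _ hmT) (S.xbar T (pred t T) - S.xbar T (ξ T))
      have n3 := hS.xbar_lip T le_rfl _ hmT _ hxT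
      have n4 : ‖y T - S.xbar T (ξ T)‖ ≤ (H + Dx) * Z :=
        (norm_sub_le _ _).trans (by linarith [hS.xbar_bound T le_rfl _ hxT])
      have m1 := mul_le_mul_of_nonneg_left n4 (mul_nonneg hLP (norm_nonneg (pred t T - ξ T)))
      have m2 := mul_le_mul_of_nonneg_left n3 (by linarith : 0 ≤ ℓ + 1)
      have m3 := mul_le_mul_of_nonneg_right hLxz (norm_nonneg (pred t T - ξ T))
      refine (norm_sub_le _ _).trans ?_
      linarith
    have e3 : ∑ τ ∈ Finset.range (K + 1), γ ^ τ * predErr T ξ pred t τ ≤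
        ∑ τ ∈ Finset.range k, γ ^ τ * predErr T ξ pred t τ + γ ^ k := by
      -- For `K = k` this lead lies just outside the sum over `τ < k`; as the parameter sets have
      -- diameter at most one, `γ ^ k` covers it.
      rcases (show K ≤ k by omega).eq_or_lt with rfl | hKk
      · rw [Finset.sum_range_succ]
        have : predErr T ξ pred t K ≤ 1 := by rw [hρ]; exact hS.diam T le_rfl _ hmT _ hxT
        have := mul_le_of_le_one_right (pow_nonneg hγ0.le K) this
        linarith
      · have := Finset.sum_le_sum_of_subset_of_nonneg (Finset.range_mono (Nat.succ_le_of_lt hKk))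
          (f := fun τ => γ ^ τ * predErr T ξ pred t τ) fun τ _ _ => hterm τ
        exact this.trans (le_add_of_nonneg_right (by positivity))
    change _ * ∑ i ∈ Finset.range K, γ ^ i * ‖pred t (t + i) - ξ (t + i)‖ + γ ^ K * _ ≤ _
    rw [e1]
    rw [Finset.sum_range_succ] at e3
    have c2nn : 0 ≤ LP * (H + Dx) + (ℓ + 1) * Lx := by positivity
    have e4 := mul_le_mul_of_nonneg_right hc1 (hsum0 K)
    have e5 := mul_le_mul_of_nonneg_left e2 (pow_nonneg hγ0.le K)
    have e6 : 0 ≤ (H + Dx) * Z *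
      (∑ τ ∈ Finset.range k, γ ^ τ * predErr T ξ pred t τ + γ ^ k) :=
      mul_nonneg (by positivity) (add_nonneg (hsum0 k) (by positivity))
    have e7 := mul_le_mul_of_nonneg_left e3
      (show 0 ≤ (c1 + (LP * (H + Dx) + (ℓ + 1) * Lx)) * Z by positivity)
    have e8 : 0 ≤ c1 * Z * (γ ^ K * predErr T ξ pred t K) := mul_nonneg (by positivity) (hterm K)
    have e9 : 0 ≤ (LP * (H + Dx) + (ℓ + 1) * Lx) * Z *
      ∑ τ ∈ Finset.range K, γ ^ τ * predErr T ξ pred t τ := mul_nonneg (by positivity) (hsum0 K)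
    linarith

end LTVTracking

/-! ### Loss per step, stability of the closed loop, and summation of the regret. -/

namespace LTVTracking

open Matrix (toEuclideanLin)

variable {T n m : ℕ} {E : ℕ → Type u} {S : LTVTracking T n m E} {ξ : ∀ t, E t} {t : ℕ}
  {z : Vec n} {μ ℓ σ a b : ℝ} {y y₁ : ℕ → Vec n} {v v₁ : ℕ → Vec m} {l l₁ : ℕ → Vec n}
  [∀ t, NormedAddCommGroup (E t)] {k : ℕ} {Dw Dx LA LB LQ LR LP Lx Lw : ℝ}

/-- The constant that bounds the loss by the squared distance to the optimal input. -/
noncomputable def lossConst (μ ℓ σ b : ℝ) : ℝ :=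
  ℓ * (1 + LQData.aprioriConst μ (ℓ + 1) (min σ 1) * b ^ 2)

theorem lossConst_nonneg (hμ : 0 < μ) (hℓ : 0 ≤ ℓ) (hσ : 0 < σ) : 0 ≤ lossConst μ ℓ σ b := by
  have := LQData.aprioriConst_pos (ℓ := ℓ + 1) hμ (by linarith) (lt_min hσ one_pos)
  unfold lossConst; positivity

theorem norm_step_sub_le (hS : S.Assumptions k μ ℓ σ a b Dw Dx LA LB LQ LR LP Lx Lw)
    (ht : t < T) (hξ : ξ t ∈ S.Ξ t) (z : Vec n) (u u' : Vec m) :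
    ‖S.step t (ξ t) z u - S.step t (ξ t) z u'‖ ≤ b * ‖u - u'‖ := by
  have : S.step t (ξ t) z u - S.step t (ξ t) z u' = toEuclideanLin (S.B t (ξ t)) (u - u') := by
    rw [step, step, map_sub]; abel
  rw [this]
  exact norm_toEuclideanLin_le (hS.B_bound t ht _ hξ) _

/-- The loss of applying the input `u` at time `t` and acting optimally afterwards is at most
quadratic in the distance of `u` to the optimal input. -/
theorem stageCost_add_costToGo_le (hS : S.Assumptions k μ ℓ σ a b Dw Dx LA LB LQ LR LP Lx Lw)
    (hμ : 0 < μ) (hℓ : 0 ≤ ℓ) (hσ : 0 < σ) (ht : t < T)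
    (hξ : ∀ s, s ≤ T → ξ s ∈ S.Ξ s) (h : S.IsFinalKKT ξ t z y v l) (u : Vec m)
    (h₁ : S.IsFinalKKT ξ (t + 1) (S.step t (ξ t) z u) y₁ v₁ l₁) :
    S.stageCost t (ξ t) z u + S.costToGo ξ (t + 1) y₁ v₁ ≤
      S.costToGo ξ t y v + lossConst μ ℓ σ b * ‖u - v t‖ ^ 2 := by
  have hσ' : 0 < min σ 1 := lt_min hσ one_pos
  -- The deviating step followed by the optimal continuation is one trajectory from `z`, whose exact
  -- excess cost is known from `IsKKT.costToGo_eq`.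
  set y' : ℕ → Vec n := fun s => if s ≤ t then z else y₁ s with hy'
  set v' : ℕ → Vec m := fun s => if s ≤ t then u else v₁ s with hv'
  have hyt : y' t = z := if_pos le_rfl
  have hvt : v' t = u := if_pos le_rfl
  have hys : ∀ s, t + 1 ≤ s → y' s = y₁ s := fun s hs => if_neg (by omega)
  have hvs : ∀ s, t + 1 ≤ s → v' s = v₁ s := fun s hs => if_neg (by omega)
  have htraj : S.IsTrajectory ξ t T z y' v' := by
    refine ⟨hyt, fun s hs hs' => ?_⟩
    rcases hs.eq_or_lt with rfl | hlt
    · rw [hys (t + 1) le_rfl, hyt, hvt, h₁.traj.1]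
    · rw [hys (s + 1) (by omega), hys s hlt, hvs s hlt, h₁.traj.2 s hlt hs']
  have hcost : S.costToGo ξ t y' v' = S.stageCost t (ξ t) z u + S.costToGo ξ (t + 1) y₁ v₁ := by
    rw [costToGo, costToGo, Finset.sum_eq_sum_Ico_succ_bot ht, hyt, hvt, hys T ht, add_assoc]
    congr 2
    refine Finset.sum_congr rfl fun s hs => ?_
    have hs := (Finset.mem_Ico.1 hs).1
    rw [hys s hs, hvs s hs]
  rw [← hcost, h.costToGo_eq hS ht.le (fun s _ hs => hξ s hs) htraj]
  refine add_le_add le_rfl ?_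
  obtain ⟨K, hK⟩ := Nat.exists_eq_add_of_le (show t + 1 ≤ T from ht)
  -- The optimal continuation and the tail of the original optimum solve the same problem from
  -- states that differ by `B (u - v t)`.
  have hsol := IsKKT.solSq_sub_le (K := K) (by rw [← hK]; exact h₁)
    (by rw [← hK]; exact h.tail (Nat.le_succ t))
    (hS.regular_final hμ hℓ hσ hK.symm fun s _ hs => hξ s hs) hμ (by linarith) hσ'
  have hM := LQData.aprioriConst_pos (ℓ := ℓ + 1) hμ (by linarith) hσ'
  set M := LQData.aprioriConst μ (ℓ + 1) (min σ 1) with hMdef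
  have hstep : ‖S.step t (ξ t) z u - y (t + 1)‖ ^ 2 ≤ b ^ 2 * ‖u - v t‖ ^ 2 := by
    rw [h.traj.2 t le_rfl ht, h.traj.1, ← mul_pow]
    exact pow_le_pow_left₀ (norm_nonneg _) (norm_step_sub_le hS ht (hξ t ht.le) z u (v t)) 2
  have hq : ∀ s < T, ∀ x w, S.quadCost s (ξ s) x w ≤ ℓ * (‖x‖ ^ 2 + ‖w‖ ^ 2) := fun s hs x w => by
    rw [quadCost, mul_add]
    exact add_le_add (quadForm_le_of_posSemidef (hS.Q_upper s hs _ (hξ s hs.le)) x)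
      (quadForm_le_of_posSemidef (hS.R_upper s hs _ (hξ s hs.le)) w)
  rw [Finset.sum_eq_sum_Ico_succ_bot ht, hyt, hvt, h.traj.1, sub_self]
  have q0 := hq t ht 0 (u - v t)
  have qT := quadForm_le_of_posSemidef (hS.PT_upper _ (hξ T le_rfl)) (y' T - y T)
  have qs : ∑ s ∈ Finset.Ico (t + 1) T, S.quadCost s (ξ s) (y' s - y s) (v' s - v s) ≤
      ∑ s ∈ Finset.Ico (t + 1) T, ℓ * (‖y₁ s - y s‖ ^ 2 + ‖v₁ s - v s‖ ^ 2) :=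
    Finset.sum_le_sum fun s hs => by
      obtain ⟨hs1, hs2⟩ := Finset.mem_Ico.1 hs
      rw [hys s hs1, hvs s hs1]
      exact hq s hs2 _ _
  rw [hys T ht] at qT
  rw [← Finset.mul_sum, Finset.sum_Ico_eq_sum_range (fun s => ‖y₁ s - y s‖ ^ 2 + ‖v₁ s - v s‖ ^ 2),
    (by omega : T - (t + 1) = K), Finset.sum_add_distrib] at qs
  have hDK : (S.lqData ξ (t + 1) K (toEuclideanLin (S.PT (ξ T))) LinearMap.id).K = K := rfl
  rw [LQData.solSq, hDK, Finset.sum_range_succ, ← hK] at hsol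
  have hl : 0 ≤ ∑ i ∈ Finset.range (K + 1), ‖l₁ (t + 1 + i) - l (t + 1 + i)‖ ^ 2 := by positivity
  have m1 := mul_le_mul_of_nonneg_left hstep hM.le
  have m2 := mul_le_mul_of_nonneg_left (show
    (∑ i ∈ Finset.range K, ‖y₁ (t + 1 + i) - y (t + 1 + i)‖ ^ 2 + ‖y₁ T - y T‖ ^ 2)
    + ∑ i ∈ Finset.range K, ‖v₁ (t + 1 + i) - v (t + 1 + i)‖ ^ 2 ≤
      M * (b ^ 2 * ‖u - v t‖ ^ 2) by linarith) hℓ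
  rw [norm_zero] at q0
  rw [hys T ht, lossConst, ← hMdef]
  linarith

/-- Deviations from the optimal inputs lead to a deviation from the optimal trajectory that forgets
old deviations at a geometric rate. -/
theorem norm_sub_le_sum_input_err (hS : S.Assumptions k μ ℓ σ a b Dw Dx LA LB LQ LR LP Lx Lw)
    (hμ : 0 < μ) (hℓ : 0 ≤ ℓ) (hσ : 0 < σ) (ha : 0 ≤ a) (hb : 0 ≤ b)
    (hξ : ∀ s, s ≤ T → ξ s ∈ S.Ξ s) {x : ℕ → Vec n} {u : ℕ → Vec m}
    (hx : ∀ t < T, x (t + 1) = S.step t (ξ t) (x t) (u t))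
    {Y : ℕ → ℕ → Vec n} {V : ℕ → ℕ → Vec m} {L : ℕ → ℕ → Vec n}
    (hY : ∀ t ≤ T, S.IsFinalKKT ξ t (x t) (Y t) (V t) (L t)) {j : ℕ} (hj : j ≤ T) :
    ‖x j - Y 0 j‖ ≤ trackConst μ ℓ σ * b *
      ∑ t ∈ Finset.range j, trackRate μ ℓ σ a b ^ (j - 1 - t) * ‖u t - V t t‖ := by
  have hG := trackConst_pos hμ hℓ hσ
  have hγ0 := trackRate_pos (a := a) (b := b) hμ hℓ hσ
  have h1 : ∀ t ∈ Finset.range j, ‖Y (t + 1) j - Y t j‖ ≤ trackConst μ ℓ σ * b *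
      (trackRate μ ℓ σ a b ^ (j - 1 - t) * ‖u t - V t t‖) := fun t ht => by
    have ht := Finset.mem_range.1 ht
    obtain ⟨K, hK⟩ := Nat.exists_eq_add_of_le (show t + 1 ≤ T by omega)
    have h2 := IsKKT.norm_sub_le (K := K) (j := j - 1 - t) (by rw [← hK]; exact hY (t + 1) (by omega))
      (by rw [← hK]; exact (hY t (by omega)).tail (Nat.le_succ t))
      (hS.regular_final hμ hℓ hσ hK.symm fun s _ hs => hξ s hs) hμ (by linarith)
      (lt_min hσ one_pos) ha hb (by omega)
    rw [(by omega : t + 1 + (j - 1 - t) = j)] at h2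
    have h3 : ‖x (t + 1) - Y t (t + 1)‖ ≤ b * ‖u t - V t t‖ := by
      rw [hx t (by omega), (hY t (by omega)).traj.2 t le_rfl (by omega),
        (hY t (by omega)).traj.1]
      exact norm_step_sub_le hS (by omega) (hξ t (by omega)) _ _ _
    have h4 := mul_le_mul_of_nonneg_left (mul_le_mul_of_nonneg_left h3
      (pow_nonneg hγ0.le (j - 1 - t))) hG.le
    refine h2.trans (h4.trans (le_of_eq ?_))
    ring
  -- Telescoping over the optimal trajectories restarted from successive states: consecutive ones
  -- differ only through one input error, which then decays.
  have h2 : x j - Y 0 j = ∑ t ∈ Finset.range j, (Y (t + 1) j - Y t j) := by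
    rw [Finset.sum_range_sub (fun t => Y t j), (hY j hj).traj.1]
  rw [h2, Finset.mul_sum]
  exact (norm_sum_le _ _).trans (Finset.sum_le_sum h1)

/-- Small gain: if the bound holds before time `j`, the accumulated deviation from the optimum is at
most half of `2 * (1 + d)`, so `1 + ‖x j‖ ≤ 1 + (1 + d) + d` and the induction closes. -/
theorem one_add_norm_le_of_input_err_le
    (hS : S.Assumptions k μ ℓ σ a b Dw Dx LA LB LQ LR LP Lx Lw)
    (hμ : 0 < μ) (hℓ : 0 ≤ ℓ) (hσ : 0 < σ) (ha : 0 ≤ a) (hb : 0 ≤ b)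
    (hξ : ∀ s, s ≤ T → ξ s ∈ S.Ξ s) {x : ℕ → Vec n} {u : ℕ → Vec m}
    (hx : ∀ t < T, x (t + 1) = S.step t (ξ t) (x t) (u t))
    {Y : ℕ → ℕ → Vec n} {V : ℕ → ℕ → Vec m} {L : ℕ → ℕ → Vec n}
    (hY : ∀ t ≤ T, S.IsFinalKKT ξ t (x t) (Y t) (V t) (L t)) {d η : ℝ}
    (hd : ∀ t ≤ T, ‖Y 0 t‖ ≤ d) (hη₀ : 0 ≤ η)
    (hη : trackConst μ ℓ σ * b * η * (1 / (1 - trackRate μ ℓ σ a b)) ≤ 1 / 2)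
    (he : ∀ t < T, ‖u t - V t t‖ ≤ η * (1 + ‖x t‖)) :
    ∀ j ≤ T, 1 + ‖x j‖ ≤ 2 * (1 + d) := by
  have hG := trackConst_pos hμ hℓ hσ
  have hγ0 := trackRate_pos (a := a) (b := b) hμ hℓ hσ
  have hγ1 := trackRate_lt_one (a := a) (b := b) hμ hℓ hσ
  have hd0 : 0 ≤ d := (norm_nonneg _).trans (hd 0 (Nat.zero_le T))
  intro j
  induction j using Nat.strong_induction_on with
  | _ j ih =>
    intro hj
    have h1 := norm_sub_le_sum_input_err hS hμ hℓ hσ ha hb hξ hx hY hj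
    have h2 : ∑ t ∈ Finset.range j, trackRate μ ℓ σ a b ^ (j - 1 - t) * ‖u t - V t t‖ ≤
        η * (2 * (1 + d)) * (1 / (1 - trackRate μ ℓ σ a b)) := by
      calc _ ≤ ∑ t ∈ Finset.range j, trackRate μ ℓ σ a b ^ (j - 1 - t) * (η * (2 * (1 + d))) :=
            Finset.sum_le_sum fun t ht => by
              have ht := Finset.mem_range.1 ht
              exact mul_le_mul_of_nonneg_left ((he t (by omega)).trans
                (mul_le_mul_of_nonneg_left (ih t ht (by omega)) hη₀)) (by positivity)
        _ = η * (2 * (1 + d)) * ∑ t ∈ Finset.range j, trackRate μ ℓ σ a b ^ t := by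
            rw [← Finset.sum_mul, Finset.sum_range_reflect (fun t => trackRate μ ℓ σ a b ^ t),
              mul_comm]
        _ ≤ _ := mul_le_mul_of_nonneg_left (geom_sum_le_inv hγ0.le hγ1 j) (by positivity)
    have h3 := mul_le_mul_of_nonneg_left h2 (mul_nonneg hG.le hb)
    have h4 := mul_le_mul_of_nonneg_right hη (show 0 ≤ 2 * (1 + d) by positivity)
    have h5 : ‖x j‖ ≤ ‖x j - Y 0 j‖ + ‖Y 0 j‖ := by
      have := norm_add_le (x j - Y 0 j) (Y 0 j)
      rwa [sub_add_cancel] at this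
    have h6 := hd j hj
    linarith

/-- The regret of a trajectory is bounded by the sum of the squared distances of its inputs to the
optimal inputs. -/
theorem totalCost_sub_le_sum (hS : S.Assumptions k μ ℓ σ a b Dw Dx LA LB LQ LR LP Lx Lw)
    (hμ : 0 < μ) (hℓ : 0 ≤ ℓ) (hσ : 0 < σ) (hξ : ∀ s, s ≤ T → ξ s ∈ S.Ξ s)
    {x : ℕ → Vec n} {u : ℕ → Vec m} (hx : ∀ t < T, x (t + 1) = S.step t (ξ t) (x t) (u t))
    {Y : ℕ → ℕ → Vec n} {V : ℕ → ℕ → Vec m} {L : ℕ → ℕ → Vec n}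
    (hY : ∀ t ≤ T, S.IsFinalKKT ξ t (x t) (Y t) (V t) (L t)) :
    S.totalCost ξ x u - S.costToGo ξ 0 (Y 0) (V 0) ≤
      lossConst μ ℓ σ b * ∑ t ∈ Finset.range T, ‖u t - V t t‖ ^ 2 := by
  -- Each stage is charged with the change of the optimal cost-to-go along the actual states; the
  -- changes telescope to the regret.
  have h1 : ∀ t ∈ Finset.range T, S.stageCost t (ξ t) (x t) (u t)
      + (S.costToGo ξ (t + 1) (Y (t + 1)) (V (t + 1)) - S.costToGo ξ t (Y t) (V t)) ≤
      lossConst μ ℓ σ b * ‖u t - V t t‖ ^ 2 := fun t ht => by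
    have ht := Finset.mem_range.1 ht
    have h2 := hY (t + 1) ht
    rw [hx t ht] at h2
    have := stageCost_add_costToGo_le hS hμ hℓ hσ ht hξ (hY t ht.le) (u t) h2
    linarith
  have h2 := Finset.sum_le_sum h1
  rw [Finset.sum_add_distrib, Finset.sum_range_sub (fun t => S.costToGo ξ t (Y t) (V t)),
    ← Finset.mul_sum] at h2
  have h3 : S.costToGo ξ T (Y T) (V T) = S.terminalCost (ξ T) (x T) := by
    rw [costToGo, Finset.Ico_self, Finset.sum_empty, zero_add, (hY T le_rfl).traj.1]
  rw [h3] at h2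
  rw [totalCost]
  linarith

theorem totalCost_eq_costToGo (S : LTVTracking T n m E) (ξ : ∀ t, E t) (x : ℕ → Vec n)
    (u : ℕ → Vec m) : S.totalCost ξ x u = S.costToGo ξ 0 x u := by
  rw [totalCost, costToGo, Finset.range_eq_Ico]

theorem costToGo_congr {y' : ℕ → Vec n} {v' : ℕ → Vec m}
    (ht : t ≤ T) (hy : ∀ s, t ≤ s → s ≤ T → y' s = y s) (hv : ∀ s, t ≤ s → s < T → v' s = v s) :
    S.costToGo ξ t y' v' = S.costToGo ξ t y v := by
  rw [costToGo, costToGo, hy T ht le_rfl]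
  congr 1
  refine Finset.sum_congr rfl fun s hs => ?_
  obtain ⟨hs1, hs2⟩ := Finset.mem_Ico.1 hs
  rw [hy s hs1 hs2.le, hv s hs1 hs2]

/-- The predictive controller is well defined. -/
theorem exists_isMPCTrajectory (hS : S.Assumptions k μ ℓ σ a b Dw Dx LA LB LQ LR LP Lx Lw)
    (hμ : 0 < μ) (hℓ : 0 ≤ ℓ) (hσ : 0 < σ) {pred : ℕ → ∀ s, E s}
    (hpred : ∀ t s, t ≤ s → s ≤ t + k → s ≤ T → pred t s ∈ S.Ξ s) (x₀ : Vec n) :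
    ∃ (x : ℕ → Vec n) (v : ℕ → Vec m), S.IsMPCTrajectory k ξ pred x₀ x v := by
  -- The condition `t < T` is inside the existential so that choice yields a feedback law defined at
  -- all times.
  have h1 : ∀ (t : ℕ) (z : Vec n), ∃ w : Vec m, t < T → ∃ (y' : ℕ → Vec n) (v' : ℕ → Vec m),
      S.IsFTOCPSolution (pred t) t (min (t + k) T) z (S.mpcTerminal k t (pred t)) y' v' ∧
        w = v' t := fun t z => by
    by_cases ht : t < T
    · obtain ⟨y, v, h⟩ := exists_mpc_solution hS hμ hℓ hσ ht (hpred t) z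
      exact ⟨v t, fun _ => ⟨y, v, h, rfl⟩⟩
    · exact ⟨0, fun h => absurd h ht⟩
  choose π hπ using h1
  let x : ℕ → Vec n := fun t => Nat.rec x₀ (fun t z => S.step t (ξ t) z (π t z)) t
  exact ⟨x, fun t => π t (x t), rfl, fun t ht => ⟨hπ t (x t) ht, rfl⟩⟩

/-- Cauchy–Schwarz with the weights `γ ^ τ`, whose total is at most `1 / (1 - γ)`, then an exchange
of the sums over time and lead. -/
theorem sum_sum_predErr_sq_le {γ lam : ℝ} (hγ0 : 0 ≤ γ) (hγ1 : γ < 1) (hγl : γ ≤ lam)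
    (T k : ℕ) (ξ : ∀ t, E t) (pred : ℕ → ∀ s, E s) :
    ∑ t ∈ Finset.range T, (∑ τ ∈ Finset.range k, γ ^ τ * predErr T ξ pred t τ) ^ 2 ≤
      1 / (1 - γ) * ∑ τ ∈ Finset.range k, lam ^ τ * predPower T ξ pred τ := by
  have h1 : ∀ t ∈ Finset.range T, (∑ τ ∈ Finset.range k, γ ^ τ * predErr T ξ pred t τ) ^ 2 ≤
      1 / (1 - γ) * ∑ τ ∈ Finset.range k, γ ^ τ * predErr T ξ pred t τ ^ 2 := fun t _ => by
    have h2 := Finset.sum_sq_le_sum_mul_sum_of_sq_le_mul (Finset.range k)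
      (r := fun τ => γ ^ τ * predErr T ξ pred t τ) (f := fun τ => γ ^ τ)
      (g := fun τ => γ ^ τ * predErr T ξ pred t τ ^ 2) (fun i _ => by positivity)
      (fun i _ => by positivity) (fun i _ => le_of_eq (by ring))
    exact h2.trans (mul_le_mul_of_nonneg_right (geom_sum_le_inv hγ0 hγ1 k)
      (Finset.sum_nonneg fun i _ => by positivity))
  refine (Finset.sum_le_sum h1).trans ?_
  rw [← Finset.mul_sum, Finset.sum_comm]
  refine mul_le_mul_of_nonneg_left (Finset.sum_le_sum fun τ _ => ?_)
    (one_div_nonneg.2 (by linarith))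
  rw [← Finset.mul_sum]
  have h3 : ∑ t ∈ Finset.range T, predErr T ξ pred t τ ^ 2 ≤ predPower T ξ pred τ := by
    -- Errors beyond the horizon are zero by definition, so only times with `t + τ ≤ T` count.
    rw [predPower, ← Finset.sum_filter_of_ne (p := fun t => t + τ ≤ T)]
    · refine Finset.sum_le_sum_of_subset_of_nonneg (fun t ht => ?_) fun i _ _ => by positivity
      have := (Finset.mem_filter.1 ht).2
      exact Finset.mem_range.2 (by omega)
    · intro t _ h
      by_contra h'
      exact h (by rw [predErr, if_neg h']; norm_num)
  exact mul_le_mul (pow_le_pow_left₀ hγ0 hγl τ) h3 (Finset.sum_nonneg fun i _ => by positivity)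
    (pow_nonneg (hγ0.trans hγl) τ)

end LTVTracking

/-! ### Choice of the constants and the regret bound. -/

theorem theorem4p2 (μ σ : ℝ) (hμ : 0 < μ) (hσ : 0 < σ) (ℓ a b : ℝ≥0) :
    ∃ lam : ℝ, 0 < lam ∧ lam < 1 ∧
    ∀ Dw Dx Dopt LA LB LQ LR LP Lx Lw : ℝ≥0,
    ∃ (k₀ : ℕ) (δ C : ℝ), 0 < δ ∧
    ∀ (T n m k : ℕ) (E : ℕ → Type u) [∀ t, NormedAddCommGroup (E t)]
      (S : LTVTracking T n m E),
      S.Assumptions k μ ℓ σ a b Dw Dx LA LB LQ LR LP Lx Lw →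
    ∀ (ξ : ∀ t, E t) (pred : ℕ → ∀ s, E s) (x₀ : Vec n),
      (∀ t ≤ T, ξ t ∈ S.Ξ t) →
      (∀ t s, t ≤ s → s ≤ t + k → s ≤ T → pred t s ∈ S.Ξ s) →
    ∀ (xs : ℕ → Vec n) (us : ℕ → Vec m),
      S.IsOfflineOptimal ξ x₀ xs us →
      (∀ t ≤ T, ‖xs t‖ ≤ Dopt) →
      k₀ ≤ k →
      (∀ t < T, ∑ τ ∈ Finset.range (k + 1), lam ^ (2 * τ) * predErr T ξ pred t τ ≤ δ) →
      (∃ (x : ℕ → Vec n) (v : ℕ → Vec m), S.IsMPCTrajectory k ξ pred x₀ x v) ∧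
      ∀ (x : ℕ → Vec n) (v : ℕ → Vec m), S.IsMPCTrajectory k ξ pred x₀ x v →
        S.totalCost ξ x v - S.totalCost ξ xs us ≤
          C * (√(T * ∑ τ ∈ Finset.range k, lam ^ τ * predPower T ξ pred τ
                  + lam ^ (2 * k) * (T : ℝ) ^ 2)
                + ∑ τ ∈ Finset.range k, lam ^ τ * predPower T ξ pred τ) := by
  set γ := LTVTracking.trackRate μ ℓ σ a b with hγ
  have hℓ : (0 : ℝ) ≤ ℓ := ℓ.2
  have hγ0 : 0 < γ := LTVTracking.trackRate_pos hμ hℓ hσ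
  have hγ1 : γ < 1 := LTVTracking.trackRate_lt_one hμ hℓ hσ
  have hlam0 : 0 < √γ := Real.sqrt_pos.2 hγ0
  have hlam1 : √γ < 1 := by rw [Real.sqrt_lt' one_pos]; simpa using hγ1
  have hsq : √γ ^ 2 = γ := Real.sq_sqrt hγ0.le
  have hγlam : γ ≤ √γ := by nlinarith
  -- With `λ = √γ` the weights `λ ^ (2 * τ)` of the smallness hypothesis are the `γ ^ τ` of the
  -- input error, and `γ ^ τ ≤ λ ^ τ` suffices for the conclusion.
  refine ⟨√γ, hlam0, hlam1, ?_⟩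
  intro Dw Dx Dopt LA LB LQ LR LP Lx Lw
  set Ce := LTVTracking.inputErrConst μ ℓ σ a b Dw Dx LA LB LQ LR LP Lx Lw with hCe
  have hG : 0 < LTVTracking.trackConst μ ℓ σ := LTVTracking.trackConst_pos hμ hℓ hσ
  have hH : 0 ≤ LTVTracking.growthConst μ ℓ σ a b Dw Dx :=
    LTVTracking.growthConst_nonneg hμ hℓ hσ Dw.2 Dx.2
  have hCe0 : 0 ≤ Ce := by rw [hCe, LTVTracking.inputErrConst]; positivity
  have hJ : 0 ≤ LTVTracking.lossConst μ ℓ σ b := LTVTracking.lossConst_nonneg hμ hℓ hσ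
  -- The largest gain is about `(1 - γ) / (2 G b)` for the small-gain induction, with `G` the
  -- constant `trackConst`; the `+ 1` guards against `b = 0`.
  set η := (1 - γ) / (2 * (LTVTracking.trackConst μ ℓ σ * b + 1)) with hη
  have h1γ : 0 < 1 - γ := by linarith
  have hGb : 0 < LTVTracking.trackConst μ ℓ σ * b + 1 := by positivity
  have hη0 : 0 < η := by positivity
  set δ := η / (2 * (Ce + 1)) with hδ
  have hδ0 : 0 < δ := by positivity
  -- Half of the admissible error goes to the predictions and half to `γ ^ k`. Taking `k₁ + 1` below
  -- also ensures `0 < k`, so that a window contains a first input.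
  obtain ⟨k₁, hk₁⟩ := exists_pow_lt_of_lt_one hδ0 hγ1
  refine ⟨k₁ + 1, δ, LTVTracking.lossConst μ ℓ σ b * (Ce * (2 * (1 + Dopt))) ^ 2 * 2
    * (1 / (1 - γ)), hδ0, ?_⟩
  intro T n m k E _ S hS ξ pred x₀ hξ hpred xs us hopt hxs hk hsmall
  refine ⟨LTVTracking.exists_isMPCTrajectory hS hμ hℓ hσ hpred x₀, fun x v hmpc => ?_⟩
  have hex : ∀ t, ∃ (y : ℕ → Vec n) (w : ℕ → Vec m) (l : ℕ → Vec n),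
      t ≤ T → S.IsFinalKKT ξ t (x t) y w l := fun t => by
    by_cases ht : t ≤ T
    · obtain ⟨y, w, l, h⟩ := LTVTracking.exists_isFinalKKT hS hμ hℓ hσ ht
        (fun s _ hs => hξ s hs) (x t)
      exact ⟨y, w, l, fun _ => h⟩
    · exact ⟨0, 0, 0, fun h => absurd h ht⟩
  choose Y V L hY using hex
  have hx : ∀ t < T, x (t + 1) = S.step t (ξ t) (x t) (v t) := fun t ht => (hmpc.2 t ht).2
  have hY0 := hY 0 (Nat.zero_le T)
  rw [hmpc.1] at hY0
  -- By uniqueness the given offline optimum is the solution of the optimality conditions from `x₀`,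
  -- so its bound `Dopt` is available for `Y 0`.
  have heq := hY0.eq_of_isFTOCPSolution_final hS hμ (Nat.zero_le T) (fun s _ hs => hξ s hs) hopt
  set s : ℕ → ℝ := fun t => ∑ τ ∈ Finset.range k, γ ^ τ * predErr T ξ pred t τ with hs
  have hs0 : ∀ t, 0 ≤ s t := fun t => Finset.sum_nonneg fun τ _ =>
    mul_nonneg (by positivity) (LTVTracking.predErr_nonneg T ξ pred t τ)
  have hsδ : ∀ t < T, s t ≤ δ := fun t ht => by
    refine le_trans ?_ (hsmall t ht)
    rw [Finset.sum_range_succ]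
    have h1 : ∀ τ, √γ ^ (2 * τ) = γ ^ τ := fun τ => by rw [pow_mul, hsq]
    simp only [h1]
    exact le_add_of_nonneg_right
      (mul_nonneg (by positivity) (LTVTracking.predErr_nonneg T ξ pred t k))
  have herr : ∀ t < T, ‖v t - V t t‖ ≤ Ce * (1 + ‖x t‖) * (s t + γ ^ k) := fun t ht => by
    obtain ⟨⟨y', v', h', hv⟩, _⟩ := hmpc.2 t ht
    rw [hv]
    exact LTVTracking.norm_mpc_input_sub_le hS hμ hℓ hσ a.2 b.2 Dw.2 Dx.2 LA.2 LB.2 LQ.2 LR.2 LP.2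
      Lx.2 Lw.2 (by omega) ht hξ (hpred t) (hY t ht.le) h'
  have hγk : γ ^ k ≤ δ :=
    (pow_le_pow_of_le_one hγ0.le hγ1.le (by omega : k₁ ≤ k)).trans hk₁.le
  have herrη : ∀ t < T, ‖v t - V t t‖ ≤ η * (1 + ‖x t‖) := fun t ht => by
    have h1 : s t + γ ^ k ≤ 2 * δ := by linarith [hsδ t ht]
    have h2 : Ce * (2 * δ) ≤ η := by
      have : (Ce + 1) * (2 * δ) = η := by rw [hδ]; field_simp
      nlinarith
    have h3 := mul_le_mul_of_nonneg_left h1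
      (show 0 ≤ Ce * (1 + ‖x t‖) by positivity)
    have h4 := mul_le_mul_of_nonneg_right h2 (show 0 ≤ 1 + ‖x t‖ by positivity)
    linarith [herr t ht]
  have hηc : LTVTracking.trackConst μ ℓ σ * b * η * (1 / (1 - γ)) ≤ 1 / 2 := by
    have h1 : LTVTracking.trackConst μ ℓ σ * b * η * (1 / (1 - γ)) =
        LTVTracking.trackConst μ ℓ σ * b / (LTVTracking.trackConst μ ℓ σ * b + 1) * (1 / 2) := by
      rw [hη]; field_simp
    rw [h1]
    have h2 : LTVTracking.trackConst μ ℓ σ * b / (LTVTracking.trackConst μ ℓ σ * b + 1) ≤ 1 := by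
      rw [div_le_one hGb]; linarith
    linarith
  have hbound := LTVTracking.one_add_norm_le_of_input_err_le hS hμ hℓ hσ a.2 b.2 hξ hx hY
    (d := Dopt) (fun t ht => by rw [← heq.1 t (Nat.zero_le t) ht]; exact hxs t ht) hη0.le hηc herrη
  have hreg := LTVTracking.totalCost_sub_le_sum hS hμ hℓ hσ hξ hx hY
  have hcost : S.totalCost ξ xs us = S.costToGo ξ 0 (Y 0) (V 0) := by
    rw [LTVTracking.totalCost_eq_costToGo]
    exact LTVTracking.costToGo_congr (Nat.zero_le T) heq.1 heq.2
  rw [← hcost] at hreg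
  set W := ∑ τ ∈ Finset.range k, √γ ^ τ * predPower T ξ pred τ with hW
  have hW0 : 0 ≤ W := Finset.sum_nonneg fun τ _ => mul_nonneg (by positivity)
    (Finset.sum_nonneg fun i _ => by positivity)
  have hsumS := LTVTracking.sum_sum_predErr_sq_le hγ0.le hγ1 hγlam T k ξ pred
  -- Only the second summand under the root is needed: its root is `T * γ ^ (k / 2)`, which exceeds
  -- `T * γ ^ (2 * k)`.
  have hroot : (T : ℝ) * (γ ^ k) ^ 2 ≤ √(T * W + √γ ^ (2 * k) * (T : ℝ) ^ 2) := by
    refine Real.le_sqrt_of_sq_le ?_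
    have h1 : √γ ^ (2 * k) = γ ^ k := by rw [pow_mul, hsq]
    have h2 : γ ^ k ≤ 1 := pow_le_one₀ hγ0.le hγ1.le
    have h3 : 0 ≤ γ ^ k := by positivity
    have h4 : (γ ^ k) ^ 4 ≤ γ ^ k := by
      simpa using pow_le_pow_of_le_one h3 h2 (by norm_num : 1 ≤ 4)
    have h5 := mul_le_mul_of_nonneg_left h4 (sq_nonneg (T : ℝ))
    have h6 : (0 : ℝ) ≤ T * W := by positivity
    rw [h1]
    nlinarith
  have hterm : ∀ t ∈ Finset.range T, ‖v t - V t t‖ ^ 2 ≤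
      (Ce * (2 * (1 + Dopt))) ^ 2 * 2 * (s t ^ 2 + (γ ^ k) ^ 2) := fun t ht => by
    have ht := Finset.mem_range.1 ht
    have h3 : 0 ≤ γ ^ k := by positivity
    have h1 : ‖v t - V t t‖ ≤ Ce * (2 * (1 + Dopt)) * (s t + γ ^ k) :=
      (herr t ht).trans (mul_le_mul_of_nonneg_right
        (mul_le_mul_of_nonneg_left (hbound t ht.le) hCe0) (add_nonneg (hs0 t) h3))
    have h2 := pow_le_pow_left₀ (norm_nonneg _) h1 2
    rw [mul_pow] at h2
    have h4 : (s t + γ ^ k) ^ 2 ≤ 2 * (s t ^ 2 + (γ ^ k) ^ 2) := by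
      nlinarith [sq_nonneg (s t - γ ^ k)]
    have h5 := mul_le_mul_of_nonneg_left h4 (sq_nonneg (Ce * (2 * (1 + (Dopt : ℝ)))))
    linarith
  have hsum := Finset.sum_le_sum hterm
  rw [← Finset.mul_sum, Finset.sum_add_distrib, Finset.sum_const, Finset.card_range,
    nsmul_eq_mul] at hsum
  have hinv : 1 ≤ 1 / (1 - γ) := by rw [le_div_iff₀ h1γ]; linarith
  set r := √(T * W + √γ ^ (2 * k) * (T : ℝ) ^ 2) with hr
  have hr0 : 0 ≤ r := Real.sqrt_nonneg _
  have hfin : ∑ t ∈ Finset.range T, s t ^ 2 + T * (γ ^ k) ^ 2 ≤ 1 / (1 - γ) * (r + W) := by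
    have := le_mul_of_one_le_left hr0 hinv
    linarith
  have h1 := mul_le_mul_of_nonneg_left hfin
    (show 0 ≤ (Ce * (2 * (1 + (Dopt : ℝ)))) ^ 2 * 2 by positivity)
  have h2 := mul_le_mul_of_nonneg_left (hsum.trans h1) hJ
  linarith
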